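/- Let $(\mathcal C,\otimes,I,C)$ be a braided tensor category and let $H$ be a Hopf algebra in $\mathcal C$ which is finite, i.e. the object $H$ has a left dual $H^*$ with evaluation $\langle\,,\rangle : H^*\otimes H\to I$ and coevaluation $I\to H\otimes H^*$. Assume that the braiding is symmetric on $H$, i.e. $C_{H,H}=C_{H,H}^{-1}$. Then there is a unique Hopf algebra structure on $H^*$ in $\mathcal C$ that makes it the quasi-dual of $H$ under $\langle\,,\rangle$, i.e. such that $$(\langle\,,\rangle\otimes\langle\,,\rangle)(H^*\otimes C_{H^*,H}\otimes H)(\Delta_{H^*}\otimes H\otimes H)=\langle\,,\rangle(H^*\otimes m_H),\qquad \epsilon_{H^*}=\langle\,,\rangle(H^*\otimes\eta_H),$$ $$\langle\,,\rangle(m_{H^*}\otimes H)=(\langle\,,\rangle\otimes\langle\,,\rangle)(H^*\otimes C_{H^*,H}\otimes H)(H^*\otimes H^*\otimes\Delta_H),\qquad \langle\,,\rangle(\eta_{H^*}\otimes H)=\epsilon_H,$$ $$\langle\,,\rangle(S_{H^*}\otimes H)=\langle\,,\rangle(H^*\otimes S_H).$$ With this structure, let $R$ be an algebra in $\mathcal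 C$ and let $\psi:R\to R\otimes H^*$ make $R$ a right $H^*$-comodule algebra. Then: * $R$ is a left $H$-module algebra via $(R\otimes\langle\,,\rangle)(R\otimes C_{H,H^*})(C_{H,R}\otimes H^*)(H\otimes\psi)$; * $H$ is a left $H^*$-module algebra via $\rightharpoonup\;=(H\otimes\langle\,,\rangle)(C_{H^*,H}\otimes H)(H^*\otimes\Delta_H)$; * $R\#H$ is a left $H^*$-module algebra via $(R\otimes\rightharpoonup)(C_{H^*,R}\otimes H)$ (trivial action on $R$, and $\rightharpoonup$ on $H$); and, for the smash products formed with these actions, $$(R\#H)\#H^*\;\cong\;R\otimes(H\#H^*)\qquad\text{as algebras in }\mathcal C.$$ Here the smash product $A\#B$ of a Hopf algebra $B$ and a left $B$-module algebra $(A,\alpha)$ is the object $A\otimes B$ with unit $\eta_A\otimes\eta_B$ and multiplication $(m_A\otimes m_B)(A\otimes\alpha\otimes B\otimes B)(A\otimes B\otimes C_{B,A}\otimes B)(A\otimes\Delta_B\otimes A\otimes B)$, and $R\otimes(H\#H^*)$ is the braided tensor product of algebras, with multiplication $(m_R\otimes m_{H\#H^*})(R\otimes C_{H\#H^*,R}\otimes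 (H\#H^*))$. -/

import Mathlib

open CategoryTheory MonoidalCategory MonObj ComonObj

universe v u

namespace BraidedDuality

variable {C : Type u} [Category.{v} C] [MonoidalCategory C] [BraidedCategory C]

/-- `act : B ⊗ A ⟶ A` makes the algebra `A` a left `B`-module algebra, for a bialgebra `B` in the
braided category `C`: it is a left module structure for which multiplication and unit of `A`
are `B`-linear, i.e. `b · 1 = ε(b) 1` and `b · (a a') = (b₁ · a) (b₂ · a')` (where `b₂` is moved
past `a` by the braiding). -/
structure IsModuleAlgebra (B : C) [BimonObj B] (A : Mon C) (act : B ⊗ A.X ⟶ A.X) : Prop where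
  one_act : η[B] ▷ A.X ≫ act = (λ_ A.X).hom
  mul_act : μ[B] ▷ A.X ≫ act = (α_ B B A.X).hom ≫ B ◁ act ≫ act
  act_one : B ◁ η[A.X] ≫ act = (ρ_ B).hom ≫ ε[B] ≫ η[A.X]
  act_mul : B ◁ μ[A.X] ≫ act =
    Δ[B] ▷ (A.X ⊗ A.X) ≫ tensorμ B B A.X A.X ≫ (act ⊗ₘ act) ≫ μ[A.X]

/-- The morphism `b ⊗ a ↦ b₁ · a ⊗ b₂`, where `b₂` is moved past `a` by the braiding
`C_{B, A}`. -/
def twist {B A : C} [ComonObj B] (act : B ⊗ A ⟶ A) : B ⊗ A ⟶ A ⊗ B :=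
  Δ[B] ▷ A ≫ (α_ B B A).hom ≫ B ◁ (β_ B A).hom ≫ (α_ B A B).inv ≫ act ▷ B

section
variable {B : C} [BimonObj B] {A : Mon C} {act : B ⊗ A.X ⟶ A.X}

theorem one_twist (h : IsModuleAlgebra B A act) :
    η[B] ▷ A.X ≫ twist act = (λ_ A.X).hom ≫ (ρ_ A.X).inv ≫ A.X ◁ η[B] := by
  have e : η[B] ≫ Δ[B] = (λ_ (𝟙_ C)).inv ≫ (η[B] ▷ 𝟙_ C) ≫ B ◁ η[B] := by
    rw [BimonObj.one_comul]; rw [MonObj.tensorObj.one_def, MonoidalCategory.tensorHom_def]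
  calc η[B] ▷ A.X ≫ twist act
      = (η[B] ≫ Δ[B]) ▷ A.X ≫ (α_ B B A.X).hom ≫ B ◁ (β_ B A.X).hom ≫
          (α_ B A.X B).inv ≫ act ▷ B := by rw [twist, comp_whiskerRight_assoc]
    _ = 𝟙 _ ⊗≫ η[B] ▷ (𝟙_ C ⊗ A.X) ⊗≫ B ◁ (η[B] ▷ A.X ≫ (β_ B A.X).hom) ⊗≫ act ▷ B := by
        rw [e]; monoidal
    _ = 𝟙 _ ⊗≫ (η[B] ▷ (𝟙_ C ⊗ A.X) ≫ B ◁ ((β_ (𝟙_ C) A.X).hom ≫ A.X ◁ η[B])) ⊗≫ act ▷ B := by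
        rw [BraidedCategory.braiding_naturality_left]; monoidal
    _ = 𝟙 _ ⊗≫ (η[B] ▷ (A.X ⊗ 𝟙_ C) ≫ B ◁ (A.X ◁ η[B])) ⊗≫ act ▷ B := by
        rw [braiding_tensorUnit_left]; monoidal
    _ = 𝟙 _ ⊗≫ A.X ◁ η[B] ⊗≫ (η[B] ▷ A.X ≫ act) ▷ B ⊗≫ 𝟙 _ := by
        rw [← whisker_exchange]; monoidal
    _ = _ := by rw [h.one_act]; monoidal

theorem twist_one (h : IsModuleAlgebra B A act) :
    B ◁ η[A.X] ≫ twist act = (ρ_ B).hom ≫ (λ_ B).inv ≫ η[A.X] ▷ B := by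
  calc B ◁ η[A.X] ≫ twist act
      = 𝟙 _ ⊗≫ (B ◁ η[A.X] ≫ Δ[B] ▷ A.X) ⊗≫ B ◁ (β_ B A.X).hom ⊗≫ act ▷ B := by
        rw [twist]; monoidal
    _ = 𝟙 _ ⊗≫ Δ[B] ▷ 𝟙_ C ⊗≫ B ◁ (B ◁ η[A.X] ≫ (β_ B A.X).hom) ⊗≫ act ▷ B := by
        rw [whisker_exchange]; monoidal
    _ = 𝟙 _ ⊗≫ Δ[B] ⊗≫ (B ◁ η[A.X] ≫ act) ▷ B := by
        rw [BraidedCategory.braiding_naturality_right, braiding_tensorUnit_right]; monoidal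
    _ = 𝟙 _ ⊗≫ (Δ[B] ≫ ε[B] ▷ B) ⊗≫ η[A.X] ▷ B := by
        rw [h.act_one]; monoidal
    _ = _ := by rw [ComonObj.counit_comul]; monoidal

theorem mul_twist (h : IsModuleAlgebra B A act) :
    μ[B] ▷ A.X ≫ twist act = (α_ B B A.X).hom ≫ B ◁ twist act ≫ (α_ B A.X B).inv ≫
      twist act ▷ B ≫ (α_ A.X B B).hom ≫ A.X ◁ μ[B] := by
  calc μ[B] ▷ A.X ≫ twist act
      = (μ[B] ≫ Δ[B]) ▷ A.X ≫ (α_ B B A.X).hom ≫ B ◁ (β_ B A.X).hom ≫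
          (α_ B A.X B).inv ≫ act ▷ B := by rw [twist, comp_whiskerRight_assoc]
    _ = 𝟙 _ ⊗≫ (Δ[B] ⊗ₘ Δ[B]) ▷ A.X ⊗≫ B ◁ (β_ B B).hom ▷ B ▷ A.X ⊗≫
          (μ[B] ▷ (B ⊗ B) ≫ B ◁ μ[B]) ▷ A.X ⊗≫ B ◁ (β_ B A.X).hom ⊗≫ act ▷ B := by
        rw [BimonObj.mul_comul, tensorμ, MonoidalCategory.tensorHom_def μ[B]]; monoidal
    _ = 𝟙 _ ⊗≫ (Δ[B] ⊗ₘ Δ[B]) ▷ A.X ⊗≫ B ◁ (β_ B B).hom ▷ B ▷ A.X ⊗≫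
          μ[B] ▷ (B ⊗ B) ▷ A.X ⊗≫ B ◁ (μ[B] ▷ A.X ≫ (β_ B A.X).hom) ⊗≫ act ▷ B := by
        monoidal
    _ = 𝟙 _ ⊗≫ (Δ[B] ⊗ₘ Δ[B]) ▷ A.X ⊗≫ B ◁ (β_ B B).hom ▷ B ▷ A.X ⊗≫
          (μ[B] ▷ ((B ⊗ B) ⊗ A.X) ≫ B ◁ ((β_ (B ⊗ B) A.X).hom ≫ A.X ◁ μ[B])) ⊗≫ act ▷ B := by
        rw [BraidedCategory.braiding_naturality_left]; monoidal
    _ = 𝟙 _ ⊗≫ (Δ[B] ⊗ₘ Δ[B]) ▷ A.X ⊗≫ B ◁ (β_ B B).hom ▷ B ▷ A.X ⊗≫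
          (B ⊗ B) ◁ (β_ (B ⊗ B) A.X).hom ⊗≫
          (((B ⊗ B) ⊗ A.X) ◁ μ[B] ≫ (μ[B] ▷ A.X ≫ act) ▷ B) := by
        rw [← whisker_exchange]; monoidal
    _ = 𝟙 _ ⊗≫ (Δ[B] ⊗ₘ Δ[B]) ▷ A.X ⊗≫ B ◁ (β_ B B).hom ▷ B ▷ A.X ⊗≫
          (B ⊗ B) ◁ (β_ (B ⊗ B) A.X).hom ⊗≫ (μ[B] ▷ A.X ≫ act) ▷ (B ⊗ B) ⊗≫
          A.X ◁ μ[B] := by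
        rw [whisker_exchange]; monoidal
    _ = 𝟙 _ ⊗≫ (Δ[B] ▷ (B ⊗ A.X) ≫ (B ⊗ B) ◁ Δ[B] ▷ A.X) ⊗≫ B ◁ (β_ B B).hom ▷ B ▷ A.X ⊗≫
          B ◁ B ◁ B ◁ (β_ B A.X).hom ⊗≫ B ◁ B ◁ (β_ B A.X).hom ▷ B ⊗≫
          B ◁ act ▷ (B ⊗ B) ⊗≫ act ▷ (B ⊗ B) ⊗≫ A.X ◁ μ[B] := by
        rw [h.mul_act, BraidedCategory.braiding_tensor_left_hom, MonoidalCategory.tensorHom_def]; monoidal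
    _ = 𝟙 _ ⊗≫ B ◁ Δ[B] ▷ A.X ⊗≫ (Δ[B] ▷ (B ⊗ B ⊗ A.X)) ⊗≫ (B ◁ ((β_ B B).hom ▷ (B ⊗ A.X) ≫
          (B ⊗ B) ◁ (β_ B A.X).hom)) ⊗≫ B ◁ B ◁ (β_ B A.X).hom ▷ B ⊗≫
          B ◁ act ▷ (B ⊗ B) ⊗≫ act ▷ (B ⊗ B) ⊗≫ A.X ◁ μ[B] := by
        rw [← whisker_exchange]; monoidal
    _ = 𝟙 _ ⊗≫ B ◁ Δ[B] ▷ A.X ⊗≫ (Δ[B] ▷ (B ⊗ B ⊗ A.X) ≫ (B ⊗ B) ◁ B ◁ (β_ B A.X).hom) ⊗≫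
          B ◁ (((β_ B B).hom ▷ A.X ⊗≫ B ◁ (β_ B A.X).hom) ⊗≫ act ▷ B) ▷ B ⊗≫
          act ▷ (B ⊗ B) ⊗≫ A.X ◁ μ[B] := by
        rw [← whisker_exchange]; monoidal
    _ = 𝟙 _ ⊗≫ B ◁ Δ[B] ▷ A.X ⊗≫ B ◁ B ◁ (β_ B A.X).hom ⊗≫ Δ[B] ▷ (B ⊗ A.X ⊗ B) ⊗≫
          B ◁ ((β_ B (B ⊗ A.X)).hom ≫ act ▷ B) ▷ B ⊗≫
          act ▷ (B ⊗ B) ⊗≫ A.X ◁ μ[B] := by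
        rw [← whisker_exchange, BraidedCategory.braiding_tensor_right_hom]; monoidal
    _ = 𝟙 _ ⊗≫ B ◁ Δ[B] ▷ A.X ⊗≫ B ◁ B ◁ (β_ B A.X).hom ⊗≫
          (Δ[B] ▷ (B ⊗ A.X) ≫ (B ⊗ B) ◁ act) ▷ B ⊗≫ B ◁ (β_ B A.X).hom ▷ B ⊗≫
          act ▷ (B ⊗ B) ⊗≫ A.X ◁ μ[B] := by
        rw [← BraidedCategory.braiding_naturality_right]; monoidal
    _ = _ := by
        rw [← whisker_exchange]; simp only [twist]; monoidal

theorem twist_mul (h : IsModuleAlgebra B A act) :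
    B ◁ μ[A.X] ≫ twist act = (α_ B A.X A.X).inv ≫ twist act ▷ A.X ≫ (α_ A.X B A.X).hom ≫
      A.X ◁ twist act ≫ (α_ A.X A.X B).inv ≫ μ[A.X] ▷ B := by
  calc B ◁ μ[A.X] ≫ twist act
      = 𝟙 _ ⊗≫ (B ◁ μ[A.X] ≫ Δ[B] ▷ A.X) ⊗≫ B ◁ (β_ B A.X).hom ⊗≫ act ▷ B := by
        rw [twist]; monoidal
    _ = 𝟙 _ ⊗≫ Δ[B] ▷ (A.X ⊗ A.X) ⊗≫ B ◁ (B ◁ μ[A.X] ≫ (β_ B A.X).hom) ⊗≫ act ▷ B := by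
        rw [whisker_exchange]; monoidal
    _ = 𝟙 _ ⊗≫ Δ[B] ▷ (A.X ⊗ A.X) ⊗≫ B ◁ (β_ B (A.X ⊗ A.X)).hom ⊗≫
          (B ◁ μ[A.X] ≫ act) ▷ B := by
        rw [BraidedCategory.braiding_naturality_right]; monoidal
    _ = 𝟙 _ ⊗≫ Δ[B] ▷ (A.X ⊗ A.X) ⊗≫
          (B ◁ (β_ B (A.X ⊗ A.X)).hom ≫ Δ[B] ▷ ((A.X ⊗ A.X) ⊗ B)) ⊗≫
          B ◁ (β_ B A.X).hom ▷ A.X ▷ B ⊗≫ (act ▷ (B ⊗ A.X) ≫ A.X ◁ act) ▷ B ⊗≫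
          μ[A.X] ▷ B := by
        rw [h.act_mul, tensorμ, MonoidalCategory.tensorHom_def act]; monoidal
    _ = 𝟙 _ ⊗≫ (Δ[B] ≫ Δ[B] ▷ B ≫ (α_ B B B).hom) ▷ (A.X ⊗ A.X) ⊗≫
          B ◁ B ◁ (β_ B (A.X ⊗ A.X)).hom ⊗≫
          B ◁ (β_ B A.X).hom ▷ A.X ▷ B ⊗≫ act ▷ (B ⊗ A.X ⊗ B) ⊗≫ A.X ◁ act ▷ B ⊗≫
          μ[A.X] ▷ B := by
        rw [whisker_exchange]; monoidal
    _ = 𝟙 _ ⊗≫ Δ[B] ▷ (A.X ⊗ A.X) ⊗≫ B ◁ Δ[B] ▷ (A.X ⊗ A.X) ⊗≫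
          B ◁ B ◁ (β_ B A.X).hom ▷ A.X ⊗≫
          B ◁ ((B ⊗ A.X) ◁ (β_ B A.X).hom ≫ (β_ B A.X).hom ▷ (A.X ⊗ B)) ⊗≫
          act ▷ (B ⊗ A.X ⊗ B) ⊗≫ A.X ◁ act ▷ B ⊗≫ μ[A.X] ▷ B := by
        rw [← ComonObj.comul_assoc, BraidedCategory.braiding_tensor_right_hom]; monoidal
    _ = 𝟙 _ ⊗≫ Δ[B] ▷ (A.X ⊗ A.X) ⊗≫
          B ◁ (Δ[B] ▷ A.X ≫ (α_ B B A.X).hom ≫ B ◁ (β_ B A.X).hom ≫ (α_ B A.X B).inv ≫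
            (β_ B A.X).hom ▷ B) ▷ A.X ⊗≫
          ((B ⊗ A.X) ◁ B ◁ (β_ B A.X).hom ≫ act ▷ (B ⊗ A.X ⊗ B)) ⊗≫
          A.X ◁ act ▷ B ⊗≫ μ[A.X] ▷ B := by
        rw [whisker_exchange]; monoidal
    _ = 𝟙 _ ⊗≫ Δ[B] ▷ (A.X ⊗ A.X) ⊗≫
          B ◁ (Δ[B] ▷ A.X ≫ (β_ (B ⊗ B) A.X).hom) ▷ A.X ⊗≫
          act ▷ (B ⊗ B ⊗ A.X) ⊗≫ A.X ◁ B ◁ (β_ B A.X).hom ⊗≫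
          A.X ◁ act ▷ B ⊗≫ μ[A.X] ▷ B := by
        rw [whisker_exchange, BraidedCategory.braiding_tensor_left_hom]; monoidal
    _ = 𝟙 _ ⊗≫ Δ[B] ▷ (A.X ⊗ A.X) ⊗≫ B ◁ (β_ B A.X).hom ▷ A.X ⊗≫
          ((B ⊗ A.X) ◁ Δ[B] ▷ A.X ≫ act ▷ ((B ⊗ B) ⊗ A.X)) ⊗≫ A.X ◁ B ◁ (β_ B A.X).hom ⊗≫
          A.X ◁ act ▷ B ⊗≫ μ[A.X] ▷ B := by
        rw [BraidedCategory.braiding_naturality_left]; monoidal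
    _ = _ := by
        rw [whisker_exchange]; simp only [twist]; monoidal

/-- The smash product algebra `A # B`: the object `A ⊗ B` with unit `1 ⊗ 1` and multiplication
`(m ⊗ m) (A ⊗ act ⊗ B ⊗ B) (A ⊗ B ⊗ C_{B, A} ⊗ B) (A ⊗ Δ ⊗ A ⊗ B)`, i.e.
`(a # b) (a' # b') = a (b₁ · a') # b₂ b'`. -/
def smash (h : IsModuleAlgebra B A act) : Mon C where
  X := A.X ⊗ B
  mon :=
    { one := (λ_ (𝟙_ C)).inv ≫ (η[A.X] ⊗ₘ η[B])
      mul := (α_ A.X B (A.X ⊗ B)).hom ≫ A.X ◁ (α_ B A.X B).inv ≫ A.X ◁ twist act ▷ B ≫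
        A.X ◁ (α_ A.X B B).hom ≫ (α_ A.X A.X (B ⊗ B)).inv ≫ (μ[A.X] ⊗ₘ μ[B])
      one_mul := by
        rw [MonoidalCategory.tensorHom_def η[A.X], MonoidalCategory.tensorHom_def μ[A.X]]
        calc _ = 𝟙 _ ⊗≫ (η[A.X] ▷ (𝟙_ C ⊗ A.X ⊗ B)) ⊗≫
                A.X ◁ (η[B] ▷ A.X ≫ twist act) ▷ B ⊗≫ μ[A.X] ▷ (B ⊗ B) ⊗≫ A.X ◁ μ[B] := by
              monoidal
          _ = 𝟙 _ ⊗≫ η[A.X] ▷ (A.X ⊗ B) ⊗≫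
                ((A.X ⊗ A.X) ◁ η[B] ▷ B ≫ μ[A.X] ▷ (B ⊗ B)) ⊗≫ A.X ◁ μ[B] := by
              rw [one_twist h]; monoidal
          _ = 𝟙 _ ⊗≫ (η[A.X] ▷ A.X ≫ μ[A.X]) ▷ B ⊗≫ A.X ◁ (η[B] ▷ B ≫ μ[B]) := by
              rw [whisker_exchange]; monoidal
          _ = _ := by rw [MonObj.one_mul, MonObj.one_mul]; monoidal
      mul_one := by
        rw [MonoidalCategory.tensorHom_def η[A.X], MonoidalCategory.tensorHom_def μ[A.X]]
        calc _ = 𝟙 _ ⊗≫ (A.X ⊗ B) ◁ ((η[A.X] ▷ 𝟙_ C) ≫ A.X ◁ η[B]) ⊗≫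
                A.X ◁ twist act ▷ B ⊗≫ μ[A.X] ▷ (B ⊗ B) ⊗≫ A.X ◁ μ[B] := by
              monoidal
          _ = 𝟙 _ ⊗≫ (A.X ⊗ B) ◁ (𝟙_ C ◁ η[B] ≫ η[A.X] ▷ B) ⊗≫
                A.X ◁ twist act ▷ B ⊗≫ μ[A.X] ▷ (B ⊗ B) ⊗≫ A.X ◁ μ[B] := by
              rw [whisker_exchange]
          _ = 𝟙 _ ⊗≫ (A.X ⊗ B) ◁ η[B] ⊗≫
                A.X ◁ (B ◁ η[A.X] ≫ twist act) ▷ B ⊗≫ μ[A.X] ▷ (B ⊗ B) ⊗≫ A.X ◁ μ[B] := by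
              monoidal
          _ = 𝟙 _ ⊗≫ A.X ◁ B ◁ η[B] ⊗≫ (A.X ◁ η[A.X] ≫ μ[A.X]) ▷ (B ⊗ B) ⊗≫ A.X ◁ μ[B] := by
              rw [twist_one h]; monoidal
          _ = 𝟙 _ ⊗≫ A.X ◁ (B ◁ η[B] ≫ μ[B]) := by rw [MonObj.mul_one]; monoidal
          _ = _ := by rw [MonObj.mul_one]; monoidal
      mul_assoc := by
        rw [MonoidalCategory.tensorHom_def μ[A.X]]
        calc _ = 𝟙 _ ⊗≫ A.X ◁ twist act ▷ B ▷ A.X ▷ B ⊗≫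
                μ[A.X] ▷ (B ⊗ B ⊗ A.X ⊗ B) ⊗≫ A.X ◁ (μ[B] ▷ A.X ≫ twist act) ▷ B ⊗≫
                μ[A.X] ▷ (B ⊗ B) ⊗≫ A.X ◁ μ[B] := by monoidal
          _ = 𝟙 _ ⊗≫ A.X ◁ twist act ▷ B ▷ A.X ▷ B ⊗≫
                (μ[A.X] ▷ (B ⊗ B ⊗ A.X ⊗ B) ≫ A.X ◁ (𝟙 (B ⊗ B ⊗ A.X ⊗ B) ⊗≫
                  B ◁ twist act ▷ B ⊗≫ twist act ▷ B ▷ B)) ⊗≫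
                ((A.X ⊗ A.X) ◁ μ[B] ▷ B ≫ μ[A.X] ▷ (B ⊗ B)) ⊗≫ A.X ◁ μ[B] := by
              rw [mul_twist h]; monoidal
          _ = 𝟙 _ ⊗≫ A.X ◁ twist act ▷ B ▷ A.X ▷ B ⊗≫
                (A.X ⊗ A.X) ◁ (𝟙 (B ⊗ B ⊗ A.X ⊗ B) ⊗≫
                  B ◁ twist act ▷ B ⊗≫ twist act ▷ B ▷ B) ⊗≫
                (μ[A.X] ▷ A.X ≫ μ[A.X]) ▷ (B ⊗ B ⊗ B) ⊗≫
                A.X ◁ (μ[B] ▷ B ≫ μ[B]) := by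
              rw [← whisker_exchange,
                show ((A.X ⊗ A.X) ◁ μ[B] ▷ B ≫ μ[A.X] ▷ (B ⊗ B)) = _ from whisker_exchange _ _]
              monoidal
          _ = 𝟙 _ ⊗≫ A.X ◁ ((twist act ▷ (B ⊗ A.X)) ≫ (A.X ⊗ B) ◁ twist act) ▷ B ⊗≫
                A.X ◁ A.X ◁ twist act ▷ B ▷ B ⊗≫
                A.X ◁ μ[A.X] ▷ (B ⊗ B ⊗ B) ⊗≫ (μ[A.X] ▷ (B ⊗ B ⊗ B) ≫
                A.X ◁ B ◁ μ[B]) ⊗≫ A.X ◁ μ[B] := by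
              rw [MonObj.mul_assoc, MonObj.mul_assoc]; monoidal
          _ = 𝟙 _ ⊗≫ A.X ◁ B ◁ A.X ◁ twist act ▷ B ⊗≫
                A.X ◁ ((α_ B A.X A.X).inv ≫ twist act ▷ A.X ≫ (α_ A.X B A.X).hom ≫
                  A.X ◁ twist act ≫ (α_ A.X A.X B).inv ≫ μ[A.X] ▷ B) ▷ (B ⊗ B) ⊗≫
                (A.X ⊗ A.X) ◁ B ◁ μ[B] ⊗≫ μ[A.X] ▷ (B ⊗ B) ⊗≫ A.X ◁ μ[B] := by
              rw [← whisker_exchange (twist act), ← whisker_exchange]; monoidal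
          _ = 𝟙 _ ⊗≫ A.X ◁ B ◁ A.X ◁ twist act ▷ B ⊗≫
                A.X ◁ B ◁ μ[A.X] ▷ (B ⊗ B) ⊗≫
                A.X ◁ (twist act ▷ (B ⊗ B) ≫ (A.X ⊗ B) ◁ μ[B]) ⊗≫
                μ[A.X] ▷ (B ⊗ B) ⊗≫ A.X ◁ μ[B] := by
              rw [← twist_mul h]; monoidal
          _ = _ := by
              rw [← whisker_exchange]; monoidal }
end
/-- `p` pairs two factors with two factors:
`(p ⊗ p) (K ⊗ C_{K, H} ⊗ H) : K ⊗ K ⊗ H ⊗ H ⟶ I`. -/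
def pairTwo {K H : C} (p : K ⊗ H ⟶ 𝟙_ C) : (K ⊗ K) ⊗ (H ⊗ H) ⟶ 𝟙_ C :=
  tensorμ K K H H ≫ (p ⊗ₘ p) ≫ (λ_ (𝟙_ C)).hom

/-- The Hopf algebra `K` is a quasi-dual of the Hopf algebra `H` under the pairing
`p : K ⊗ H ⟶ I`. -/
structure IsQuasiDual (K H : C) [HopfObj K] [HopfObj H] (p : K ⊗ H ⟶ 𝟙_ C) : Prop where
  comul_pair : Δ[K] ▷ (H ⊗ H) ≫ pairTwo p = K ◁ μ[H] ≫ p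
  counit_pair : ε[K] = (ρ_ K).inv ≫ K ◁ η[H] ≫ p
  mul_pair : μ[K] ▷ H ≫ p = (K ⊗ K) ◁ Δ[H] ≫ pairTwo p
  one_pair : η[K] ▷ H ≫ p = (λ_ H).hom ≫ ε[H]
  antipode_pair : HopfObj.antipode (X := K) ▷ H ≫ p = K ◁ HopfObj.antipode (X := H) ≫ p

/-- `ψ : R ⟶ R ⊗ K` makes the algebra `R` a right `K`-comodule algebra: it is a coassociative and
counital coaction, and an algebra morphism into the (braided) tensor product algebra `R ⊗ K`. -/
structure IsComoduleAlgebra (K : C) [BimonObj K] (R : Mon C) (ψ : R.X ⟶ R.X ⊗ K) : Prop where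
  coassoc : ψ ≫ ψ ▷ K ≫ (α_ R.X K K).hom = ψ ≫ R.X ◁ Δ[K]
  counit : ψ ≫ R.X ◁ ε[K] = (ρ_ R.X).inv
  map_one : η[R.X] ≫ ψ = (λ_ (𝟙_ C)).inv ≫ (η[R.X] ⊗ₘ η[K])
  map_mul : μ[R.X] ≫ ψ = (ψ ⊗ₘ ψ) ≫ tensorμ R.X K R.X K ≫ (μ[R.X] ⊗ₘ μ[K])

/-- The action of `H` on `R` obtained from a coaction `ψ` of `K` and a pairing `p` of `K` with `H`:
`(R ⊗ p) (R ⊗ C_{H, K}) (C_{H, R} ⊗ K) (H ⊗ ψ)`. -/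
def coactionAct {K H : C} (p : K ⊗ H ⟶ 𝟙_ C) {R : C} (ψ : R ⟶ R ⊗ K) : H ⊗ R ⟶ R :=
  H ◁ ψ ≫ (α_ H R K).inv ≫ (β_ H R).hom ▷ K ≫ (α_ R H K).hom ≫ R ◁ (β_ H K).hom ≫
    R ◁ p ≫ (ρ_ R).hom

/-- The action `⇀` of `K` on `H`: `(H ⊗ p) (C_{K, H} ⊗ H) (K ⊗ Δ)`. -/
def hitAct {K H : C} [ComonObj H] (p : K ⊗ H ⟶ 𝟙_ C) : K ⊗ H ⟶ H :=
  K ◁ Δ[H] ≫ (α_ K H H).inv ≫ (β_ K H).hom ▷ H ≫ (α_ H K H).hom ≫ H ◁ p ≫ (ρ_ H).hom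

/-- The action of `K` on `R ⊗ H` which is trivial on `R` and given by `act` on `H`:
`(R ⊗ act) (C_{K, R} ⊗ H)`. -/
def extendAct {K H : C} (R : C) (act : K ⊗ H ⟶ H) : K ⊗ (R ⊗ H) ⟶ R ⊗ H :=
  (α_ K R H).inv ≫ (β_ K R).hom ▷ H ≫ (α_ R K H).hom ≫ R ◁ act

end BraidedDuality

/-! Write K for the dual of H, Σ eᵢ ⊗ fⁱ for the coevaluation and S for antipodes, and use Sweedler
notation with the braidings suppressed; the diagrams keep track of them.

The structure on K is forced. K and H, and also K ⊗ K and H ⊗ H, are paired nondegenerately, so the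
quasi-dual equations determine every operation of K, and transposing the axioms of H gives those of
K. Bending strings carries the symmetry of C_{H,H} over to C_{K,H}, C_{H,K} and C_{K,K}. This is
`DualPair`, then `IsSymmDual.hopf` and `IsSymmDual.hopf_unique`.

The isomorphism is the Blattner–Montgomery one. The smash product E = H # K acts on H by (h # k)·x =
h (k ⇀ x), and an element of E can be recovered from its action (`rep_faithful`), so identities in E
may be checked on H. Let f(k) ∈ E act as x ↦ ⟨k, S⁻¹x₁⟩ x₂ and g(k) as x ↦ ⟨k, x₁⟩ x₂. Then f is an
algebra map (`mul_cleave`, `one_cleave`), g is its convolution inverse, and (h # k) f(k') = ⟨k'₂,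
h₁⟩ f(k'₁) (h₂ # k) (`join_cleave`). Hence r ⊗ e ↦ r₀ ⊗ f(r₁) e is invertible, with inverse r ⊗ e ↦
r₀ ⊗ g(r₁) e, and since h·r = r₀⟨r₁, h⟩ the commutation relation is exactly what makes it
multiplicative (`duality_mul`). No symmetry between R and the other objects is needed: strings cross
R by naturality only.

This needs S⁻¹ on H. Let H act on K by h·k = k₁⟨k₂, h⟩, and put P(k) = Σ S²(eᵢ)·(fⁱ k). Then P is
idempotent with values in the left integrals, k P(k') = ε(k) P(k'), and P(S(h)·k) = ε(h) P(k).
Together they give Σ eᵢ ⊗ P(fⁱ (S(h)·P(k))) = h ⊗ P(k), which recovers h from S(h) up to the factor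
P(k); the factor is removed by Σ ⟨S(eᵢ), P(fⁱ)⟩ = 1. So S has a left inverse. The same holds for K,
and transposing its left inverse gives a right inverse for H.

The calculations are done by reflection. A diagram is a list of boxes with positions, a proof of an
equation is a list of rewriting steps evaluated by `rfl`, and the soundness of the steps is proved
once (`Val.step`, `Total.holds`). The lemmas ending in `_iff` translate between diagram equations
and equations of morphisms. -/

namespace BraidedDuality

/-! ### String diagrams

A morphism between tensor products of given objects is described by the list of the boxes of a
string diagram, read from top to bottom. -/

/-- The objects that label the strings. -/
inductive Wire
  | R | H | K | E
  deriving DecidableEq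

/-- The boxes. -/
inductive Box
  | cross (x y : Wire)
  | mul (x : Wire) | one (x : Wire) | comul (x : Wire) | counit (x : Wire)
  | anti (x : Wire) | coanti (x : Wire)
  | act (x y : Wire) | pair (x y : Wire) | copair (x y : Wire)
  | proj (x : Wire) | coact (x y : Wire) | cleave (x y : Wire) | cleaveInv (x y : Wire)
  | join (x y z : Wire) | split (x y z : Wire)
  deriving DecidableEq

namespace Box

def dom : Box → List Wire
  | cross x y | act x y | pair x y | join x y _ => [x, y]
  | mul x => [x, x]
  | one _ | copair _ _ => []
  | comul x | counit x | anti x | coanti x | proj x | coact x _ | cleave x _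
  | cleaveInv x _ => [x]
  | split _ _ z => [z]

def cod : Box → List Wire
  | cross x y => [y, x]
  | mul x | one x | anti x | coanti x | proj x => [x]
  | comul x => [x, x]
  | counit _ | pair _ _ => []
  | act _ y | cleave _ y | cleaveInv _ y => [y]
  | copair x y | coact x y | split x y _ => [x, y]
  | join _ _ z => [z]

def isCross : Box → Bool
  | cross _ _ => true
  | _ => false

end Box

/-- A box placed to the right of a number of strings. -/
abbrev Layer := Box × ℕ

def shift (k : ℕ) (L : List Layer) : List Layer := L.map fun l => (l.1, l.2 + k)

/-! ### Values of diagrams in a monoidal category. -/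

section Semantics

variable {C : Type u} [Category.{v} C] [MonoidalCategory C]

/-- Nested to the right with a trailing unit, so that adding a string on the left is definitionally
a tensor product; the price is the unit that `flat` removes later. -/
def tens (obj : Wire → C) : List Wire → C
  | [] => 𝟙_ C
  | x :: l => obj x ⊗ tens obj l

/-- An interpretation of the strings and of some of the boxes. -/
structure Model (C : Type u) [Category.{v} C] [MonoidalCategory C] where
  obj : Wire → C
  box : ∀ g : Box, Option (tens obj g.dom ⟶ tens obj g.cod)

namespace Model

variable (M : Model C)

abbrev ob (l : List Wire) : C := tens M.obj l

def app : ∀ a b : List Wire, M.ob (a ++ b) ≅ M.ob a ⊗ M.ob b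
  | [], b => (λ_ (M.ob b)).symm
  | x :: a, b => whiskerLeftIso (M.obj x) (app a b) ≪≫ (α_ (M.obj x) (M.ob a) (M.ob b)).symm

/-- Needed because concatenation of lists is associative and right unital only propositionally. -/
def cast {a b : List Wire} (h : a = b) : M.ob a ⟶ M.ob b := eqToHom (congrArg M.ob h)

@[simp] theorem cast_rfl {a : List Wire} (h : a = a) : M.cast h = 𝟙 _ := rfl

instance {a b : List Wire} (h : a = b) : IsIso (M.cast h) := by
  unfold cast; infer_instance

/-- Coherence of the two ways to split three blocks of strings; it is what lets strings be added on
the right of a layer. -/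
theorem app_assoc (a b c : List Wire) :
    (M.app (a ++ b) c).hom ≫ (M.app a b).hom ▷ M.ob c =
      M.cast (List.append_assoc a b c) ≫ (M.app a (b ++ c)).hom ≫ M.ob a ◁ (M.app b c).hom ≫
        (α_ _ _ _).inv := by
  induction a with
  | nil => simp [app, tens, ob]
  | cons x a ih =>
    have e : M.cast (List.append_assoc (x :: a) b c) =
        M.obj x ◁ M.cast (List.append_assoc a b c) := by
      simp only [cast]; rw [whiskerLeft_eqToHom]; rfl
    have := congrArg (fun t => M.obj x ◁ t ≫ (α_ (M.obj x) (M.ob a ⊗ M.ob b) (M.ob c)).inv ≫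
      (α_ (M.obj x) (M.ob a) (M.ob b)).inv ▷ M.ob c) ih
    rw [e]
    simp only [app, tens, ob, List.cons_append, List.append_eq, Iso.trans_hom, whiskerLeftIso_hom,
        Iso.symm_hom, comp_whiskerRight,
      Category.assoc] at this ⊢
    refine Eq.trans ?_ (this.trans ?_)
    · simp only [MonoidalCategory.whiskerLeft_comp, Category.assoc]; simp
    · simp only [MonoidalCategory.whiskerLeft_comp, Category.assoc]; simp

variable [BraidedCategory C]

/-- A crossing is never left to the model: it is always the braiding, so every box with a value
slides through it by naturality. -/
def hom : ∀ g : Box, Option (M.ob g.dom ⟶ M.ob g.cod)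
  | .cross x y => some ((α_ (M.obj x) (M.obj y) (𝟙_ C)).inv ≫
      (β_ (M.obj x) (M.obj y)).hom ▷ 𝟙_ C ≫ (α_ (M.obj y) (M.obj x) (𝟙_ C)).hom)
  | g => M.box g

/-- `M.Lay g p a b f`: the box `g` to the right of `p` strings maps the strings `a` to `b`, and its
value in `M` is `f`. -/
inductive Lay (g : Box) : ℕ → ∀ a b : List Wire, (M.ob a ⟶ M.ob b) → Prop
  | here {a b : List Wire} {f : M.ob g.dom ⟶ M.ob g.cod} (post : List Wire)
      (hf : M.hom g = some f) (ha : a = g.dom ++ post) (hb : b = g.cod ++ post) :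
      Lay g 0 a b (M.cast ha ≫ (M.app g.dom post).hom ≫ f ▷ M.ob post ≫
        (M.app g.cod post).inv ≫ M.cast hb.symm)
  | there {p : ℕ} {a b : List Wire} {f : M.ob a ⟶ M.ob b} (x : Wire) (h : Lay g p a b f) :
      Lay g (p + 1) (x :: a) (x :: b) (M.obj x ◁ f)

/-- The value of a diagram. -/
inductive Val : ∀ a : List Wire, List Layer → ∀ b : List Wire, (M.ob a ⟶ M.ob b) → Prop
  | nil (a : List Wire) : Val a [] a (𝟙 _)
  | cons {a b c : List Wire} {l : Layer} {L : List Layer} {f : M.ob a ⟶ M.ob b}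
      {g : M.ob b ⟶ M.ob c} (h : M.Lay l.1 l.2 a b f) (h' : Val b L c g) : Val a (l :: L) c (f ≫ g)

variable {M}

/-- The relation is a partial function of the box, its position and the incoming strings. The
equality is heterogeneous because the outgoing strings are part of the output. -/
theorem Lay.unique {g : Box} {p : ℕ} {a b b' : List Wire} {f : M.ob a ⟶ M.ob b}
    {f' : M.ob a ⟶ M.ob b'} (h : M.Lay g p a b f) (h' : M.Lay g p a b' f') :
    b = b' ∧ HEq f f' := by
  induction h generalizing b' with
  | here post hf ha hb =>
    cases h' with
    | here post' hf' ha' hb' =>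
      subst ha
      obtain rfl := List.append_cancel_left ha'
      subst hb hb'
      rw [hf] at hf'
      cases hf'
      exact ⟨rfl, HEq.rfl⟩
  | there x h ih =>
    cases h' with
    | there _ h' =>
      obtain ⟨rfl, e⟩ := ih h'
      obtain rfl := eq_of_heq e
      exact ⟨rfl, HEq.rfl⟩

theorem Val.unique {a b b' : List Wire} {L : List Layer} {f : M.ob a ⟶ M.ob b}
    {f' : M.ob a ⟶ M.ob b'} (h : M.Val a L b f) (h' : M.Val a L b' f') : b = b' ∧ HEq f f' := by
  induction h generalizing b' with
  | nil a => cases h'; exact ⟨rfl, HEq.rfl⟩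
  | cons h _ ih =>
    cases h' with
    | cons h₁ h₂ =>
      obtain ⟨rfl, e⟩ := h.unique h₁
      obtain ⟨rfl, e'⟩ := ih h₂
      exact ⟨rfl, by rw [eq_of_heq e, eq_of_heq e']⟩

theorem Val.append {a b c : List Wire} {L L' : List Layer} {f : M.ob a ⟶ M.ob b}
    {g : M.ob b ⟶ M.ob c} (h : M.Val a L b f) (h' : M.Val b L' c g) :
    M.Val a (L ++ L') c (f ≫ g) := by
  induction h with
  | nil a => simpa using h'
  | cons h _ ih => rw [Category.assoc]; exact .cons h (ih h')

theorem Val.split {a c : List Wire} {L L' : List Layer} {f : M.ob a ⟶ M.ob c}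
    (h : M.Val a (L ++ L') c f) :
    ∃ b g g', M.Val a L b g ∧ M.Val b L' c g' ∧ f = g ≫ g' := by
  induction L generalizing a with
  | nil => exact ⟨a, 𝟙 _, f, .nil a, h, by simp⟩
  | cons l L ih =>
    cases h with
    | cons h₁ h₂ =>
      obtain ⟨b, g, g', h, h', rfl⟩ := ih h₂
      exact ⟨b, _, g', .cons h₁ h, h', by simp⟩

theorem Val.whiskerLeft {a b : List Wire} {L : List Layer} {f : M.ob a ⟶ M.ob b}
    (h : M.Val a L b f) (x : Wire) : M.Val (x :: a) (shift 1 L) (x :: b) (M.obj x ◁ f) := by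
  induction h with
  | nil a => rw [MonoidalCategory.whiskerLeft_id]; exact .nil _
  | cons h _ ih => rw [MonoidalCategory.whiskerLeft_comp]; exact .cons (.there x h) ih

theorem Lay.whiskerRight {g : Box} {p : ℕ} {a b : List Wire} {f : M.ob a ⟶ M.ob b}
    (h : M.Lay g p a b f) (q : List Wire) :
    M.Lay g p (a ++ q) (b ++ q) ((M.app a q).hom ≫ f ▷ M.ob q ≫ (M.app b q).inv) := by
  induction h with
  | here post hf ha hb =>
    rename_i f
    subst ha hb
    convert Lay.here (post ++ q) hf (List.append_assoc ..) (List.append_assoc ..) using 1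
    have e₁ := M.app_assoc g.dom post q
    have e₂ := M.app_assoc g.cod post q
    have e₃ : M.cast (List.append_assoc g.cod post q).symm =
        (M.app g.cod (post ++ q)).hom ≫ M.ob g.cod ◁ (M.app post q).hom ≫
        (α_ _ _ _).inv ≫ (M.app g.cod post).inv ▷ M.ob q ≫ (M.app (g.cod ++ post) q).inv := by
      have e₄ : M.cast (List.append_assoc g.cod post q) ≫
          M.cast (List.append_assoc g.cod post q).symm = 𝟙 _ := by simp [cast]
      have e₅ : M.cast (List.append_assoc g.cod post q).symm ≫
          M.cast (List.append_assoc g.cod post q) = 𝟙 _ := by simp [cast]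
      rw [← cancel_epi (M.cast (List.append_assoc g.cod post q)), e₄]
      simp only [← Category.assoc] at e₂ ⊢
      rw [← e₂]; simp
    rw [e₃]
    simp only [cast_rfl, Category.id_comp, Category.comp_id, comp_whiskerRight, Category.assoc]
    rw [reassoc_of% e₁]
    simp [← whisker_exchange_assoc]
  | there x h ih =>
    convert Lay.there x ih using 1
    simp [app, tens, ob]

theorem Val.whiskerRight {a b : List Wire} {L : List Layer} {f : M.ob a ⟶ M.ob b}
    (h : M.Val a L b f) (q : List Wire) :
    M.Val (a ++ q) L (b ++ q) ((M.app a q).hom ≫ f ▷ M.ob q ≫ (M.app b q).inv) := by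
  induction h with
  | nil a => simpa using Val.nil (a ++ q)
  | cons h _ ih => convert Val.cons (h.whiskerRight q) ih using 1; simp

theorem Lay.append {g : Box} {p : ℕ} {a b : List Wire} {f : M.ob a ⟶ M.ob b}
    (h : M.Lay g p a b f) (d : List Wire) :
    M.Lay g (d.length + p) (d ++ a) (d ++ b)
      ((M.app d a).hom ≫ M.ob d ◁ f ≫ (M.app d b).inv) := by
  induction d with
  | nil => simpa [app, tens, ob] using h
  | cons x d ih =>
    have := Lay.there x ih
    rw [Nat.add_right_comm] at this
    convert this using 1
    simp [app, tens, ob]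

theorem Lay.split {g : Box} {d n : ℕ} {a b : List Wire} {f : M.ob a ⟶ M.ob b}
    (h : M.Lay g (d + n) a b f) :
    ∃ e post post', ∃ h₀ : M.ob post ⟶ M.ob post', e.length = d ∧ M.Lay g n post post' h₀ ∧
      ∃ (ha : a = e ++ post) (hb : b = e ++ post'),
        f = M.cast ha ≫ (M.app e post).hom ≫ M.ob e ◁ h₀ ≫ (M.app e post').inv ≫
          M.cast hb.symm := by
  induction d generalizing a b with
  | zero =>
    rw [Nat.zero_add] at h
    exact ⟨[], a, b, f, rfl, h, rfl, rfl, by simp [app, tens, ob]⟩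
  | succ d ih =>
    rw [Nat.add_right_comm] at h
    cases h with
    | there x h =>
      obtain ⟨e, post, post', h₀, he, hl, rfl, rfl, rfl⟩ := ih h
      exact ⟨x :: e, post, post', h₀, by simp [he], hl, rfl, rfl, by simp [app, tens, ob]⟩

/-- The interchange law for boxes on disjoint strings. The box on the right changes position, since
the one on its left replaces its inputs by its outputs. -/
theorem Lay.interchange_right {g₁ g₂ : Box} {p n : ℕ} {a b c : List Wire}
    {f : M.ob a ⟶ M.ob b} {h : M.ob b ⟶ M.ob c} (h₁ : M.Lay g₁ p a b f)
    (h₂ : M.Lay g₂ (p + g₁.cod.length + n) b c h) :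
    ∃ b' f' h', M.Lay g₂ (p + g₁.dom.length + n) a b' h' ∧ M.Lay g₁ p b' c f' ∧
      f ≫ h = h' ≫ f' := by
  induction h₁ generalizing c with
  | here post hf ha hb =>
    rename_i f
    rw [Nat.zero_add] at h₂
    obtain ⟨e, post₁, post₂, h₀, he, hl, rfl, rfl, rfl⟩ := h₂.split
    obtain ⟨rfl, rfl⟩ := List.append_inj hb he
    subst ha
    rw [Nat.zero_add]
    refine ⟨_, _, _, hl.append g₁.dom, Lay.here post₂ hf rfl rfl, ?_⟩
    simp [← whisker_exchange_assoc]
  | there x h₁ ih =>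
    rename_i p _ _ _
    rw [show p + 1 + g₁.cod.length + n = p + g₁.cod.length + n + 1 by omega] at h₂
    rw [show p + 1 + g₁.dom.length + n = p + g₁.dom.length + n + 1 by omega]
    cases h₂ with
    | there _ h₂ =>
      obtain ⟨b', f', h', l₁, l₂, e⟩ := ih h₂
      exact ⟨_, _, _, .there x l₁, .there x l₂, 
        (MonoidalCategory.whiskerLeft_comp ..).symm.trans
          ((congrArg (M.obj x ◁ ·) e).trans (MonoidalCategory.whiskerLeft_comp ..))⟩

theorem Lay.interchange_left {g₁ g₂ : Box} {p n : ℕ} {a b c : List Wire}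
    {f : M.ob a ⟶ M.ob b} {h : M.ob b ⟶ M.ob c}
    (h₁ : M.Lay g₁ (p + g₂.dom.length + n) a b f) (h₂ : M.Lay g₂ p b c h) :
    ∃ b' f' h', M.Lay g₂ p a b' h' ∧ M.Lay g₁ (p + g₂.cod.length + n) b' c f' ∧
      f ≫ h = h' ≫ f' := by
  induction h₂ generalizing a with
  | here post hf ha hb =>
    rename_i f
    rw [Nat.zero_add] at h₁
    obtain ⟨e, post₁, post₂, h₀, he, hl, rfl, rfl, rfl⟩ := h₁.split
    obtain ⟨rfl, rfl⟩ := List.append_inj ha he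
    subst hb
    rw [Nat.zero_add]
    refine ⟨_, _, _, Lay.here post₁ hf rfl rfl, hl.append g₂.cod, ?_⟩
    simp [whisker_exchange_assoc]
  | there x h₂ ih =>
    rename_i p _ _ _
    rw [show p + 1 + g₂.dom.length + n = p + g₂.dom.length + n + 1 by omega] at h₁
    rw [show p + 1 + g₂.cod.length + n = p + g₂.cod.length + n + 1 by omega]
    cases h₁ with
    | there _ h₁ =>
      obtain ⟨b', f', h', l₁, l₂, e⟩ := ih h₁
      exact ⟨_, _, _, .there x l₁, .there x l₂, 
        (MonoidalCategory.whiskerLeft_comp ..).symm.trans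
          ((congrArg (M.obj x ◁ ·) e).trans (MonoidalCategory.whiskerLeft_comp ..))⟩

/-! ### Sliding a box along a string -/

/-- The string `w`, to the right of the strings `l`, moves to the left of `l`. -/
def passLeft (w : Wire) : List Wire → List Layer
  | [] => []
  | x :: l => shift 1 (passLeft w l) ++ [(.cross x w, 0)]

/-- The string `w`, to the left of the strings `l`, moves to the right of `l`. -/
def passRight (w : Wire) : List Wire → List Layer
  | [] => []
  | x :: l => (.cross w x, 0) :: shift 1 (passRight w l)

theorem Lay.congr {g : Box} {p : ℕ} {a b : List Wire} {f f' : M.ob a ⟶ M.ob b}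
    (h : M.Lay g p a b f) (e : f = f') : M.Lay g p a b f' := e ▸ h

theorem Val.congr {L : List Layer} {a b : List Wire} {f f' : M.ob a ⟶ M.ob b}
    (h : M.Val a L b f) (e : f = f') : M.Val a L b f' := e ▸ h

/-- Clears away the units that the general description of a layer inserts around the braiding. -/
theorem lay_cross (x y : Wire) (l : List Wire) :
    M.Lay (.cross x y) 0 (x :: y :: l) (y :: x :: l)
      ((α_ (M.obj x) (M.obj y) (M.ob l)).inv ≫ (β_ (M.obj x) (M.obj y)).hom ▷ M.ob l ≫
        (α_ (M.obj y) (M.obj x) (M.ob l)).hom) := by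
  refine (Lay.here (M := M) (g := .cross x y) l rfl rfl rfl).congr ?_
  change 𝟙 (M.obj x ⊗ M.obj y ⊗ M.ob l) ≫
    (M.obj x ◁ (M.obj y ◁ (λ_ (M.ob l)).inv ≫ (α_ (M.obj y) (𝟙_ C) (M.ob l)).inv) ≫
      (α_ (M.obj x) (M.obj y ⊗ 𝟙_ C) (M.ob l)).inv) ≫
    ((α_ (M.obj x) (M.obj y) (𝟙_ C)).inv ≫ (β_ (M.obj x) (M.obj y)).hom ▷ 𝟙_ C ≫
      (α_ (M.obj y) (M.obj x) (𝟙_ C)).hom) ▷ M.ob l ≫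
    ((α_ (M.obj y) (M.obj x ⊗ 𝟙_ C) (M.ob l)).hom ≫
      M.obj y ◁ ((α_ (M.obj x) (𝟙_ C) (M.ob l)).hom ≫ M.obj x ◁ (λ_ (M.ob l)).hom)) ≫
    𝟙 (M.obj y ⊗ M.obj x ⊗ M.ob l) = _
  monoidal

/-- By the hexagon identity, crossing the strings of `l` one at a time amounts to the braiding with
their whole tensor product. -/
theorem val_passLeft (w : Wire) (l : List Wire) :
    M.Val (l ++ [w]) (passLeft w l) (w :: l)
      ((M.app l [w]).hom ≫ M.ob l ◁ (ρ_ (M.obj w)).hom ≫ (β_ (M.ob l) (M.obj w)).hom) := by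
  induction l with
  | nil =>
    refine (Val.nil (M := M) [w]).congr ?_
    simp only [app, tens, ob, Iso.symm_hom, List.nil_append, braiding_tensorUnit_left]
    monoidal
  | cons x l ih =>
    refine ((ih.whiskerLeft x).append (.cons (l := (.cross x w, 0)) (lay_cross x w l)
      (.nil _))).congr ?_
    change M.obj x ◁ ((M.app l [w]).hom ≫ M.ob l ◁ (ρ_ (M.obj w)).hom ≫
        (β_ (M.ob l) (M.obj w)).hom) ≫ ((α_ (M.obj x) (M.obj w) (M.ob l)).inv ≫
        (β_ (M.obj x) (M.obj w)).hom ▷ M.ob l ≫ (α_ (M.obj w) (M.obj x) (M.ob l)).hom) ≫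
        𝟙 (M.obj w ⊗ M.obj x ⊗ M.ob l) =
      (M.obj x ◁ (M.app l [w]).hom ≫ (α_ (M.obj x) (M.ob l) (M.obj w ⊗ 𝟙_ C)).inv) ≫
        (M.obj x ⊗ M.ob l) ◁ (ρ_ (M.obj w)).hom ≫ (β_ (M.obj x ⊗ M.ob l) (M.obj w)).hom
    rw [BraidedCategory.braiding_tensor_left_hom]
    monoidal

theorem val_passRight (w : Wire) (l : List Wire) :
    M.Val (w :: l) (passRight w l) (l ++ [w])
      ((β_ (M.obj w) (M.ob l)).hom ≫ M.ob l ◁ (ρ_ (M.obj w)).inv ≫ (M.app l [w]).inv) := by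
  induction l with
  | nil =>
    refine (Val.nil (M := M) [w]).congr ?_
    simp only [app, tens, ob, Iso.symm_inv, List.nil_append, braiding_tensorUnit_right]
    monoidal
  | cons x l ih =>
    refine (Val.cons (l := (.cross w x, 0)) (lay_cross w x l) (ih.whiskerLeft x)).congr ?_
    change ((α_ (M.obj w) (M.obj x) (M.ob l)).inv ≫ (β_ (M.obj w) (M.obj x)).hom ▷ M.ob l ≫
        (α_ (M.obj x) (M.obj w) (M.ob l)).hom) ≫ M.obj x ◁ ((β_ (M.obj w) (M.ob l)).hom ≫
        M.ob l ◁ (ρ_ (M.obj w)).inv ≫ (M.app l [w]).inv) =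
      (β_ (M.obj w) (M.obj x ⊗ M.ob l)).hom ≫ (M.obj x ⊗ M.ob l) ◁ (ρ_ (M.obj w)).inv ≫
        ((α_ (M.obj x) (M.ob l) (M.obj w ⊗ 𝟙_ C)).hom ≫ M.obj x ◁ (M.app l [w]).inv)
    rw [BraidedCategory.braiding_tensor_right_hom]
    monoidal

/-- The unit counterpart of `app_assoc`; through it, a box with no strings beside it has its own
value (`Lay.gen`). -/
theorem app_nil (a : List Wire) : M.cast (List.append_nil a).symm ≫ (M.app a []).hom =
    (ρ_ (M.ob a)).inv := by
  induction a with
  | nil => simp only [app, tens, ob, Iso.symm_hom, cast_rfl, List.nil_append]; monoidal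
  | cons x a ih =>
    have e : M.cast (List.append_nil (x :: a)).symm =
        M.obj x ◁ M.cast (List.append_nil a).symm := by
      simp only [cast]; rw [whiskerLeft_eqToHom]; rfl
    have := congrArg (fun t => M.obj x ◁ t ≫ (α_ (M.obj x) (M.ob a) (𝟙_ C)).inv) ih
    rw [e]
    simp only [app, tens, ob, Iso.trans_hom, whiskerLeftIso_hom, Iso.symm_hom,
      List.cons_append, List.append_eq, MonoidalCategory.whiskerLeft_comp,
      Category.assoc] at this ⊢
    refine this.trans ?_
    simp

theorem Lay.gen {g : Box} {f : M.ob g.dom ⟶ M.ob g.cod} (hf : M.hom g = some f) :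
    M.Lay g 0 g.dom g.cod f := by
  have h := Lay.here (M := M) [] hf (List.append_nil _).symm (List.append_nil _).symm
  refine h.congr ?_
  have e : (M.app g.cod []).inv ≫ M.cast (List.append_nil g.cod) =
      (ρ_ (M.ob g.cod)).hom := by
    refine (cancel_epi (ρ_ (M.ob g.cod)).inv).1 ?_
    refine (congrArg (· ≫ (M.app g.cod []).inv ≫ M.cast (List.append_nil g.cod))
      (app_nil g.cod)).symm.trans ?_
    simp [cast]
  calc _ = (M.cast (List.append_nil g.dom).symm ≫ (M.app g.dom []).hom) ≫ f ▷ M.ob [] ≫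
        (M.app g.cod []).inv ≫ M.cast (List.append_nil g.cod) := by simp
    _ = (ρ_ (M.ob g.dom)).inv ≫ f ▷ 𝟙_ C ≫ (ρ_ (M.ob g.cod)).hom := by rw [e, app_nil]; rfl
    _ = f := by simp

/-! ### Rewriting -/

variable (M) in
/-- Two diagrams have the same value. -/
def Holds (a : List Wire) (L L' : List Layer) : Prop :=
  ∃ b f, M.Val a L b f ∧ M.Val a L' b f

theorem Holds.symm {a : List Wire} {L L' : List Layer} (h : M.Holds a L L') : M.Holds a L' L :=
  let ⟨b, f, h, h'⟩ := h; ⟨b, f, h', h⟩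

omit M in
-- Naturality of the braiding, with the splittings of lists replaced by arbitrary isomorphisms so
-- that no list has to be unfolded.
theorem braiding_slide_left {A B W P Q : C} (f : A ⟶ B) (i : P ≅ A ⊗ W ⊗ 𝟙_ C)
    (j : Q ≅ B ⊗ W ⊗ 𝟙_ C) :
    (i.hom ≫ A ◁ (ρ_ W).hom ≫ (β_ A W).hom) ≫ W ◁ f ≫ 𝟙 (W ⊗ B) =
      (𝟙 P ≫ i.hom ≫ f ▷ (W ⊗ 𝟙_ C) ≫ j.inv ≫ 𝟙 Q) ≫ j.hom ≫ B ◁ (ρ_ W).hom ≫ (β_ B W).hom := by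
  have e : f ▷ (W ⊗ 𝟙_ C) ≫ B ◁ (ρ_ W).hom = A ◁ (ρ_ W).hom ≫ f ▷ W :=
    (whisker_exchange _ _).symm
  simp [reassoc_of% e]

omit M in
theorem braiding_slide_right {A B W P Q : C} (f : A ⟶ B) (i : P ≅ A ⊗ W ⊗ 𝟙_ C)
    (j : Q ≅ B ⊗ W ⊗ 𝟙_ C) :
    ((β_ W A).hom ≫ A ◁ (ρ_ W).inv ≫ i.inv) ≫
      (𝟙 P ≫ i.hom ≫ f ▷ (W ⊗ 𝟙_ C) ≫ j.inv ≫ 𝟙 Q) ≫ 𝟙 Q =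
      W ◁ f ≫ (β_ W B).hom ≫ B ◁ (ρ_ W).inv ≫ j.inv := by
  have e : A ◁ (ρ_ W).inv ≫ f ▷ (W ⊗ 𝟙_ C) = f ▷ W ≫ B ◁ (ρ_ W).inv := whisker_exchange _ _
  simp [reassoc_of% e]

variable (M) in
/-- A box, to the left of the string `w`, slides along it. -/
theorem slideLeft (g : Box) (w : Wire) (hg : (M.hom g).isSome) :
    M.Holds (g.dom ++ [w]) ((g, 0) :: passLeft w g.cod) (passLeft w g.dom ++ [(g, 1)]) := by
    obtain ⟨f, hf⟩ := Option.isSome_iff_exists.1 hg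
    refine ⟨_, _, .cons (l := (g, 0)) (.here [w] hf rfl rfl) (val_passLeft w g.cod),
      ((val_passLeft w g.dom).append (.cons (l := (g, 1)) ((Lay.gen hf).there w)
        (.nil _))).congr ?_⟩
    exact braiding_slide_left f (M.app g.dom [w]) (M.app g.cod [w])

variable (M) in
/-- A box, to the right of the string `w`, slides along it. -/
theorem slideRight (g : Box) (w : Wire) (hg : (M.hom g).isSome) :
    M.Holds (w :: g.dom) ((g, 1) :: passRight w g.cod) (passRight w g.dom ++ [(g, 0)]) := by
    obtain ⟨f, hf⟩ := Option.isSome_iff_exists.1 hg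
    refine ⟨_, _, .cons (l := (g, 1)) ((Lay.gen hf).there w) (val_passRight w g.cod),
      ((val_passRight w g.dom).append (.cons (l := (g, 0)) (.here [w] hf rfl rfl)
        (.nil _))).congr ?_⟩
    exact braiding_slide_right f (M.app g.dom [w]) (M.app g.cod [w])

/-- The strings after a diagram, if it is well formed. -/
def after : List Wire → List Layer → Option (List Wire)
  | a, [] => some a
  | a, (g, p) :: L =>
    if (a.drop p).take g.dom.length = g.dom then
      after (a.take p ++ (g.cod ++ a.drop (p + g.dom.length))) L else none

theorem Lay.cod_eq {g : Box} {p : ℕ} {a b : List Wire} {f : M.ob a ⟶ M.ob b}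
    (h : M.Lay g p a b f) : b = a.take p ++ (g.cod ++ a.drop (p + g.dom.length)) := by
  induction h with
  | here post hf ha hb => subst ha hb; simp
  | there x h ih => rename_i p _ _ _; rw [Nat.add_right_comm]; simpa using ih

theorem Val.after {a b : List Wire} {L : List Layer} {f : M.ob a ⟶ M.ob b}
    (h : M.Val a L b f) (c : List Wire) (hc : after a L = some c) : b = c := by
  induction h with
  | nil a => simpa [Model.after] using hc
  | cons h _ ih =>
    obtain rfl := h.cod_eq
    unfold Model.after at hc
    split_ifs at hc
    exact ih hc

/-- The rewriting steps: the layer `n` places below the first `t` layers moves up past `n` layers,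
    all
on its right or all on its left; or a rule is applied to a number of layers,
    below the first `t` layers and to the right of `k` strings. -/
inductive Step (M : Model C)
  | up (t n : ℕ) (left : Bool)
  | rw {a : List Wire} {L L' : List Layer} (h : M.Holds a L L') (t k : ℕ)

/-- Exchange two consecutive layers; the second one is to the left of the first one or to the
right of it. -/
def exchange (left : Bool) (l l' : Layer) : Option (Layer × Layer) :=
  if left then
    if l'.2 + l'.1.dom.length ≤ l.2 then
      some (l', (l.1, l'.2 + l'.1.cod.length + (l.2 - (l'.2 + l'.1.dom.length)))) else none
  else
    if l.2 + l.1.cod.length ≤ l'.2 then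
      some ((l'.1, l.2 + l.1.dom.length + (l'.2 - (l.2 + l.1.cod.length))), l) else none

/-- Soundness of `exchange`. The flag carries information: when the upper box has no output and the
lower one no input at the same position, both sides are admissible and give different positions. -/
theorem Val.exchange {left : Bool} {a c : List Wire} {l l' m m' : Layer} {L : List Layer}
    {f : M.ob a ⟶ M.ob c} (h : M.Val a (l :: l' :: L) c f)
    (e : exchange left l l' = some (m, m')) : M.Val a (m :: m' :: L) c f := by
  cases h with
  | cons h₁ h =>
    cases h with
    | cons h₂ h =>
      obtain ⟨g, p⟩ := l
      obtain ⟨g', p'⟩ := l'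
      unfold Model.exchange at e
      split_ifs at e with hl hp hp <;> simp only [Option.some.injEq, Prod.mk.injEq] at e hp
      · obtain ⟨rfl, rfl⟩ := e
        dsimp only at h₁ h₂
        obtain ⟨n, rfl⟩ := Nat.exists_eq_add_of_le hp
        obtain ⟨b', f', h', l₁, l₂, e⟩ := h₁.interchange_left h₂
        rw [← Category.assoc, e, Category.assoc]
        refine .cons l₁ (.cons ?_ h)
        simpa using l₂
      · obtain ⟨rfl, rfl⟩ := e
        dsimp only at h₁ h₂
        obtain ⟨n, rfl⟩ := Nat.exists_eq_add_of_le hp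
        obtain ⟨b', f', h', l₁, l₂, e⟩ := h₁.interchange_right h₂
        rw [← Category.assoc, e, Category.assoc]
        refine .cons ?_ (.cons l₂ h)
        simpa using l₁

/-- Move the layer `l'` up to the top. -/
def moveUp (left : Bool) (l' : Layer) : List Layer → Option (Layer × List Layer)
  | [] => some (l', [])
  | l :: L =>
    (moveUp left l' L).bind fun q => (exchange left l q.1).map fun r => (r.1, r.2 :: q.2)

theorem Val.moveUp {left : Bool} {l' m : Layer} {L L₁ L₂ : List Layer} {a c : List Wire}
    {f : M.ob a ⟶ M.ob c} (h : M.Val a (L ++ l' :: L₂) c f)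
    (e : moveUp left l' L = some (m, L₁)) : M.Val a (m :: (L₁ ++ L₂)) c f := by
  induction L generalizing a m L₁ with
  | nil =>
    simp only [Model.moveUp, Option.some.injEq, Prod.mk.injEq] at e
    obtain ⟨rfl, rfl⟩ := e
    exact h
  | cons l L ih =>
    simp only [Model.moveUp, Option.bind_eq_some_iff, Option.map_eq_some_iff,
      Prod.mk.injEq] at e
    obtain ⟨⟨l₁, L₃⟩, e₁, ⟨l₂, l₃⟩, e₂, rfl, rfl⟩ := e
    cases h with
    | cons h₁ h => exact (Val.cons h₁ (ih h e₁)).exchange e₂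

/-- The effect of a rewriting step on a diagram. -/
def Step.apply (a : List Wire) (L : List Layer) : M.Step → Option (List Layer)
  | .up t n left =>
    match (L.drop t).drop n with
    | l :: L₂ =>
      (moveUp left l ((L.drop t).take n)).map fun q => L.take t ++ q.1 :: (q.2 ++ L₂)
    | [] => none
  | .rw (a := d) (L := l) (L' := r) _ t k =>
    if (L.drop t).take l.length = shift k l then
      (after a (L.take t)).bind fun b =>
        if k ≤ b.length ∧ (b.drop k).take d.length = d then
          some (L.take t ++ (shift k r ++ L.drop (t + l.length)))
        else none
    else none

/-- One morphism `g` serves every diagram with value `f`, so both sides of a rule keep a common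
value when strings are added on the left. -/
theorem Val.whiskerLeft_list {a b : List Wire} {L : List Layer} {f : M.ob a ⟶ M.ob b}
    (h : M.Val a L b f) (q : List Wire) :
    ∃ g, M.Val (q ++ a) (shift q.length L) (q ++ b) g ∧
      ∀ L', M.Val a L' b f → M.Val (q ++ a) (shift q.length L') (q ++ b) g := by
  induction q with
  | nil => exact ⟨f, by simpa [shift] using h, fun L' h' => by simpa [shift] using h'⟩
  | cons x q ih =>
    obtain ⟨g, h₁, h₂⟩ := ih
    have e (L : List Layer) : shift (x :: q).length L = shift 1 (shift q.length L) := by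
      simp [shift, Nat.add_assoc]
    exact ⟨_, e L ▸ h₁.whiskerLeft x, fun L' h' => e L' ▸ (h₂ L' h').whiskerLeft x⟩

/-- Soundness of a step. For a rule, the diagram is cut into three, the middle part is recognised as
the left side of the rule with strings added on both sides, and determinism of values identifies the
two. -/
theorem Val.step {a c : List Wire} {L L' : List Layer} {f : M.ob a ⟶ M.ob c}
    (h : M.Val a L c f) (s : M.Step) (hs : s.apply a L = some L') : M.Val a L' c f := by
  cases s with
  | up t n left =>
    unfold Step.apply at hs
    dsimp only at hs
    split at hs
    · rename_i l L₂ e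
      simp only [Option.map_eq_some_iff] at hs
      obtain ⟨⟨m, L₁⟩, e', rfl⟩ := hs
      have e₁ : L = L.take t ++ ((L.drop t).take n ++ l :: L₂) := by
        rw [← e, List.take_append_drop, List.take_append_drop]
      rw [e₁] at h
      obtain ⟨b, g, g', h₁, h₂, rfl⟩ := h.split
      exact h₁.append (h₂.moveUp e')
    · cases hs
  | @rw d l r hr t k =>
    unfold Step.apply at hs
    dsimp only at hs
    split_ifs at hs with e
    simp only [Option.bind_eq_some_iff, Option.ite_none_right_eq_some, Option.some.injEq] at hs
    obtain ⟨b, hb, ⟨hk, hd⟩, rfl⟩ := hs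
    have e₁ : L = L.take t ++ (shift k l ++ L.drop (t + l.length)) := by
      rw [← e, ← List.drop_drop, List.take_append_drop, List.take_append_drop]
    rw [e₁] at h
    obtain ⟨b', g, g', h₁, h₂, rfl⟩ := h.split
    obtain ⟨b₂, g₂, g₂', h₃, h₄, rfl⟩ := h₂.split
    obtain rfl := h₁.after _ hb
    refine h₁.append (Val.append ?_ h₄)
    obtain ⟨d', φ, hl, hr⟩ := hr
    obtain ⟨φ', hl', hr'⟩ := Val.whiskerLeft_list
      (hl.whiskerRight ((b'.drop k).drop d.length)) (b'.take k)
    replace hr' := hr' _ (hr.whiskerRight _)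
    -- The strings at the level of the rule are `k` untouched ones, the domain `d` of the rule, and
    -- the rest.
    have e₂ : b'.take k ++ (d ++ (b'.drop k).drop d.length) = b' := by
      conv_rhs => rw [← List.take_append_drop k b',
        ← List.take_append_drop d.length (b'.drop k), hd]
    rw [List.length_take, min_eq_left hk] at hl' hr'
    generalize b'.take k ++ (d ++ (b'.drop k).drop d.length) = b₁ at *
    subst e₂
    obtain ⟨rfl, e₃⟩ := h₃.unique hl'
    rw [eq_of_heq e₃]
    exact hr'

/-- The effect of several rewriting steps. -/
def run (a : List Wire) : List Layer → List M.Step → Option (List Layer)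
  | L, [] => some L
  | L, s :: S => (s.apply a L).bind fun L' => run a L' S

theorem Val.run {a c : List Wire} {L L' : List Layer} {f : M.ob a ⟶ M.ob c}
    (h : M.Val a L c f) (S : List M.Step) (hs : run a L S = some L') : M.Val a L' c f := by
  induction S generalizing L with
  | nil => cases hs; exact h
  | cons s S ih =>
    simp only [Model.run, Option.bind_eq_some_iff] at hs
    obtain ⟨L₁, e, hs⟩ := hs
    exact ih (h.step s e) hs

theorem Lay.exists {g : Box} (hg : (M.hom g).isSome) {a : List Wire} {p : ℕ}
    (ha : (a.drop p).take g.dom.length = g.dom) (hp : p ≤ a.length) :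
    ∃ f, M.Lay g p a (a.take p ++ (g.cod ++ a.drop (p + g.dom.length))) f := by
  obtain ⟨f, hf⟩ := Option.isSome_iff_exists.1 hg
  induction p generalizing a with
  | zero =>
    rw [Nat.zero_add]
    refine ⟨_, .here (a.drop g.dom.length) hf ?_ rfl⟩
    conv_lhs => rw [← List.take_append_drop g.dom.length a]
    rw [List.drop_zero] at ha
    rw [ha]
  | succ p ih =>
    cases a with
    | nil => simp at hp
    | cons x a =>
      obtain ⟨φ, h⟩ := ih (by simpa using ha) (by simpa using hp)
      rw [Nat.add_right_comm]
      exact ⟨_, h.there x⟩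

variable (M) in
/-- The boxes that satisfy `P` have a value. -/
def Total (P : Box → Bool) : Prop := ∀ g, P g → (M.hom g).isSome

/-- The diagram `L` is well formed, and its boxes satisfy `P` or are crossings. -/
def check (P : Box → Bool) : List Wire → List Layer → Bool
  | _, [] => true
  | a, (g, p) :: L =>
    (P g || g.isCross) && (decide (p ≤ a.length) &&
      (decide ((a.drop p).take g.dom.length = g.dom) &&
        check P (a.take p ++ (g.cod ++ a.drop (p + g.dom.length))) L))

theorem isSome_hom {P : Box → Bool} (hM : M.Total P) {g : Box} (hg : P g || g.isCross) :
    (M.hom g).isSome := by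
  rw [Bool.or_eq_true] at hg
  rcases hg with hg | hg
  · exact hM g hg
  · cases g <;> simp_all [Box.isCross, hom]

theorem exists_val {P : Box → Bool} (hM : M.Total P) (a : List Wire) (L : List Layer)
    (h : check P a L) : ∃ b f, M.Val a L b f := by
  induction L generalizing a with
  | nil => exact ⟨a, _, .nil a⟩
  | cons l L ih =>
    obtain ⟨g, p⟩ := l
    simp only [check, Bool.and_eq_true, decide_eq_true_eq] at h
    obtain ⟨f, hf⟩ := Lay.exists (isSome_hom hM h.1) h.2.2.1 h.2.1
    obtain ⟨b, f', hf'⟩ := ih _ h.2.2.2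
    exact ⟨b, _, .cons (l := (g, p)) hf hf'⟩

/-- The reflection principle. Only the left diagram has to be checked to be well formed, as each
step preserves the value; both premises are closed by computation. -/
theorem Total.holds {P : Box → Bool} (hM : M.Total P) {a : List Wire} {L L' : List Layer}
    (S : List M.Step) (hL : check P a L = true) (h : run a L S = some L') :
    M.Holds a L L' := by
  obtain ⟨b, f, hf⟩ := exists_val hM a L hL
  exact ⟨b, f, hf, hf.run S h⟩

theorem Total.slideL {P : Box → Bool} (hM : M.Total P) (g : Box) (w : Wire)
    (hg : (P g || g.isCross) = true := by rfl) :
    M.Holds (g.dom ++ [w]) ((g, 0) :: passLeft w g.cod) (passLeft w g.dom ++ [(g, 1)]) :=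
  slideLeft M g w (isSome_hom hM hg)

theorem Total.slideR {P : Box → Bool} (hM : M.Total P) (g : Box) (w : Wire)
    (hg : (P g || g.isCross) = true := by rfl) :
    M.Holds (w :: g.dom) ((g, 1) :: passRight w g.cod) (passRight w g.dom ++ [(g, 0)]) :=
  slideRight M g w (isSome_hom hM hg)

end Model

end Semantics

variable {C : Type u} [Category.{v} C] [MonoidalCategory C] [BraidedCategory C]

/-! ### Algebraic structures as systems of diagram equations. -/

namespace Model

variable {M : Model C}

structure IsMonoid (M : Model C) (x : Wire) : Prop where
  mul_assoc : M.Holds [x, x, x] [(.mul x, 0), (.mul x, 0)] [(.mul x, 1), (.mul x, 0)]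
  one_mul : M.Holds [x] [(.one x, 0), (.mul x, 0)] []
  mul_one : M.Holds [x] [(.one x, 1), (.mul x, 0)] []

structure IsComonoid (M : Model C) (x : Wire) : Prop where
  comul_assoc : M.Holds [x] [(.comul x, 0), (.comul x, 1)] [(.comul x, 0), (.comul x, 0)]
  counit_comul : M.Holds [x] [(.comul x, 0), (.counit x, 0)] []
  comul_counit : M.Holds [x] [(.comul x, 0), (.counit x, 1)] []

structure IsBimonoid (M : Model C) (x : Wire) : Prop extends M.IsMonoid x, M.IsComonoid x where
  mul_comul : M.Holds [x, x] [(.mul x, 0), (.comul x, 0)] [(.comul x, 1), (.comul x, 0),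
    (.cross x x, 1), (.mul x, 0), (.mul x, 1)]
  one_comul : M.Holds [] [(.one x, 0), (.comul x, 0)] [(.one x, 0), (.one x, 0)]
  mul_counit : M.Holds [x, x] [(.mul x, 0), (.counit x, 0)] [(.counit x, 0), (.counit x, 0)]
  one_counit : M.Holds [] [(.one x, 0), (.counit x, 0)] []

/-- The last four fields follow from the others in a braided category; they are included so that the
calculations may quote them as rules. -/
structure IsHopf (M : Model C) (x : Wire) : Prop extends M.IsBimonoid x where
  antipode_left : M.Holds [x] [(.comul x, 0), (.anti x, 0), (.mul x, 0)] [(.counit x, 0), (.one x,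
    0)]
  antipode_right : M.Holds [x] [(.comul x, 0), (.anti x, 1), (.mul x, 0)] [(.counit x, 0),
    (.one x, 0)]
  antipode_comul : M.Holds [x] [(.anti x, 0), (.comul x, 0)] [(.comul x, 0), (.cross x x, 0),
    (.anti x, 0), (.anti x, 1)]
  mul_antipode : M.Holds [x, x] [(.mul x, 0), (.anti x, 0)] [(.anti x, 0), (.anti x, 1),
    (.cross x x, 0), (.mul x, 0)]
  antipode_counit : M.Holds [x] [(.anti x, 0), (.counit x, 0)] [(.counit x, 0)]
  one_antipode : M.Holds [] [(.one x, 0), (.anti x, 0)] [(.one x, 0)]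

/-! ### Integrals in the dual and a left inverse of the antipode. -/

def dualActionBox : Box → Bool
  | .mul .K | .one .K | .counit .K | .proj .K => true
  | .mul .H | .one .H | .comul .H | .counit .H | .anti .H => true
  | .act .H .K | .copair .H .K | .pair .H .K => true
  | _ => false

/-- What the integral argument uses. In elements, `coev_act` is Σ eᵢ ⊗ h·fⁱ = Σ eᵢh ⊗ fⁱ,
`coev_cancel` is Σ (S(eᵢ)·k) fⁱ = ε(k)1, `act_pair` is ⟨h, h'·k⟩ = ⟨hh', k⟩, and `proj` is P(k) = Σ
S²(eᵢ)·(fⁱk). -/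
structure DualAction (M : Model C) : Prop where
  total : M.Total dualActionBox
  monoid : M.IsMonoid .K
  hopf : M.IsHopf .H
  symm_HH : M.Holds [.H, .H] [(.cross .H .H, 0), (.cross .H .H, 0)] []
  symm_HK : M.Holds [.H, .K] [(.cross .H .K, 0), (.cross .K .H, 0)] []
  symm_KH : M.Holds [.K, .H] [(.cross .K .H, 0), (.cross .H .K, 0)] []
  symm_KK : M.Holds [.K, .K] [(.cross .K .K, 0), (.cross .K .K, 0)] []
  one_act : M.Holds [.K] [(.one .H, 0), (.act .H .K, 0)] []
  mul_act : M.Holds [.H, .H, .K] [(.mul .H, 0), (.act .H .K, 0)] [(.act .H .K, 1), (.act .H .K, 0)]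
  act_mul : M.Holds [.H, .K, .K] [(.mul .K, 1), (.act .H .K, 0)] [(.comul .H, 0), (.cross .H .K,
    1), (.act .H .K, 0), (.act .H .K, 1), (.mul .K, 0)]
  coev_comul : M.Holds [] [(.copair .H .K, 0), (.comul .H, 0)] [(.copair .H .K, 0),
    (.copair .H .K, 1), (.cross .K .K, 2), (.mul .K, 2)]
  coev_act : M.Holds [.H] [(.copair .H .K, 1), (.cross .H .H, 0), (.act .H .K,
    1)] [(.copair .H .K, 1), (.cross .H .H, 0), (.mul .H, 0)]
  coev_counit : M.Holds [] [(.copair .H .K, 0), (.counit .H, 0)] [(.one .K, 0)]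
  coev_cancel : M.Holds [.K] [(.copair .H .K, 0), (.cross .K .K, 1), (.anti .H, 0), (.act .H .K,
    0), (.mul .K, 0)] [(.counit .K, 0), (.one .K, 0)]
  act_pair : M.Holds [.H, .H, .K] [(.act .H .K, 1), (.pair .H .K, 0)] [(.mul .H, 0), (.pair .H .K,
    0)]
  coev_counit_right : M.Holds [] [(.copair .H .K, 0), (.counit .K, 1)] [(.one .H, 0)]
  one_pair : M.Holds [.K] [(.one .H, 0), (.pair .H .K, 0)] [(.counit .K, 0)]
  one_counit : M.Holds [] [(.one .K, 0), (.counit .K, 0)] []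
  proj_def : M.Holds [.K] [(.proj .K, 0)] [(.copair .H .K, 0), (.mul .K, 1), (.anti .H, 0),
    (.anti .H, 0), (.act .H .K, 0)]

/-- k (S(h)·k') = S(h₁)·((h₂·k) k'): distribute S(h₁) over the product on the right and cancel it
against h₂ on the first factor. -/
theorem DualAction.mul_antipode_act (h : M.DualAction) :
    M.Holds [.H, .K, .K] [(.cross .H .K, 0), (.anti .H, 1), (.act .H .K, 1), (.mul .K,
      0)] [(.comul .H, 0), (.act .H .K, 1), (.mul .K, 1), (.anti .H, 0), (.act .H .K, 0)] := by
  refine h.total.holds [.rw h.hopf.comul_counit.symm 0 0, .rw h.one_act.symm 0 1, .up 0 2 true,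
    .up 1 2 true, .rw h.hopf.antipode_left.symm 1 1, .rw h.mul_act 3 1,
    .rw h.hopf.comul_assoc 0 0, .rw (h.total.slideR (.act .H .K) .H) 4 0, .up 3 1 true,
    .rw (h.total.slideR (.anti .H) .H) 2 0, .up 6 1 false, .up 3 1 false, .up 4 1 false,
    .up 5 1 false, .rw (h.total.slideL (.anti .H) .K).symm 4 1, .up 3 3 true, .up 4 1 true,
    .rw h.hopf.antipode_comul.symm 1 0, .up 1 2 false, .rw h.act_mul.symm 3 0,
    .up 2 1 false] ?_ ?_ <;> rfl

theorem DualAction.coev_coev (h : M.DualAction) :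
    M.Holds [] [(.copair .H .K, 0), (.copair .H .K, 1), (.cross .H .H, 0), (.cross .K .K,
      2)] [(.copair .H .K, 0), (.copair .H .K, 1)] := by
  refine h.total.holds [.rw h.symm_HK.symm 3 1, .rw (h.total.slideR (.copair .H .K) .H) 1 0,
    .up 0 1 true, .rw (h.total.slideR (.copair .H .K) .K) 1 1] ?_ ?_ <;> rfl

/-- Σ eᵢ ⊗ fⁱ (S(h)·k) = Σ eᵢh₂ ⊗ S(h₁)·(fⁱk): the previous identity applied to fⁱ, after which h₂
moves from fⁱ to eᵢ. -/
theorem DualAction.coev_mul_antipode_act (h : M.DualAction) :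
    M.Holds [.H, .K] [(.anti .H, 0), (.act .H .K, 0), (.copair .H .K, 0), (.mul .K,
      1)] [(.comul .H, 0), (.copair .H .K, 2), (.cross .H .H, 1), (.mul .H, 1), (.cross .H .H, 0),
      (.mul .K, 2), (.anti .H, 1), (.act .H .K, 1)] := by
  refine h.total.holds [.up 0 2 true, .rw (h.total.slideR (.copair .H .K) .H).symm 0 0,
    .rw h.mul_antipode_act 2 1, .rw (h.total.slideL (.comul .H) .H).symm 1 0, .up 0 1 true,
    .up 3 1 false, .rw h.coev_act 1 1] ?_ ?_ <;> rfl

/-- The two order reversals leave a double crossing of H with itself, which is trivial by symmetry.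
-/
theorem DualAction.mul_antipode_sq (h : M.DualAction) :
    M.Holds [.H, .H] [(.mul .H, 0), (.anti .H, 0), (.anti .H, 0)] [(.anti .H, 0), (.anti .H, 0),
      (.anti .H, 1), (.anti .H, 1), (.mul .H, 0)] := by
  refine h.total.holds [.rw h.hopf.mul_antipode 0 0, .rw h.hopf.mul_antipode 3 0,
    .rw (h.total.slideR (.anti .H) .H) 4 0, .rw (h.total.slideR (.anti .H) .H).symm 2 0,
    .rw h.symm_HH 3 0, .up 2 1 true, .up 1 1 true] ?_ ?_ <;> rfl

/-- S²(h₂) S(h₁) = S(h₁ S(h₂)) = ε(h)1. -/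
theorem DualAction.comul_antipode_sq (h : M.DualAction) :
    M.Holds [.H] [(.comul .H, 0), (.cross .H .H, 0), (.anti .H, 0), (.anti .H, 0), (.anti .H, 1),
      (.mul .H, 0)] [(.counit .H, 0), (.one .H, 0)] := by
  refine h.total.holds [.rw (h.total.slideR (.anti .H) .H).symm 1 0,
    .rw (h.total.slideR (.anti .H) .H).symm 2 0, .rw (h.total.slideL (.anti .H) .H).symm 3 0,
    .up 2 1 true, .rw h.hopf.mul_antipode.symm 2 0, .rw h.hopf.antipode_right 0 0,
    .rw h.hopf.one_antipode 1 0] ?_ ?_ <;> rfl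

/-- P(S(h)·k) = Σ S²(eᵢh₂) S(h₁)·(fⁱk), where S² is multiplicative and S²(h₂) S(h₁) = ε(h)1. -/
theorem DualAction.antipode_act_proj (h : M.DualAction) :
    M.Holds [.H, .K] [(.anti .H, 0), (.act .H .K, 0), (.proj .K, 0)] [(.counit .H, 0), (.proj .K,
      0)] := by
  refine h.total.holds [.rw h.proj_def 2 0, .rw h.coev_mul_antipode_act 0 0, .up 5 3 true,
    .rw (h.total.slideR (.anti .H) .H).symm 4 0, .up 6 3 true,
    .rw (h.total.slideR (.anti .H) .H).symm 5 0, .rw h.mul_antipode_sq 3 1,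
    .rw h.mul_act.symm 11 0, .rw (h.total.slideR (.mul .H) .H) 7 0, .up 10 1 true, .up 5 2 true,
    .rw (h.total.slideR (.anti .H) .H) 4 0, .rw (h.total.slideR (.anti .H) .H) 3 0, .up 4 2 false,
    .up 5 2 false, .up 6 2 false, .rw (h.total.slideR (.anti .H) .H) 5 1, .up 0 1 false,
    .rw (h.total.slideL (.comul .H) .H) 1 0, .rw (h.total.slideR (.anti .H) .H) 3 1, .up 4 2 true,
    .up 5 2 true, .up 8 1 false, .up 10 1 true, .rw h.hopf.mul_assoc 9 0, .up 4 2 false,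
    .up 5 2 false, .up 6 2 false, .up 7 2 false, .rw h.comul_antipode_sq 2 1, .up 2 2 true,
    .up 3 2 true, .up 4 1 true, .up 5 1 true, .rw h.hopf.mul_one 4 0, .up 2 2 false,
    .rw (h.total.slideL (.counit .H) .H).symm 1 0, .up 0 1 true, .up 2 2 false,
    .rw h.proj_def.symm 1 0] ?_ ?_ <;> rfl

/-- The values of P are left integrals. Applying `mul_antipode_act` to k P(k') and splitting the
coevaluation by `coev_comul` leaves the factor Σ (S(eᵢ)·k) fⁱ = ε(k)1. -/
theorem DualAction.mul_proj (h : M.DualAction) :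
    M.Holds [.K, .K] [(.proj .K, 1), (.mul .K, 0)] [(.counit .K, 0), (.proj .K, 0)] := by
  refine h.total.holds [.rw h.proj_def 0 1, .rw (h.total.slideL (.copair .H .K) .K).symm 0 0,
    .up 3 1 true, .rw (h.total.slideL (.anti .H) .K).symm 2 0, .up 4 1 true, .up 3 2 false,
    .rw h.mul_antipode_act 4 0, .up 1 1 true, .up 2 2 true, .rw h.hopf.antipode_comul 1 0,
    .up 3 2 false, .up 4 2 false, .rw h.coev_comul 0 0, .up 2 2 true, .rw h.coev_coev 0 0,
    .rw (h.total.slideL (.mul .K) .K) 2 2, .up 1 1 false, .up 6 1 false, .up 4 2 true,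
    .up 7 1 false, .up 5 2 true, .up 8 1 false, .rw h.monoid.mul_assoc 6 2,
    .rw h.monoid.mul_assoc.symm 7 1, .up 6 1 true, .rw h.coev_cancel 2 1, .up 3 1 false,
    .rw h.monoid.one_mul 4 1, .rw (h.total.slideR (.counit .K) .K).symm 1 1, .up 0 1 false,
    .rw h.proj_def.symm 1 0] ?_ ?_ <;> rfl

/-- On the integral P(k), each fⁱ acts by ε(fⁱ), and Σ eᵢ ε(fⁱ) = 1. -/
theorem DualAction.proj_proj (h : M.DualAction) :
    M.Holds [.K] [(.proj .K, 0), (.proj .K, 0)] [(.proj .K, 0)] := by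
  refine h.total.holds [.rw h.proj_def 1 0, .up 0 1 true, .rw h.mul_proj 1 1,
    .rw h.coev_counit_right 0 0, .up 1 1 true, .rw h.hopf.one_antipode 0 0, .up 1 1 true,
    .rw h.hopf.one_antipode 0 0, .up 0 1 false, .rw h.one_act 1 0] ?_ ?_ <;> rfl

/-- The key identity Σ eᵢ ⊗ P(fⁱ (S(h)·P(k))) = h ⊗ P(k). By `coev_mul_antipode_act` the left side
is Σ eᵢh₂ ⊗ P(S(h₁)·(fⁱP(k))); the integral property replaces fⁱ by ε(fⁱ), and P turns S(h₁) into
ε(h₁). -/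
theorem DualAction.proj_antipode_act_coev_proj (h : M.DualAction) :
    M.Holds [.H, .K] [(.proj .K, 1), (.anti .H, 0), (.act .H .K, 0), (.copair .H .K, 0), (.mul .K,
      1), (.proj .K, 1)] [(.proj .K, 1)] := by
  refine h.total.holds [.rw h.coev_mul_antipode_act 1 0, .up 1 1 false, .up 0 1 true,
    .up 2 4 false, .rw h.mul_proj 1 2, .up 0 3 true, .up 2 2 true, .up 3 2 true, .up 4 2 true,
    .up 2 3 false, .rw h.coev_counit_right 1 2, .rw (h.total.slideR (.one .H) .H) 1 1,
    .rw h.hopf.one_mul 1 1, .rw h.antipode_act_proj 3 1, .up 2 1 true,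
    .rw (h.total.slideL (.counit .H) .H).symm 1 0, .rw h.hopf.counit_comul 0 0,
    .rw h.proj_proj 0 1] ?_ ?_ <;> rfl

/-- Σ ⟨S(eᵢ), P(fⁱ)⟩ = 1, so P does not vanish. Moving S² across the pairing gives Σ ⟨S(eᵢ) S²(eⱼ),
fʲfⁱ⟩ = Σ ⟨S(S(e₁) e₂), f⟩ = ⟨1, 1⟩, with e ⊗ f the coevaluation. -/
theorem DualAction.coev_proj_pair (h : M.DualAction) :
    M.Holds [] [(.copair .H .K, 0), (.proj .K, 1), (.anti .H, 0), (.pair .H .K, 0)] [] := by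
  refine h.total.holds [.rw h.proj_def 1 1, .up 5 1 true, .rw h.act_pair 6 0, .up 3 2 true,
    .rw h.coev_coev.symm 0 0, .up 2 1 false, .up 3 1 false, .rw h.coev_comul.symm 0 0,
    .rw (h.total.slideR (.anti .H) .H).symm 2 0, .rw (h.total.slideL (.anti .H) .H).symm 3 0,
    .rw (h.total.slideL (.anti .H) .H).symm 4 0, .up 2 1 true, .up 3 1 true,
    .rw h.hopf.mul_antipode.symm 3 0, .rw h.hopf.antipode_left 1 0, .up 0 2 true, .up 1 2 true,
    .rw h.hopf.one_antipode 0 0, .up 0 1 false, .up 1 1 false, .rw h.coev_counit 0 0,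
    .rw h.one_pair 1 0, .rw h.one_counit 0 0] ?_ ?_ <;> rfl

/-- The key identity with k taken from a coevaluation; contracting with `coev_proj_pair` then
removes P(k). Everything below the first box is the left inverse of S. -/
theorem DualAction.antipode_comp_retraction (h : M.DualAction) :
    M.Holds [.H] [(.anti .H, 0), (.copair .H .K, 1), (.cross .H .H, 0), (.proj .K, 2),
      (.act .H .K, 1), (.copair .H .K, 1), (.mul .K, 2), (.proj .K, 2), (.cross .H .H, 0),
      (.anti .H, 1), (.pair .H .K, 1)] [] := by
  refine h.total.holds [.up 0 1 false, .rw (h.total.slideL (.anti .H) .H) 1 0, .up 2 1 false,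
    .rw h.proj_antipode_act_coev_proj 2 1, .up 2 1 true, .rw h.symm_HH 1 0,
    .rw h.coev_proj_pair 0 1] ?_ ?_ <;> rfl

end Model

/-! ### The Hopf axioms for the transposed operations. -/

namespace Model

variable {M : Model C}

/-- Crossings are isomorphisms, so a one-sided inverse is two-sided. -/
theorem holds_cross_cross {x y : Wire}
    (h : M.Holds [x, y] [(.cross x y, 0), (.cross y x, 0)] []) :
    M.Holds [y, x] [(.cross y x, 0), (.cross x y, 0)] [] := by
  obtain ⟨b, f, h₁, h₂⟩ := h
  obtain ⟨rfl, e⟩ := h₂.unique (.nil _)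
  obtain ⟨-, e'⟩ := h₁.unique (.cons (lay_cross x y []) (.cons (lay_cross y x []) (.nil _)))
  obtain rfl := eq_of_heq e
  refine ⟨_, _, .cons (lay_cross y x []) (.cons (lay_cross x y []) (.nil _)),
    (Val.nil _).congr ?_⟩
  have key : ∀ {X Y : C} (f : X ≅ Y) (g : Y ⟶ X), 𝟙 X = f.hom ≫ g ≫ 𝟙 X →
      𝟙 Y = g ≫ f.hom ≫ 𝟙 Y := by
    intro X Y f g e
    rw [Category.comp_id, ← cancel_epi f.hom, ← Category.assoc, ← (Category.comp_id g), ← e]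
    simp
  exact key ((α_ (M.obj x) (M.obj y) (M.ob [])).symm ≪≫
    whiskerRightIso (β_ (M.obj x) (M.obj y)) (M.ob []) ≪≫ α_ (M.obj y) (M.obj x) (M.ob [])) _
    (eq_of_heq e')

def dualPairBox : Box → Bool
  | .mul .K | .one .K | .comul .K | .counit .K | .anti .K => true
  | .mul .H | .one .H | .comul .H | .counit .H | .anti .H => true
  | .copair .H .K | .pair .K .H => true
  | _ => false

/-- Only H is assumed to be a Hopf algebra and only C_{H,H} to be symmetric; the operations of K are
the transposes of those of H. -/
structure DualPair (M : Model C) : Prop where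
  total : M.Total dualPairBox
  hopf : M.IsHopf .H
  symm_HH : M.Holds [.H, .H] [(.cross .H .H, 0), (.cross .H .H, 0)] []
  coev_eval : M.Holds [.K] [(.copair .H .K, 1), (.pair .K .H, 0)] []
  eval_coev : M.Holds [.H] [(.copair .H .K, 0), (.pair .K .H, 1)] []
  mul_def : M.Holds [.K, .K] [(.mul .K, 0)] [(.copair .H .K, 2), (.comul .H, 2), (.cross .K .H,
    1), (.pair .K .H, 0), (.pair .K .H, 0)]
  one_def : M.Holds [] [(.one .K, 0)] [(.copair .H .K, 0), (.counit .H, 0)]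
  comul_def : M.Holds [.K] [(.comul .K, 0)] [(.copair .H .K, 1), (.copair .H .K, 3),
    (.cross .K .H, 2), (.mul .H, 1), (.pair .K .H, 0)]
  counit_def : M.Holds [.K] [(.counit .K, 0)] [(.one .H, 1), (.pair .K .H, 0)]
  antipode_def : M.Holds [.K] [(.anti .K, 0)] [(.copair .H .K, 1), (.anti .H, 1), (.pair .K .H, 0)]

/-- Bend the string K by a coevaluation and an evaluation: its double crossing with H becomes one of
H with H, which is trivial. -/
theorem DualPair.symm_KH (h : M.DualPair) :
    M.Holds [.K, .H] [(.cross .K .H, 0), (.cross .H .K, 0)] [] := by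
  refine h.total.holds [.rw h.coev_eval.symm 2 0,
    .rw (h.total.slideR (.copair .H .K) .H).symm 2 1, .up 0 2 false, .up 4 1 true,
    .rw (h.total.slideR (.pair .K .H) .H).symm 2 0, .rw h.symm_HH.symm 1 1,
    .rw (h.total.slideL (.pair .K .H) .H).symm 2 0, .up 2 1 false,
    .rw (h.total.slideR (.copair .H .K) .H) 0 1, .rw h.coev_eval 0 0] ?_ ?_ <;> rfl

theorem DualPair.symm_HK (h : M.DualPair) :
    M.Holds [.H, .K] [(.cross .H .K, 0), (.cross .K .H, 0)] [] :=
  holds_cross_cross h.symm_KH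

theorem DualPair.symm_KK (h : M.DualPair) :
    M.Holds [.K, .K] [(.cross .K .K, 0), (.cross .K .K, 0)] [] := by
  refine h.total.holds [.rw h.coev_eval.symm 2 0,
    .rw (h.total.slideR (.copair .H .K) .K).symm 2 1, .up 0 2 false, .up 4 1 true,
    .rw (h.total.slideR (.pair .K .H) .K).symm 2 0, .rw h.symm_KH.symm 1 1,
    .rw (h.total.slideL (.pair .K .H) .K).symm 2 0, .up 2 1 false,
    .rw (h.total.slideR (.copair .H .K) .K) 0 1, .rw h.coev_eval 0 0] ?_ ?_ <;> rfl

theorem DualPair.mul_pair (h : M.DualPair) :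
    M.Holds [.K, .K, .H] [(.mul .K, 0), (.pair .K .H, 0)] [(.comul .H, 2), (.cross .K .H, 1),
      (.pair .K .H, 0), (.pair .K .H, 0)] := by
  refine h.total.holds [.rw h.mul_def 0 0, .up 1 4 false, .rw h.eval_coev 0 2] ?_ ?_ <;> rfl

theorem DualPair.one_pair (h : M.DualPair) :
    M.Holds [.H] [(.one .K, 0), (.pair .K .H, 0)] [(.counit .H, 0)] := by
  refine h.total.holds [.rw h.one_def 0 0, .up 1 1 false, .rw h.eval_coev 0 0] ?_ ?_ <;> rfl

/-- A zigzag identity for H ⊗ H and K ⊗ K; the crossings of H with K in the double pairing and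
copairing cancel by symmetry. -/
theorem DualPair.coev_eval_two (h : M.DualPair) :
    M.Holds [.H, .H] [(.copair .H .K, 0), (.copair .H .K, 2), (.cross .K .H, 1), (.cross .K .H,
      3), (.pair .K .H, 2), (.pair .K .H, 2)] [] := by
  refine h.total.holds [.up 0 1 false, .up 1 2 false, .rw h.symm_HH.symm 2 0, .up 0 4 true,
    .rw (h.total.slideL (.copair .H .K) .H) 1 2, .rw (h.total.slideL (.pair .K .H) .H).symm 2 1,
    .up 1 1 true, .rw h.eval_coev 0 0, .rw h.eval_coev 0 1] ?_ ?_ <;> rfl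

/-- The other zigzag identity. It allows maps into K ⊗ K to be compared after pairing with H ⊗ H. -/
theorem DualPair.eval_coev_two (h : M.DualPair) :
    M.Holds [.K, .K] [(.copair .H .K, 2), (.copair .H .K, 4), (.cross .K .H, 3), (.cross .K .H,
      1), (.pair .K .H, 0), (.pair .K .H, 0)] [] := by
  refine h.total.holds [.up 1 2 true, .up 3 1 true, .rw h.symm_KK.symm 2 2, .up 5 1 false,
    .rw (h.total.slideR (.copair .H .K) .K) 0 1, .up 1 1 false, .up 4 1 false,
    .rw (h.total.slideR (.pair .K .H) .K).symm 2 2, .up 1 2 true, .rw h.coev_eval 0 0,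
    .rw h.coev_eval 0 1] ?_ ?_ <;> rfl

theorem DualPair.comul_pair (h : M.DualPair) :
    M.Holds [.K, .H, .H] [(.comul .K, 0), (.cross .K .H, 1), (.pair .K .H, 0), (.pair .K .H,
      0)] [(.mul .H, 1), (.pair .K .H, 0)] := by
  refine h.total.holds [.rw h.comul_def 0 0, .up 3 2 false, .up 4 2 false, .up 5 2 false,
    .rw h.coev_eval_two 0 1] ?_ ?_ <;> rfl

theorem DualPair.antipode_pair (h : M.DualPair) :
    M.Holds [.K, .H] [(.anti .K, 0), (.pair .K .H, 0)] [(.anti .H, 1), (.pair .K .H, 0)] := by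
  refine h.total.holds [.rw h.antipode_def 0 0, .up 1 2 false, .rw h.eval_coev 0 1] ?_ ?_ <;> rfl

theorem DualPair.coev_comul_dual (h : M.DualPair) :
    M.Holds [] [(.copair .H .K, 0), (.comul .K, 1)] [(.copair .H .K, 0), (.copair .H .K, 2),
      (.cross .K .H, 1), (.mul .H, 0)] := by
  refine h.total.holds [.rw h.comul_def 1 1, .up 0 1 false, .up 1 1 false, .up 2 1 false,
    .up 3 1 false, .rw h.eval_coev 4 0] ?_ ?_ <;> rfl

theorem DualPair.coev_counit_dual (h : M.DualPair) :
    M.Holds [] [(.copair .H .K, 0), (.counit .K, 1)] [(.one .H, 0)] := by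
  refine h.total.holds [.rw h.counit_def 1 1, .up 0 1 false, .rw h.eval_coev 1 0] ?_ ?_ <;> rfl

/-- The pattern for the axioms of K: insert a zigzag on K, move the operations of K across the
pairing, use the axiom of H, and close the zigzag. -/
theorem DualPair.one_mul (h : M.DualPair) :
    M.Holds [.K] [(.one .K, 0), (.mul .K, 0)] [] := by
  refine h.total.holds [.rw h.coev_eval.symm 2 0, .up 0 2 false, .rw h.mul_pair 2 0,
    .up 1 1 false, .up 2 1 false, .rw h.one_pair 3 0,
    .rw (h.total.slideR (.counit .H) .K).symm 2 0, .rw h.hopf.counit_comul 1 1,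
    .rw h.coev_eval 0 0] ?_ ?_ <;> rfl

theorem DualPair.mul_one (h : M.DualPair) :
    M.Holds [.K] [(.one .K, 1), (.mul .K, 0)] [] := by
  refine h.total.holds [.rw h.coev_eval.symm 2 0, .up 0 2 false, .rw h.mul_pair 2 0,
    .up 1 1 false, .rw (h.total.slideL (.one .K) .H) 2 1, .up 3 1 false, .rw h.one_pair 2 2,
    .rw h.hopf.comul_counit 1 1, .rw h.coev_eval 0 0] ?_ ?_ <;> rfl

theorem DualPair.mul_assoc (h : M.DualPair) :
    M.Holds [.K, .K, .K] [(.mul .K, 0), (.mul .K, 0)] [(.mul .K, 1), (.mul .K, 0)] := by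
  refine h.total.holds [.rw h.coev_eval.symm 2 0, .up 0 2 false, .rw h.mul_pair 2 0,
    .up 1 1 false, .up 2 1 false, .rw h.mul_pair 3 0,
    .rw (h.total.slideR (.comul .H) .K).symm 2 2, .rw h.hopf.comul_assoc.symm 1 3, .up 2 1 true,
    .up 3 2 true, .up 4 2 true, .rw h.mul_pair.symm 5 0, .up 4 1 false,
    .rw (h.total.slideL (.mul .K) .H).symm 2 1, .up 1 1 true, .rw h.mul_pair.symm 2 0,
    .up 0 1 true, .up 1 1 true, .rw h.coev_eval 2 0] ?_ ?_ <;> rfl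

theorem DualPair.comul_assoc (h : M.DualPair) :
    M.Holds [.K] [(.comul .K, 0), (.comul .K, 1)] [(.comul .K, 0), (.comul .K, 0)] := by
  refine h.total.holds [.rw h.coev_eval.symm 0 0, .up 1 1 false, .up 2 1 false,
    .rw h.coev_comul_dual 0 1, .up 2 2 false, .rw h.coev_comul_dual 1 3,
    .rw (h.total.slideR (.mul .H) .K) 4 2, .rw h.hopf.mul_assoc.symm 6 1, .up 2 2 true,
    .up 3 3 true, .rw h.coev_comul_dual.symm 0 1, .up 1 1 false,
    .rw (h.total.slideL (.comul .K) .H) 2 2, .up 3 1 true, .rw h.coev_comul_dual.symm 0 1,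
    .up 1 2 true, .rw h.coev_eval 0 0] ?_ ?_ <;> rfl

theorem DualPair.counit_comul (h : M.DualPair) :
    M.Holds [.K] [(.comul .K, 0), (.counit .K, 0)] [] := by
  refine h.total.holds [.rw h.coev_eval.symm 0 0, .up 1 1 false, .up 2 1 false,
    .rw h.coev_comul_dual 0 1, .up 3 1 false, .rw (h.total.slideL (.counit .K) .H).symm 2 2,
    .up 1 1 true, .rw h.coev_counit_dual 0 1, .up 0 1 false, .rw h.hopf.one_mul 1 1,
    .rw h.coev_eval 0 0] ?_ ?_ <;> rfl

theorem DualPair.comul_counit (h : M.DualPair) :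
    M.Holds [.K] [(.comul .K, 0), (.counit .K, 1)] [] := by
  refine h.total.holds [.rw h.coev_eval.symm 0 0, .up 1 1 false, .up 2 1 false,
    .rw h.coev_comul_dual 0 1, .up 2 2 false, .rw h.coev_counit_dual 1 3,
    .rw (h.total.slideR (.one .H) .K) 1 2, .rw h.hopf.mul_one 1 1,
    .rw h.coev_eval 0 0] ?_ ?_ <;> rfl

theorem DualPair.one_comul (h : M.DualPair) :
    M.Holds [] [(.one .K, 0), (.comul .K, 0)] [(.one .K, 0), (.one .K, 0)] := by
  refine h.total.holds [.rw h.eval_coev_two.symm 2 0, .up 1 1 false, .up 2 1 false, .up 3 1 false,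
    .rw h.comul_pair 4 0, .up 0 1 false, .up 1 1 false, .up 2 1 false, .up 3 1 false,
    .rw h.one_pair 4 0, .rw h.hopf.mul_counit 3 0, .up 1 2 true, .rw h.one_def.symm 0 0,
    .rw (h.total.slideR (.counit .H) .K).symm 2 0, .rw h.one_def.symm 1 1,
    .up 0 1 false] ?_ ?_ <;> rfl

theorem DualPair.mul_counit (h : M.DualPair) :
    M.Holds [.K, .K] [(.mul .K, 0), (.counit .K, 0)] [(.counit .K, 0), (.counit .K, 0)] := by
  refine h.total.holds [.rw h.counit_def 1 0, .up 0 1 false, .rw h.mul_pair 1 0,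
    .rw h.hopf.one_comul 0 2, .up 0 1 true, .up 1 1 true, .rw (h.total.slideR (.one .H) .K) 0 1,
    .up 1 1 true, .rw h.counit_def.symm 0 0, .rw h.counit_def.symm 1 0] ?_ ?_ <;> rfl

theorem DualPair.one_counit (h : M.DualPair) :
    M.Holds [] [(.one .K, 0), (.counit .K, 0)] [] := by
  refine h.total.holds [.rw h.counit_def 1 0, .up 0 1 false, .rw h.one_pair 1 0,
    .rw h.hopf.one_counit 0 0] ?_ ?_ <;> rfl

theorem DualPair.antipode_left (h : M.DualPair) :
    M.Holds [.K] [(.comul .K, 0), (.anti .K, 0), (.mul .K, 0)] [(.counit .K, 0), (.one .K, 0)] := by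
  refine h.total.holds [.rw h.coev_eval.symm 3 0, .up 0 3 false, .rw h.mul_pair 3 0,
    .up 2 1 false, .up 3 1 false, .rw h.antipode_pair 4 0,
    .rw (h.total.slideR (.anti .H) .K).symm 3 1, .up 1 1 false, .up 2 1 false,
    .rw h.comul_pair 3 0, .rw h.hopf.antipode_left 1 1, .rw h.one_def.symm 0 1, .up 0 1 true,
    .up 1 1 true, .rw h.counit_def.symm 0 0, .up 0 1 false, .up 0 1 true] ?_ ?_ <;> rfl

theorem DualPair.antipode_right (h : M.DualPair) :
    M.Holds [.K] [(.comul .K, 0), (.anti .K, 1), (.mul .K, 0)] [(.counit .K, 0), (.one .K, 0)] := by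
  refine h.total.holds [.rw h.coev_eval.symm 3 0, .up 0 3 false, .rw h.mul_pair 3 0,
    .up 2 1 false, .rw (h.total.slideL (.anti .K) .H) 3 1, .up 4 1 true, .rw h.antipode_pair 5 0,
    .up 1 1 false, .up 2 3 false, .rw h.comul_pair 3 0, .rw h.hopf.antipode_right 1 1,
    .rw h.one_def.symm 0 1, .up 0 1 true, .up 1 1 true, .rw h.counit_def.symm 0 0, .up 0 1 false,
    .up 0 1 true] ?_ ?_ <;> rfl

/-- The bialgebra axiom is self-dual: after pairing with H ⊗ H it becomes compatibility of Δ and m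
on H. Most steps bring the eight strings created by the two comultiplications into position. -/
theorem DualPair.mul_comul (h : M.DualPair) :
    M.Holds [.K, .K] [(.mul .K, 0), (.comul .K, 0)] [(.comul .K, 1), (.comul .K, 0),
      (.cross .K .K, 1), (.mul .K, 0), (.mul .K, 1)] := by
  refine h.total.holds [.rw h.eval_coev_two.symm 2 0, .up 0 2 false, .up 1 2 false, .up 2 2 false,
    -- The left side has become Δ(xy) in H paired with the two inputs; the axiom of H is used here,
    -- and what follows transposes its right side back.
    .rw h.comul_pair 4 0, .up 3 1 false, .rw h.mul_pair 4 0, .rw h.hopf.mul_comul 3 2,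
    .up 7 1 true, .up 9 1 false, .rw h.comul_pair.symm 8 2, .up 8 4 true,
    .rw (h.total.slideR (.mul .H) .K) 6 1, .rw h.comul_pair.symm 8 0, .up 8 4 false,
    .rw (h.total.slideL (.comul .K) .H).symm 7 2, .up 6 4 true,
    .rw (h.total.slideL (.comul .K) .H).symm 7 2, .up 6 1 false, .up 5 1 true, .up 6 1 true,
    .up 7 1 true, .up 9 1 false, .up 10 5 false, .rw (h.total.slideL (.cross .K .H) .H).symm 8 4,
    .up 8 3 true, .up 9 4 true, .up 10 4 true, .up 15 1 false,
    .rw (h.total.slideL (.pair .K .H) .H).symm 13 1, .up 8 3 false, .up 12 1 true, .up 0 6 true,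
    .up 1 5 true, .up 3 3 true, .up 4 3 true, .up 5 4 true, .up 6 4 true, .up 7 3 true,
    .up 11 1 false, .up 8 3 true, .up 9 3 true, .rw (h.total.slideR (.pair .K .H) .K) 8 2,
    .up 0 2 false, .up 1 11 false, .up 2 11 false, .up 3 11 false, .up 4 2 false, .up 5 1 false,
    .up 8 2 false, .up 11 3 true, .up 1 3 true, .up 2 3 true, .up 3 3 true, .up 4 3 true,
    .up 5 4 true, .up 6 4 true, .up 11 1 false, .up 7 4 true,
    .rw (h.total.slideL (.cross .K .K) .H).symm 5 1, .up 1 7 false, .up 2 7 false, .up 3 7 false,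
    .up 7 1 true, .up 9 2 false, .up 11 2 false, .up 4 1 true, .up 5 1 true, .up 6 1 true,
    .rw (h.total.slideR (.comul .H) .K) 7 3, .up 1 3 true, .up 2 3 true, .up 3 3 true,
    .up 4 3 true, .up 5 3 true, .up 6 3 true, .up 7 3 true,
    .rw (h.total.slideR (.comul .H) .K) 5 2, .up 10 3 false, .up 11 3 false, .up 12 3 false,
    .rw h.mul_pair.symm 9 4, .up 7 4 true, .up 8 4 true, .up 9 4 true, .rw h.mul_pair.symm 6 0,
    .up 0 1 true, .up 1 1 true, .up 2 1 true, .up 4 4 false, .up 5 4 false, .up 4 2 true,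
    .up 5 2 true, .up 8 2 false, .up 6 2 true, .rw (h.total.slideL (.mul .K) .H).symm 4 2,
    .up 3 5 true, .up 4 1 true, .up 6 1 false, .up 7 1 false, .rw h.eval_coev_two 5 0] ?_ ?_ <;> rfl

end Model

/-! ### Translation between diagram equations and equations of morphisms. -/

section
variable {X Y Z W : C}
-- The two digits count inputs and outputs; each of these definitions adds the trailing units of
-- `tens` to a morphism.
def b01 (f : 𝟙_ C ⟶ Z) : 𝟙_ C ⟶ Z ⊗ 𝟙_ C := f ≫ (ρ_ Z).inv
def b02 (f : 𝟙_ C ⟶ Z ⊗ W) : 𝟙_ C ⟶ Z ⊗ W ⊗ 𝟙_ C :=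
  f ≫ (ρ_ (Z ⊗ W)).inv ≫ (α_ Z W (𝟙_ C)).hom
def b10 (f : X ⟶ 𝟙_ C) : X ⊗ 𝟙_ C ⟶ 𝟙_ C := (ρ_ X).hom ≫ f
def b11 (f : X ⟶ Z) : X ⊗ 𝟙_ C ⟶ Z ⊗ 𝟙_ C := f ▷ 𝟙_ C
def b12 (f : X ⟶ Z ⊗ W) : X ⊗ 𝟙_ C ⟶ Z ⊗ W ⊗ 𝟙_ C := f ▷ 𝟙_ C ≫ (α_ Z W (𝟙_ C)).hom
def b20 (f : X ⊗ Y ⟶ 𝟙_ C) : X ⊗ Y ⊗ 𝟙_ C ⟶ 𝟙_ C := X ◁ (ρ_ Y).hom ≫ f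
def b21 (f : X ⊗ Y ⟶ Z) : X ⊗ Y ⊗ 𝟙_ C ⟶ Z ⊗ 𝟙_ C := (α_ X Y (𝟙_ C)).inv ≫ f ▷ 𝟙_ C
end
namespace Model
variable {M : Model C}
variable (M) in
def flatOb : List Wire → C
  | [] => 𝟙_ C
  | [x] => M.obj x
  | x :: y :: l => M.obj x ⊗ flatOb (y :: l)
variable (M) in
def flat : ∀ l : List Wire, M.ob l ≅ M.flatOb l
  | [] => Iso.refl _
  | [x] => ρ_ (M.obj x)
  | x :: y :: l => whiskerLeftIso (M.obj x) (flat (y :: l))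
-- Values are determined by the diagram, so a diagram equation can be tested on any computed values,
-- and conjugating by `i` and `j` brings these into bracketed form.
theorem holds_iff {a b : List Wire} {L L' : List Layer} {f g : M.ob a ⟶ M.ob b} {X Y : C} {x y : X
    ⟶ Y}
  (h : M.Val a L b f) (h' : M.Val a L' b g) (i : M.ob a ≅ X) (j : M.ob b ≅ Y)
  (e : f = i.hom ≫ x ≫ j.inv) (e' : g = i.hom ≫ y ≫ j.inv) : M.Holds a L L' ↔ x = y := by
  constructor
  · rintro ⟨b', k, h₁, h₂⟩
    obtain ⟨rfl, k₁⟩ := h.unique h₁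
    obtain ⟨-, k₂⟩ := h'.unique h₂
    have := (eq_of_heq k₁).trans (eq_of_heq k₂).symm
    rw [e, e'] at this
    simpa using this
  · rintro rfl
    exact ⟨b, f, h, h'.congr (e'.trans e.symm)⟩

theorem lay_box {g : Box} (post : List Wire) {f : M.ob g.dom ⟶ M.ob g.cod}
    (hf : M.hom g = some f) : M.Lay g 0 (g.dom ++ post) (g.cod ++ post)
      ((M.app g.dom post).hom ≫ f ▷ M.ob post ≫ (M.app g.cod post).inv) :=
  (Lay.here post hf rfl rfl).congr (by simp)

theorem monoid_iff {x : Wire}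
    {m : M.obj x ⊗ M.obj x ⟶ M.obj x} (hm : M.hom (.mul x) = some (b21 m))
    {u : 𝟙_ C ⟶ M.obj x} (hu : M.hom (.one x) = some (b01 u)) :
    (M.Holds [x, x, x] [(.mul x, 0), (.mul x, 0)] [(.mul x, 1), (.mul x, 0)] ↔
      m ▷ M.obj x ≫ m = (α_ _ _ _).hom ≫ M.obj x ◁ m ≫ m) ∧
    (M.Holds [x] [(.one x, 0), (.mul x, 0)] [] ↔
      u ▷ M.obj x ≫ m = (λ_ _).hom) ∧
    (M.Holds [x] [(.one x, 1), (.mul x, 0)] [] ↔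
      M.obj x ◁ u ≫ m = (ρ_ _).hom) := by
  refine ⟨?_, ?_, ?_⟩
  on_goal 3 => apply holds_iff (b := [x]) (i := M.flat [x] ≪≫ (ρ_ _).symm) (j := M.flat _)
  on_goal 2 => apply holds_iff (b := [x]) (i := M.flat [x] ≪≫ (λ_ _).symm) (j := M.flat _)
  on_goal 1 => apply holds_iff (b := [x]) (i := M.flat [x, x, x] ≪≫ (α_ _ _ _).symm) (j := M.flat _)
  -- The first alternative computes the values of the two diagrams box by box. The second compares
  -- them with the bracketed morphisms, which is pure coherence once the units are unfolded.
  all_goals first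
    | (repeat' first | assumption | exact rfl | apply Val.nil | apply Val.cons | apply lay_box |
        apply Lay.there); done
    | (simp only [app, flat, flatOb, ob, tens, Box.dom, Box.cod, List.cons_append, List.nil_append,
        List.append_eq, Iso.trans_hom, Iso.trans_inv, Iso.symm_hom, Iso.symm_inv,
        whiskerLeftIso_hom, whiskerLeftIso_inv, Iso.refl_hom, Iso.refl_inv, b01, b21]
       monoidal)

theorem comonoid_iff {x : Wire}
    {d : M.obj x ⟶ M.obj x ⊗ M.obj x} (hD : M.hom (.comul x) = some (b12 d))
    {e : M.obj x ⟶ 𝟙_ C} (hE : M.hom (.counit x) = some (b10 e)) :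
    (M.Holds [x] [(.comul x, 0), (.comul x, 1)] [(.comul x, 0), (.comul x, 0)] ↔
      d ≫ M.obj x ◁ d = d ≫ d ▷ M.obj x ≫ (α_ _ _ _).hom) ∧
    (M.Holds [x] [(.comul x, 0), (.counit x, 0)] [] ↔
      d ≫ e ▷ M.obj x ≫ (λ_ _).hom = 𝟙 _) ∧
    (M.Holds [x] [(.comul x, 0), (.counit x, 1)] [] ↔
      d ≫ M.obj x ◁ e ≫ (ρ_ _).hom = 𝟙 _) := by
  refine ⟨?_, ?_, ?_⟩
  on_goal 3 => apply holds_iff (b := [x]) (i := M.flat [x]) (j := M.flat _)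
  on_goal 2 => apply holds_iff (b := [x]) (i := M.flat [x]) (j := M.flat _)
  on_goal 1 => apply holds_iff (b := [x, x, x]) (i := M.flat [x]) (j := M.flat _)
  all_goals first
    | (repeat' first | assumption | exact rfl | apply Val.nil | apply Val.cons | apply lay_box |
        apply Lay.there); done
    | (simp only [app, flat, flatOb, ob, tens, Box.dom, Box.cod, List.cons_append, List.nil_append,
        List.append_eq, Iso.trans_hom, Iso.trans_inv, Iso.symm_hom, Iso.symm_inv,
        whiskerLeftIso_hom, whiskerLeftIso_inv, Iso.refl_hom, Iso.refl_inv, b10, b12]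
       monoidal)

theorem bimonoid_iff {x : Wire}
    {m : M.obj x ⊗ M.obj x ⟶ M.obj x} (hm : M.hom (.mul x) = some (b21 m))
    {u : 𝟙_ C ⟶ M.obj x} (hu : M.hom (.one x) = some (b01 u))
    {d : M.obj x ⟶ M.obj x ⊗ M.obj x} (hD : M.hom (.comul x) = some (b12 d))
    {e : M.obj x ⟶ 𝟙_ C} (hE : M.hom (.counit x) = some (b10 e)) :
    (M.Holds [x, x] [(.mul x, 0), (.comul x, 0)] [(.comul x, 1), (.comul x, 0), (.cross x x, 1),
      (.mul x, 0), (.mul x, 1)] ↔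
      m ≫ d = (d ⊗ₘ d) ≫ tensorμ _ _ _ _ ≫ (m ⊗ₘ m)) ∧
    (M.Holds [] [(.one x, 0), (.comul x, 0)] [(.one x, 0), (.one x, 0)] ↔
      u ≫ d = (λ_ _).inv ≫ (u ⊗ₘ u)) ∧
    (M.Holds [x, x] [(.mul x, 0), (.counit x, 0)] [(.counit x, 0), (.counit x, 0)] ↔
      m ≫ e = (e ⊗ₘ e) ≫ (λ_ _).hom) ∧
    (M.Holds [] [(.one x, 0), (.counit x, 0)] [] ↔
      u ≫ e = 𝟙 _) := by
  refine ⟨?_, ?_, ?_, ?_⟩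
  on_goal 4 => apply holds_iff (b := []) (i := M.flat []) (j := M.flat _)
  on_goal 3 => apply holds_iff (b := []) (i := M.flat [x, x]) (j := M.flat _)
  on_goal 2 => apply holds_iff (b := [x, x]) (i := M.flat []) (j := M.flat _)
  on_goal 1 => apply holds_iff (b := [x, x]) (i := M.flat [x, x]) (j := M.flat _)
  all_goals first
    | (repeat' first | assumption | exact rfl | apply Val.nil | apply Val.cons | apply lay_box |
        apply Lay.there); done
    | (simp only [app, flat, flatOb, ob, tens, Box.dom, Box.cod, List.cons_append, List.nil_append,
        List.append_eq, Iso.trans_hom, Iso.trans_inv, Iso.symm_hom, Iso.symm_inv,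
        whiskerLeftIso_hom, whiskerLeftIso_inv, Iso.refl_hom, Iso.refl_inv, tensorμ, hom, b01,
            b10, b12, b21,
        tensorHom_def' d d, MonoidalCategory.tensorHom_def m m, tensorHom_def' u u,
        MonoidalCategory.tensorHom_def e e]
       monoidal)

theorem antipode_iff {x : Wire}
    {m : M.obj x ⊗ M.obj x ⟶ M.obj x} (hm : M.hom (.mul x) = some (b21 m))
    {u : 𝟙_ C ⟶ M.obj x} (hu : M.hom (.one x) = some (b01 u))
    {d : M.obj x ⟶ M.obj x ⊗ M.obj x} (hD : M.hom (.comul x) = some (b12 d))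
    {e : M.obj x ⟶ 𝟙_ C} (hE : M.hom (.counit x) = some (b10 e))
    {s : M.obj x ⟶ M.obj x} (hS : M.hom (.anti x) = some (b11 s)) :
    (M.Holds [x] [(.comul x, 0), (.anti x, 0), (.mul x, 0)] [(.counit x, 0), (.one x, 0)] ↔
      d ≫ s ▷ M.obj x ≫ m = e ≫ u) ∧
    (M.Holds [x] [(.comul x, 0), (.anti x, 1), (.mul x, 0)] [(.counit x, 0), (.one x, 0)] ↔
      d ≫ M.obj x ◁ s ≫ m = e ≫ u) ∧
    (M.Holds [x] [(.anti x, 0), (.comul x, 0)] [(.comul x, 0), (.cross x x, 0), (.anti x, 0),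
      (.anti x, 1)] ↔
      s ≫ d = d ≫ (β_ _ _).hom ≫ (s ⊗ₘ s)) ∧
    (M.Holds [x, x] [(.mul x, 0), (.anti x, 0)] [(.anti x, 0), (.anti x, 1), (.cross x x, 0),
      (.mul x, 0)] ↔
      m ≫ s = (s ⊗ₘ s) ≫ (β_ _ _).hom ≫ m) ∧
    (M.Holds [x] [(.anti x, 0), (.counit x, 0)] [(.counit x, 0)] ↔
      s ≫ e = e) ∧
    (M.Holds [] [(.one x, 0), (.anti x, 0)] [(.one x, 0)] ↔
      u ≫ s = u) := by
  refine ⟨?_, ?_, ?_, ?_, ?_, ?_⟩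
  on_goal 6 => apply holds_iff (b := [x]) (i := M.flat []) (j := M.flat _)
  on_goal 5 => apply holds_iff (b := []) (i := M.flat [x]) (j := M.flat _)
  on_goal 4 => apply holds_iff (b := [x]) (i := M.flat [x, x]) (j := M.flat _)
  on_goal 3 => apply holds_iff (b := [x, x]) (i := M.flat [x]) (j := M.flat _)
  on_goal 2 => apply holds_iff (b := [x]) (i := M.flat [x]) (j := M.flat _)
  on_goal 1 => apply holds_iff (b := [x]) (i := M.flat [x]) (j := M.flat _)
  all_goals first
    | (repeat' first | assumption | exact rfl | apply Val.nil | apply Val.cons | apply lay_box |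
        apply Lay.there); done
    | (simp only [app, flat, flatOb, ob, tens, Box.dom, Box.cod, List.cons_append, List.nil_append,
        List.append_eq, Iso.trans_hom, Iso.trans_inv, Iso.symm_hom, Iso.symm_inv,
        whiskerLeftIso_hom, whiskerLeftIso_inv, Iso.refl_hom, Iso.refl_inv, hom, b01, b10, b11,
            b12, b21, MonoidalCategory.tensorHom_def s s]
       monoidal)

theorem symm_iff (x y : Wire) :
    M.Holds [x, y] [(.cross x y, 0), (.cross y x, 0)] [] ↔
      (β_ (M.obj x) (M.obj y)).hom ≫ (β_ (M.obj y) (M.obj x)).hom = 𝟙 _ := by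
  apply holds_iff (b := [x, y]) (i := M.flat [x, y]) (j := M.flat _)
  all_goals first
    | (repeat' first | assumption | exact rfl | apply Val.nil | apply Val.cons | apply lay_box |
        apply Lay.there); done
    | (simp only [app, flat, flatOb, ob, tens, Box.dom, Box.cod, List.cons_append, List.nil_append,
        List.append_eq, Iso.trans_hom, Iso.trans_inv, Iso.symm_hom, Iso.symm_inv,
        whiskerLeftIso_hom, whiskerLeftIso_inv, Iso.refl_hom, Iso.refl_inv, hom]
       monoidal)

theorem zigzag_iff {x y : Wire}
    {p : M.obj y ⊗ M.obj x ⟶ 𝟙_ C} (hp : M.hom (.pair y x) = some (b20 p))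
    {c : 𝟙_ C ⟶ M.obj x ⊗ M.obj y} (hc : M.hom (.copair x y) = some (b02 c)) :
    (M.Holds [y] [(.copair x y, 1), (.pair y x, 0)] [] ↔
      M.obj y ◁ c ≫ (α_ _ _ _).inv ≫ p ▷ M.obj y = (ρ_ _).hom ≫ (λ_ _).inv) ∧
    (M.Holds [x] [(.copair x y, 0), (.pair y x, 1)] [] ↔
      c ▷ M.obj x ≫ (α_ _ _ _).hom ≫ M.obj x ◁ p = (λ_ _).hom ≫ (ρ_ _).inv) := by
  refine ⟨?_, ?_⟩
  on_goal 2 => apply holds_iff (b := [x]) (i := M.flat [x] ≪≫ (λ_ _).symm) (j := M.flat _ ≪≫ (ρ_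
    _).symm)
  on_goal 1 => apply holds_iff (b := [y]) (i := M.flat [y] ≪≫ (ρ_ _).symm) (j := M.flat _ ≪≫ (λ_
    _).symm)
  all_goals first
    | (repeat' first | assumption | exact rfl | apply Val.nil | apply Val.cons | apply lay_box |
        apply Lay.there); done
    | (simp only [app, flat, flatOb, ob, tens, Box.dom, Box.cod, List.cons_append, List.nil_append,
        List.append_eq, Iso.trans_hom, Iso.trans_inv, Iso.symm_hom, Iso.symm_inv,
        whiskerLeftIso_hom, whiskerLeftIso_inv, Iso.refl_hom, Iso.refl_inv, b02, b20]
       monoidal)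

theorem quasiDual_iff {x y : Wire}
    {p : M.obj y ⊗ M.obj x ⟶ 𝟙_ C} (hp : M.hom (.pair y x) = some (b20 p))
    {m : M.obj x ⊗ M.obj x ⟶ M.obj x} (hm : M.hom (.mul x) = some (b21 m))
    {u : 𝟙_ C ⟶ M.obj x} (hu : M.hom (.one x) = some (b01 u))
    {d : M.obj x ⟶ M.obj x ⊗ M.obj x} (hD : M.hom (.comul x) = some (b12 d))
    {e : M.obj x ⟶ 𝟙_ C} (hE : M.hom (.counit x) = some (b10 e))
    {s : M.obj x ⟶ M.obj x} (hS : M.hom (.anti x) = some (b11 s))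
    {m' : M.obj y ⊗ M.obj y ⟶ M.obj y} (hm' : M.hom (.mul y) = some (b21 m'))
    {u' : 𝟙_ C ⟶ M.obj y} (hu' : M.hom (.one y) = some (b01 u'))
    {d' : M.obj y ⟶ M.obj y ⊗ M.obj y} (hD' : M.hom (.comul y) = some (b12 d'))
    {e' : M.obj y ⟶ 𝟙_ C} (hE' : M.hom (.counit y) = some (b10 e'))
    {s' : M.obj y ⟶ M.obj y} (hS' : M.hom (.anti y) = some (b11 s')) :
    (M.Holds [y, x, x] [(.comul y, 0), (.cross y x, 1), (.pair y x, 0), (.pair y x, 0)] [(.mul x,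
      1), (.pair y x, 0)] ↔
      d' ▷ (M.obj x ⊗ M.obj x) ≫ pairTwo p = M.obj y ◁ m ≫ p) ∧
    (M.Holds [y] [(.counit y, 0)] [(.one x, 1), (.pair y x, 0)] ↔
      e' = (ρ_ _).inv ≫ M.obj y ◁ u ≫ p) ∧
    (M.Holds [y, y, x] [(.mul y, 0), (.pair y x, 0)] [(.comul x, 2), (.cross y x, 1), (.pair y x,
      0), (.pair y x, 0)] ↔
      m' ▷ M.obj x ≫ p = (M.obj y ⊗ M.obj y) ◁ d ≫ pairTwo p) ∧
    (M.Holds [x] [(.one y, 0), (.pair y x, 0)] [(.counit x, 0)] ↔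
      u' ▷ M.obj x ≫ p = (λ_ _).hom ≫ e) ∧
    (M.Holds [y, x] [(.anti y, 0), (.pair y x, 0)] [(.anti x, 1), (.pair y x, 0)] ↔
      s' ▷ M.obj x ≫ p = M.obj y ◁ s ≫ p) := by
  refine ⟨?_, ?_, ?_, ?_, ?_⟩
  on_goal 5 => apply holds_iff (b := []) (i := M.flat [y, x]) (j := M.flat _)
  on_goal 4 => apply holds_iff (b := []) (i := M.flat [x] ≪≫ (λ_ _).symm) (j := M.flat _)
  on_goal 3 => apply holds_iff (b := []) (i := M.flat [y, y, x] ≪≫ (α_ _ _ _).symm) (j := M.flat _)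
  on_goal 2 => apply holds_iff (b := []) (i := M.flat [y]) (j := M.flat _)
  on_goal 1 => apply holds_iff (b := []) (i := M.flat [y, x, x]) (j := M.flat _)
  all_goals first
    | (repeat' first | assumption | exact rfl | apply Val.nil | apply Val.cons | apply lay_box |
        apply Lay.there); done
    | (simp only [app, flat, flatOb, ob, tens, Box.dom, Box.cod, List.cons_append, List.nil_append,
        List.append_eq, Iso.trans_hom, Iso.trans_inv, Iso.symm_hom, Iso.symm_inv,
        whiskerLeftIso_hom, whiskerLeftIso_inv, Iso.refl_hom, Iso.refl_inv, hom, tensorμ, pairTwo,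
            b01, b10, b11, b12, b20,
        b21, MonoidalCategory.tensorHom_def p p]
       monoidal)

end Model

section
variable {H K : C} (p : K ⊗ H ⟶ 𝟙_ C) (c : 𝟙_ C ⟶ H ⊗ K)

/-! ### The dual Hopf algebra -/

/-- The transpose of the comultiplication of `H`. -/
def dualMul (d : H ⟶ H ⊗ H) : K ⊗ K ⟶ K :=
  𝟙 _ ⊗≫ (K ⊗ K) ◁ c ⊗≫ K ◁ K ◁ d ▷ K ⊗≫ K ◁ (β_ K H).hom ▷ H ▷ K ⊗≫ p ▷ (K ⊗ H ⊗ K) ⊗≫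
    p ▷ K ⊗≫ 𝟙 _

/-- The transpose of the counit of `H`. -/
def dualOne (e : H ⟶ 𝟙_ C) : 𝟙_ C ⟶ K := c ≫ e ▷ K ≫ (λ_ K).hom

/-- The transpose of the multiplication of `H`. -/
def dualComul (m : H ⊗ H ⟶ H) : K ⟶ K ⊗ K :=
  𝟙 _ ⊗≫ K ◁ c ⊗≫ K ◁ H ◁ K ◁ c ⊗≫ K ◁ H ◁ (β_ K H).hom ▷ K ⊗≫ K ◁ m ▷ K ▷ K ⊗≫
    p ▷ (K ⊗ K) ⊗≫ 𝟙 _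

/-- The transpose of the unit of `H`. -/
def dualCounit (u : 𝟙_ C ⟶ H) : K ⟶ 𝟙_ C := (ρ_ K).inv ≫ K ◁ u ≫ p

/-- The transpose of the antipode of `H`. -/
def dualAntipode (s : H ⟶ H) : K ⟶ K := 𝟙 _ ⊗≫ K ◁ c ⊗≫ K ◁ s ▷ K ⊗≫ p ▷ K ⊗≫ 𝟙 _

/-- The coevaluation of `H ⊗ H` and `K ⊗ K`. -/
def copairTwo : 𝟙_ C ⟶ (H ⊗ H) ⊗ (K ⊗ K) :=
  𝟙 _ ⊗≫ c ⊗≫ (H ⊗ K) ◁ c ⊗≫ H ◁ (β_ K H).hom ▷ K ⊗≫ 𝟙 _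

end

namespace Model
variable {M : Model C}

theorem dual_iff {x y : Wire}
    {p : M.obj y ⊗ M.obj x ⟶ 𝟙_ C} (hp : M.hom (.pair y x) = some (b20 p))
    {c : 𝟙_ C ⟶ M.obj x ⊗ M.obj y} (hc : M.hom (.copair x y) = some (b02 c))
    {m : M.obj x ⊗ M.obj x ⟶ M.obj x} (hm : M.hom (.mul x) = some (b21 m))
    {u : 𝟙_ C ⟶ M.obj x} (hu : M.hom (.one x) = some (b01 u))
    {d : M.obj x ⟶ M.obj x ⊗ M.obj x} (hD : M.hom (.comul x) = some (b12 d))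
    {e : M.obj x ⟶ 𝟙_ C} (hE : M.hom (.counit x) = some (b10 e))
    {s : M.obj x ⟶ M.obj x} (hS : M.hom (.anti x) = some (b11 s))
    {m' : M.obj y ⊗ M.obj y ⟶ M.obj y} (hm' : M.hom (.mul y) = some (b21 m'))
    {u' : 𝟙_ C ⟶ M.obj y} (hu' : M.hom (.one y) = some (b01 u'))
    {d' : M.obj y ⟶ M.obj y ⊗ M.obj y} (hD' : M.hom (.comul y) = some (b12 d'))
    {e' : M.obj y ⟶ 𝟙_ C} (hE' : M.hom (.counit y) = some (b10 e'))
    {s' : M.obj y ⟶ M.obj y} (hS' : M.hom (.anti y) = some (b11 s')) :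
    (M.Holds [y, y] [(.mul y, 0)] [(.copair x y, 2), (.comul x, 2), (.cross y x, 1), (.pair y x,
      0), (.pair y x, 0)] ↔
      m' = dualMul p c d) ∧
    (M.Holds [] [(.one y, 0)] [(.copair x y, 0), (.counit x, 0)] ↔
      u' = dualOne c e) ∧
    (M.Holds [y] [(.comul y, 0)] [(.copair x y, 1), (.copair x y, 3), (.cross y x, 2), (.mul x,
      1), (.pair y x, 0)] ↔
      d' = dualComul p c m) ∧
    (M.Holds [y] [(.counit y, 0)] [(.one x, 1), (.pair y x, 0)] ↔
      e' = dualCounit p u) ∧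
    (M.Holds [y] [(.anti y, 0)] [(.copair x y, 1), (.anti x, 1), (.pair y x, 0)] ↔
      s' = dualAntipode p c s) := by
  refine ⟨?_, ?_, ?_, ?_, ?_⟩
  on_goal 5 => apply holds_iff (b := [y]) (i := M.flat [y]) (j := M.flat _)
  on_goal 4 => apply holds_iff (b := []) (i := M.flat [y]) (j := M.flat _)
  on_goal 3 => apply holds_iff (b := [y, y]) (i := M.flat [y]) (j := M.flat _)
  on_goal 2 => apply holds_iff (b := [y]) (i := M.flat []) (j := M.flat _)
  on_goal 1 => apply holds_iff (b := [y]) (i := M.flat [y, y]) (j := M.flat _)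
  all_goals first
    | (repeat' first | assumption | exact rfl | apply Val.nil | apply Val.cons | apply lay_box |
        apply Lay.there); done
    | (simp only [app, flat, flatOb, ob, tens, Box.dom, Box.cod, List.cons_append, List.nil_append,
        List.append_eq, Iso.trans_hom, Iso.trans_inv, Iso.symm_hom, Iso.symm_inv,
        whiskerLeftIso_hom, whiskerLeftIso_inv, Iso.refl_hom, Iso.refl_inv, hom, b01, b02, b10,
            b11, b12, b20, b21, dualMul, dualOne,
        dualComul, dualCounit, dualAntipode]
       monoidal)

theorem zigzagTwo_iff {x y : Wire}
    {p : M.obj y ⊗ M.obj x ⟶ 𝟙_ C} (hp : M.hom (.pair y x) = some (b20 p))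
    {c : 𝟙_ C ⟶ M.obj x ⊗ M.obj y} (hc : M.hom (.copair x y) = some (b02 c)) :
    M.Holds [y, y] [(.copair x y, 2), (.copair x y, 4), (.cross y x, 3), (.cross y x, 1),
      (.pair y x, 0), (.pair y x, 0)] [] ↔
      (M.obj y ⊗ M.obj y) ◁ copairTwo c ≫ (α_ _ _ _).inv ≫ pairTwo p ▷ (M.obj y ⊗ M.obj y) =
      (ρ_ _).hom ≫ (λ_ _).inv := by
  apply holds_iff (b := [y, y]) (i := M.flat [y, y] ≪≫ (ρ_ _).symm) (j := M.flat _ ≪≫ (λ_ _).symm)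
  all_goals first
    | (repeat' first | assumption | exact rfl | apply Val.nil | apply Val.cons | apply lay_box |
        apply Lay.there); done
    | (simp only [app, flat, flatOb, ob, tens, Box.dom, Box.cod, List.cons_append, List.nil_append,
        List.append_eq, Iso.trans_hom, Iso.trans_inv, Iso.symm_hom, Iso.symm_inv,
        whiskerLeftIso_hom, whiskerLeftIso_inv, Iso.refl_hom, Iso.refl_inv, hom, b02, b20,
            tensorμ, pairTwo,
        copairTwo, MonoidalCategory.tensorHom_def p p]
       monoidal)

/-- The interpretation of the wire `H` as a Hopf algebra, and of the wire `K` as its dual. -/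
abbrev dual (H K : C) [HopfObj H] (p : K ⊗ H ⟶ 𝟙_ C) (c : 𝟙_ C ⟶ H ⊗ K) : Model C where
  obj := fun | .H => H | _ => K
  box := fun
    | .mul .H => some (b21 μ[H])
    | .one .H => some (b01 η[H])
    | .comul .H => some (b12 Δ[H])
    | .counit .H => some (b10 ε[H])
    | .anti .H => some (b11 (HopfObj.antipode (X := H)))
    | .mul .K => some (b21 (dualMul p c Δ[H]))
    | .one .K => some (b01 (dualOne c ε[H]))
    | .comul .K => some (b12 (dualComul p c μ[H]))
    | .counit .K => some (b10 (dualCounit p η[H]))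
    | .anti .K => some (b11 (dualAntipode p c (HopfObj.antipode (X := H))))
    | .pair .K .H => some (b20 p)
    | .copair .H .K => some (b02 c)
    | _ => none

theorem isHopf_of {x : Wire} [HopfObj (M.obj x)]
    (hm : M.hom (.mul x) = some (b21 μ[M.obj x])) (hu : M.hom (.one x) = some (b01 η[M.obj x]))
    (hD : M.hom (.comul x) = some (b12 Δ[M.obj x]))
    (hE : M.hom (.counit x) = some (b10 ε[M.obj x]))
    (hS : M.hom (.anti x) = some (b11 (HopfObj.antipode (X := M.obj x)))) : M.IsHopf x := by
  obtain ⟨i₁, i₂, i₃⟩ := monoid_iff hm hu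
  obtain ⟨j₁, j₂, j₃⟩ := comonoid_iff hD hE
  obtain ⟨k₁, k₂, k₃, k₄⟩ := bimonoid_iff hm hu hD hE
  obtain ⟨l₁, l₂, l₃, l₄, l₅, l₆⟩ := antipode_iff hm hu hD hE hS
  refine { mul_assoc := i₁.2 (by simp), one_mul := i₂.2 (by simp), mul_one := i₃.2 (by simp)
           comul_assoc := j₁.2 (by simp), counit_comul := j₂.2 (by simp)
           comul_counit := j₃.2 (by simp), mul_comul := k₁.2 (BimonObj.mul_comul _)
           one_comul := k₂.2 (BimonObj.one_comul _), mul_counit := k₃.2 (BimonObj.mul_counit _)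
           one_counit := k₄.2 (BimonObj.one_counit _)
           antipode_left := l₁.2 (HopfObj.antipode_left _)
           antipode_right := l₂.2 (HopfObj.antipode_right _)
           antipode_comul := l₃.2 (HopfObj.antipode_comul _)
           mul_antipode := l₄.2 (HopfObj.mul_antipode _)
           antipode_counit := l₅.2 (HopfObj.antipode_counit _)
           one_antipode := l₆.2 (HopfObj.one_antipode _) }

theorem isHopf_dual (H K : C) [HopfObj H] (p : K ⊗ H ⟶ 𝟙_ C) (c : 𝟙_ C ⟶ H ⊗ K) :
    (dual H K p c).IsHopf .H := by
  letI : HopfObj ((dual H K p c).obj .H) := inferInstanceAs (HopfObj H)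
  exact isHopf_of rfl rfl rfl rfl rfl

end Model

open Model

/-! ### Existence and uniqueness of the dual Hopf algebra. -/

section
variable {H K : C} [HopfObj H] {p : K ⊗ H ⟶ 𝟙_ C} {c : 𝟙_ C ⟶ H ⊗ K}

/-- `p` and `c` make `K` a left dual of `H`, and the braiding is symmetric on `H`. -/
structure IsSymmDual (H K : C) (p : K ⊗ H ⟶ 𝟙_ C) (c : 𝟙_ C ⟶ H ⊗ K) : Prop where
  symm : (β_ H H).hom ≫ (β_ H H).hom = 𝟙 _
  coev_eval : K ◁ c ≫ (α_ _ _ _).inv ≫ p ▷ K = (ρ_ _).hom ≫ (λ_ _).inv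
  eval_coev : c ▷ H ≫ (α_ _ _ _).hom ≫ H ◁ p = (λ_ _).hom ≫ (ρ_ _).inv

/-- Nondegeneracy: the zigzag identity rebuilds f from f ▷ Z ≫ p. -/
theorem pair_cancel {X Y Z : C} {p : Y ⊗ Z ⟶ 𝟙_ C} {c : 𝟙_ C ⟶ Z ⊗ Y}
    (h : Y ◁ c ≫ (α_ _ _ _).inv ≫ p ▷ Y = (ρ_ _).hom ≫ (λ_ _).inv) {f g : X ⟶ Y}
    (e : f ▷ Z ≫ p = g ▷ Z ≫ p) : f = g := by
  have key : ∀ f : X ⟶ Y, f = (ρ_ _).inv ≫ X ◁ c ⊗≫ (f ▷ Z ≫ p) ▷ Y ≫ (λ_ _).hom := fun f => by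
    calc f = f ⊗≫ (Y ◁ c ≫ (α_ _ _ _).inv ≫ p ▷ Y) ⊗≫ 𝟙 Y := by rw [h]; monoidal
      _ = 𝟙 _ ⊗≫ (f ▷ 𝟙_ C ≫ Y ◁ c) ⊗≫ p ▷ Y ⊗≫ 𝟙 Y := by monoidal
      _ = _ := by rw [← whisker_exchange]; monoidal
  rw [key f, key g, e]

theorem hopfObj_ext {X : C} (D D' : HopfObj X)
    (h₁ : D.toBimonObj.toMonObj.mul = D'.toBimonObj.toMonObj.mul)
    (h₂ : D.toBimonObj.toMonObj.one = D'.toBimonObj.toMonObj.one)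
    (h₃ : D.toBimonObj.toComonObj.comul = D'.toBimonObj.toComonObj.comul)
    (h₄ : D.toBimonObj.toComonObj.counit = D'.toBimonObj.toComonObj.counit)
    (h₅ : D.antipode = D'.antipode) : D = D' := by
  obtain @⟨@⟨⟨⟩, ⟨⟩⟩⟩ := D
  obtain @⟨@⟨⟨⟩, ⟨⟩⟩⟩ := D'
  dsimp only at h₁ h₂ h₃ h₄ h₅
  subst h₁ h₂ h₃ h₄ h₅
  rfl

namespace IsSymmDual

theorem dualPair (h : IsSymmDual H K p c) : (Model.dual H K p c).DualPair := by
  obtain ⟨i₁, i₂⟩ := zigzag_iff (M := .dual H K p c) (x := .H) (y := .K) rfl rfl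
  obtain ⟨j₁, j₂, j₃, j₄, j₅⟩ := dual_iff (M := .dual H K p c) (x := .H) (y := .K)
    rfl rfl rfl rfl rfl rfl rfl rfl rfl rfl rfl rfl
  exact { total := by intro g hg; unfold dualPairBox at hg; split at hg <;> first | rfl | cases hg
          hopf := isHopf_dual H K p c
          symm_HH := (symm_iff (M := .dual H K p c) .H .H).2 h.symm
          coev_eval := i₁.2 h.coev_eval
          eval_coev := i₂.2 h.eval_coev
          mul_def := j₁.2 rfl
          one_def := j₂.2 rfl
          comul_def := j₃.2 rfl
          counit_def := j₄.2 rfl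
          antipode_def := j₅.2 rfl }

theorem symm_left (h : IsSymmDual H K p c) : (β_ K H).hom ≫ (β_ H K).hom = 𝟙 _ :=
  (symm_iff (M := .dual H K p c) .K .H).1 h.dualPair.symm_KH

theorem symm_right (h : IsSymmDual H K p c) : (β_ H K).hom ≫ (β_ K H).hom = 𝟙 _ :=
  (symm_iff (M := .dual H K p c) .H .K).1 h.dualPair.symm_HK

theorem symm_dual (h : IsSymmDual H K p c) : (β_ K K).hom ≫ (β_ K K).hom = 𝟙 _ :=
  (symm_iff (M := .dual H K p c) .K .K).1 h.dualPair.symm_KK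

/-- The dual Hopf algebra. -/
abbrev hopf (h : IsSymmDual H K p c) : HopfObj K where
  mul := dualMul p c Δ[H]
  one := dualOne c ε[H]
  comul := dualComul p c μ[H]
  counit := dualCounit p η[H]
  antipode := dualAntipode p c (HopfObj.antipode (X := H))
  one_mul := (monoid_iff (M := .dual H K p c) (x := .K) rfl rfl).2.1.1 h.dualPair.one_mul
  mul_one := (monoid_iff (M := .dual H K p c) (x := .K) rfl rfl).2.2.1 h.dualPair.mul_one
  mul_assoc := (monoid_iff (M := .dual H K p c) (x := .K) rfl rfl).1.1 h.dualPair.mul_assoc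
  counit_comul := by
    have := (comonoid_iff (M := .dual H K p c) (x := .K) rfl rfl).2.1.1 h.dualPair.counit_comul
    rw [← Category.assoc] at this; exact (Iso.comp_hom_eq_id (λ_ K)).1 this
  comul_counit := by
    have := (comonoid_iff (M := .dual H K p c) (x := .K) rfl rfl).2.2.1 h.dualPair.comul_counit
    rw [← Category.assoc] at this; exact (Iso.comp_hom_eq_id (ρ_ K)).1 this
  comul_assoc := (comonoid_iff (M := .dual H K p c) (x := .K) rfl rfl).1.1 h.dualPair.comul_assoc
  mul_comul := (bimonoid_iff (M := .dual H K p c) (x := .K) rfl rfl rfl rfl).1.1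
    h.dualPair.mul_comul
  one_comul := (bimonoid_iff (M := .dual H K p c) (x := .K) rfl rfl rfl rfl).2.1.1
    h.dualPair.one_comul
  mul_counit := (bimonoid_iff (M := .dual H K p c) (x := .K) rfl rfl rfl rfl).2.2.1.1
    h.dualPair.mul_counit
  one_counit := (bimonoid_iff (M := .dual H K p c) (x := .K) rfl rfl rfl rfl).2.2.2.1
    h.dualPair.one_counit
  antipode_left := (antipode_iff (M := .dual H K p c) (x := .K) rfl rfl rfl rfl rfl).1.1
    h.dualPair.antipode_left
  antipode_right := (antipode_iff (M := .dual H K p c) (x := .K) rfl rfl rfl rfl rfl).2.1.1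
    h.dualPair.antipode_right

theorem isQuasiDual_hopf (h : IsSymmDual H K p c) : letI := h.hopf; IsQuasiDual K H p := by
  obtain ⟨i₁, -, i₃, i₄, i₅⟩ := quasiDual_iff (M := .dual H K p c) (x := .H) (y := .K)
    rfl rfl rfl rfl rfl rfl rfl rfl rfl rfl rfl
  letI := h.hopf
  exact ⟨i₁.1 h.dualPair.comul_pair, rfl, i₃.1 h.dualPair.mul_pair, i₄.1 h.dualPair.one_pair,
    i₅.1 h.dualPair.antipode_pair⟩

theorem hopf_unique (h : IsSymmDual H K p c) (D D' : HopfObj K)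
    (hD : @IsQuasiDual C _ _ _ K H D _ p) (hD' : @IsQuasiDual C _ _ _ K H D' _ p) : D = D' := by
  have z := zigzagTwo_iff (M := .dual H K p c) (x := .H) (y := .K) rfl rfl
  have e (D : HopfObj K) (hD : IsQuasiDual K H p) := And.intro hD.mul_pair <|
    And.intro hD.one_pair <| And.intro hD.comul_pair <| And.intro hD.counit_pair hD.antipode_pair
  obtain ⟨i₁, i₂, i₃, i₄, i₅⟩ := @e D hD
  obtain ⟨j₁, j₂, j₃, j₄, j₅⟩ := @e D' hD'
  -- Multiplication, unit and antipode take values in K, and are compared through the pairing with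
  -- H; the comultiplication takes values in K ⊗ K and needs the double pairing. The counit is given
  -- outright.
  exact hopfObj_ext D D' (pair_cancel h.coev_eval (i₁.trans j₁.symm))
    (pair_cancel h.coev_eval (i₂.trans j₂.symm))
    (pair_cancel (z.1 h.dualPair.eval_coev_two) (i₃.trans j₃.symm)) (i₄.trans j₄.symm)
    (pair_cancel h.coev_eval (i₅.trans j₅.symm))

end IsSymmDual
end

/-! ### The dual acted on by translations. -/

section
variable {H K : C} (p : K ⊗ H ⟶ 𝟙_ C)

/-- The action of `H` on its dual by translations: `h · k = k₁ ⟨k₂, h⟩`. -/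
def translate [ComonObj K] : H ⊗ K ⟶ K :=
  𝟙 _ ⊗≫ H ◁ Δ[K] ⊗≫ (β_ H K).hom ▷ K ⊗≫ K ◁ ((β_ H K).hom ≫ p) ⊗≫ 𝟙 _

/-- The projection onto the coinvariants of the dual. -/
def coinvariants (c : 𝟙_ C ⟶ H ⊗ K) [HopfObj H] [HopfObj K] : K ⟶ K :=
  𝟙 _ ⊗≫ c ▷ K ⊗≫ H ◁ μ[K] ≫ HopfObj.antipode (X := H) ▷ K ≫
    HopfObj.antipode (X := H) ▷ K ≫ translate p

end

namespace Model

variable {M : Model C}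

/-- The wires `H` and `K` are Hopf algebras in duality, and their braidings are symmetric. -/
structure IsDual (M : Model C) (x y : Wire) : Prop where
  hopf_left : M.IsHopf x
  hopf_right : M.IsHopf y
  symm_left : M.Holds [x, x] [(.cross x x, 0), (.cross x x, 0)] []
  symm_left_right : M.Holds [x, y] [(.cross x y, 0), (.cross y x, 0)] []
  symm_right_left : M.Holds [y, x] [(.cross y x, 0), (.cross x y, 0)] []
  symm_right : M.Holds [y, y] [(.cross y y, 0), (.cross y y, 0)] []
  coev_eval : M.Holds [y] [(.copair x y, 1), (.pair y x, 0)] []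
  eval_coev : M.Holds [x] [(.copair x y, 0), (.pair y x, 1)] []
  comul_pair : M.Holds [y, x, x] [(.comul y, 0), (.cross y x, 1), (.pair y x, 0), (.pair y x,
    0)] [(.mul x, 1), (.pair y x, 0)]
  counit_pair : M.Holds [y] [(.counit y, 0)] [(.one x, 1), (.pair y x, 0)]
  mul_pair : M.Holds [y, y, x] [(.mul y, 0), (.pair y x, 0)] [(.comul x, 2), (.cross y x, 1),
    (.pair y x, 0), (.pair y x, 0)]
  one_pair : M.Holds [x] [(.one y, 0), (.pair y x, 0)] [(.counit x, 0)]
  antipode_pair : M.Holds [y, x] [(.anti y, 0), (.pair y x, 0)] [(.anti x, 1), (.pair y x, 0)]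

def regularActionBox : Box → Bool
  | .mul .H | .one .H | .comul .H | .counit .H | .anti .H => true
  | .mul .K | .one .K | .comul .K | .counit .K | .anti .K | .coanti .K | .proj .K => true
  | .copair .H .K | .pair .K .H | .copair .K .H | .pair .H .K | .act .H .K => true
  | _ => false

/-- The action of `H` on its dual `K` by translations. -/
structure RegularAction (M : Model C) : Prop where
  total : M.Total regularActionBox
  dual : M.IsDual .H .K
  pair_def : M.Holds [.H, .K] [(.pair .H .K, 0)] [(.cross .H .K, 0), (.pair .K .H, 0)]
  copair_def : M.Holds [] [(.copair .K .H, 0)] [(.copair .H .K, 0), (.cross .H .K, 0)]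
  act_def : M.Holds [.H, .K] [(.act .H .K, 0)] [(.comul .K, 1), (.cross .H .K, 0), (.pair .H .K, 1)]
  proj_def : M.Holds [.K] [(.proj .K, 0)] [(.copair .H .K, 0), (.mul .K, 1), (.anti .H, 0),
    (.anti .H, 0), (.act .H .K, 0)]

/-- With symmetric crossings, the pairing and copairing composed with braidings make H a left dual
of K as well. -/
theorem RegularAction.coev_eval (h : M.RegularAction) :
    M.Holds [.H] [(.copair .K .H, 1), (.pair .H .K, 0)] [] := by
  refine h.total.holds [.rw h.pair_def 1 0, .rw h.copair_def 0 1, .rw h.dual.symm_left.symm 1 0,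
    .rw (h.total.slideL (.cross .H .H) .K) 2 0, .rw (h.total.slideR (.copair .H .K) .H) 0 0,
    .rw (h.total.slideR (.pair .K .H) .H).symm 1 0, .rw h.dual.eval_coev 0 0] ?_ ?_ <;> rfl

theorem RegularAction.eval_coev (h : M.RegularAction) :
    M.Holds [.K] [(.copair .K .H, 0), (.pair .H .K, 1)] [] := by
  refine h.total.holds [.rw h.pair_def 1 1, .rw h.copair_def 0 0, .rw h.dual.symm_right.symm 1 1,
    .rw (h.total.slideL (.cross .H .K) .K).symm 2 0, .rw (h.total.slideL (.copair .H .K) .K) 0 0,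
    .rw (h.total.slideL (.pair .K .H) .K).symm 1 0, .rw h.dual.coev_eval 0 0] ?_ ?_ <;> rfl

theorem RegularAction.comul_pair (h : M.RegularAction) :
    M.Holds [.H, .K, .K] [(.comul .H, 0), (.cross .H .K, 1), (.pair .H .K, 0), (.pair .H .K,
      0)] [(.mul .K, 1), (.pair .H .K, 0)] := by
  refine h.total.holds [.rw h.pair_def 3 0, .rw h.pair_def 2 0,
    .rw (h.total.slideL (.comul .H) .K) 0 0, .up 2 1 false, .rw h.dual.symm_left_right.symm 3 1,
    .rw (h.total.slideL (.comul .H) .K) 1 1, .rw h.dual.mul_pair.symm 2 0,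
    .rw (h.total.slideR (.mul .K) .H).symm 0 0, .rw h.pair_def.symm 1 0] ?_ ?_ <;> rfl

theorem RegularAction.mul_pair (h : M.RegularAction) :
    M.Holds [.H, .H, .K] [(.mul .H, 0), (.pair .H .K, 0)] [(.comul .K, 2), (.cross .H .K, 1),
      (.pair .H .K, 0), (.pair .H .K, 0)] := by
  refine h.total.holds [.rw h.pair_def 1 0, .rw (h.total.slideL (.mul .H) .K) 0 0,
    .rw h.dual.comul_pair.symm 2 0, .rw (h.total.slideR (.comul .K) .H).symm 1 0,
    .rw h.dual.symm_left_right 3 1, .rw (h.total.slideR (.comul .K) .H).symm 0 1, .up 2 1 true,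
    .up 3 1 true, .rw h.pair_def.symm 4 0, .rw h.pair_def.symm 2 0] ?_ ?_ <;> rfl

theorem RegularAction.counit_pair (h : M.RegularAction) :
    M.Holds [.H] [(.counit .H, 0)] [(.one .K, 1), (.pair .H .K, 0)] := by
  refine h.total.holds [.rw h.dual.one_pair.symm 0 0, .rw (h.total.slideR (.one .K) .H).symm 0 0,
    .rw (h.total.slideR (.one .K) .H) 0 0, .rw (h.total.slideR (.one .K) .H).symm 0 0,
    .rw h.pair_def.symm 1 0] ?_ ?_ <;> rfl

theorem RegularAction.one_pair (h : M.RegularAction) :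
    M.Holds [.K] [(.one .H, 0), (.pair .H .K, 0)] [(.counit .K, 0)] := by
  refine h.total.holds [.rw h.pair_def 1 0, .rw (h.total.slideL (.one .H) .K) 0 0,
    .rw h.dual.counit_pair.symm 0 0] ?_ ?_ <;> rfl

theorem RegularAction.antipode_pair (h : M.RegularAction) :
    M.Holds [.H, .K] [(.anti .H, 0), (.pair .H .K, 0)] [(.anti .K, 1), (.pair .H .K, 0)] := by
  refine h.total.holds [.rw h.pair_def 1 0, .rw (h.total.slideL (.anti .H) .K) 0 0,
    .rw h.dual.antipode_pair.symm 1 0, .rw (h.total.slideR (.anti .K) .H).symm 0 0,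
    .rw h.pair_def.symm 1 0] ?_ ?_ <;> rfl

/-- The transpose of a left inverse of the antipode of K is a right inverse of the antipode of H,
because the two antipodes are transposes of each other. -/
theorem RegularAction.antipode_section (h : M.RegularAction)
    (ht : M.Holds [.K] [(.anti .K, 0), (.coanti .K, 0)] []) :
    M.Holds [.H] [(.copair .H .K, 0), (.coanti .K, 1), (.pair .K .H, 1), (.anti .H, 0)] [] := by
  refine h.total.holds [.up 1 2 true, .rw h.dual.eval_coev.symm 2 0, .up 0 2 true,
    .rw h.dual.antipode_pair.symm 2 1, .up 1 1 true, .rw h.dual.coev_eval 2 1, .rw ht 1 1,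
    .rw h.dual.eval_coev 0 0] ?_ ?_ <;> rfl

theorem RegularAction.one_act (h : M.RegularAction) :
    M.Holds [.K] [(.one .H, 0), (.act .H .K, 0)] [] := by
  refine h.total.holds [.rw h.act_def 1 0, .up 0 1 false, .rw (h.total.slideL (.one .H) .K) 1 0,
    .rw h.one_pair 1 1, .rw h.dual.hopf_right.comul_counit 0 0] ?_ ?_ <;> rfl

theorem RegularAction.mul_act (h : M.RegularAction) :
    M.Holds [.H, .H, .K] [(.mul .H, 0), (.act .H .K, 0)] [(.act .H .K, 1), (.act .H .K, 0)] := by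
  refine h.total.holds [.rw h.act_def 1 0, .up 0 1 false, .rw (h.total.slideL (.mul .H) .K) 1 0,
    .rw h.mul_pair 3 1, .up 1 2 false, .rw h.dual.hopf_right.comul_assoc 0 2, .up 3 1 false,
    .rw (h.total.slideR (.comul .K) .H) 1 1, .up 2 3 false, .up 2 1 true, .up 3 1 true,
    .up 4 1 true, .rw h.act_def.symm 2 0, .up 2 1 false, .rw h.act_def.symm 0 1] ?_ ?_ <;> rfl

theorem RegularAction.act_mul (h : M.RegularAction) :
    M.Holds [.H, .K, .K] [(.mul .K, 1), (.act .H .K, 0)] [(.comul .H, 0), (.cross .H .K, 1),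
      (.act .H .K, 0), (.act .H .K, 1), (.mul .K, 0)] := by
  refine h.total.holds [.rw h.act_def 1 0, .rw h.dual.hopf_right.mul_comul 0 1, .up 4 1 true,
    .rw (h.total.slideR (.mul .K) .H) 3 0, .rw h.comul_pair.symm 6 1, .up 5 1 false,
    .up 6 1 false, .up 7 1 false, .up 8 1 false, .rw (h.total.slideL (.comul .H) .K).symm 4 1,
    .up 0 1 true, .up 1 2 true, .up 2 2 true, .rw (h.total.slideL (.comul .H) .K).symm 1 0,
    .up 3 1 false, .up 4 1 false, .up 5 1 false, .up 6 2 false,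
    .rw (h.total.slideL (.cross .H .K) .K).symm 4 2, .up 6 1 true,
    .rw (h.total.slideL (.pair .H .K) .K).symm 7 1, .up 0 1 true, .up 3 1 true,
    .rw (h.total.slideR (.comul .K) .H) 1 1, .up 3 2 true, .up 4 2 true, .rw h.act_def.symm 5 1,
    .rw h.act_def.symm 2 0] ?_ ?_ <;> rfl

theorem RegularAction.coev_counit (h : M.RegularAction) :
    M.Holds [] [(.copair .H .K, 0), (.counit .H, 0)] [(.one .K, 0)] := by
  refine h.total.holds [.rw h.dual.one_pair.symm 1 0, .up 0 1 true,
    .rw h.dual.coev_eval 1 0] ?_ ?_ <;> rfl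

theorem RegularAction.coev_counit_right (h : M.RegularAction) :
    M.Holds [] [(.copair .H .K, 0), (.counit .K, 1)] [(.one .H, 0)] := by
  refine h.total.holds [.rw h.dual.counit_pair 1 1, .up 0 1 false,
    .rw h.dual.eval_coev 1 0] ?_ ?_ <;> rfl

theorem RegularAction.coev_comul (h : M.RegularAction) :
    M.Holds [] [(.copair .H .K, 0), (.comul .H, 0)] [(.copair .H .K, 0), (.copair .H .K, 1),
      (.cross .K .K, 2), (.mul .K, 2)] := by
  refine h.total.holds [.rw h.dual.eval_coev.symm 2 1, .rw h.dual.eval_coev.symm 2 0,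
    .up 3 1 true, .rw (h.total.slideR (.pair .K .H) .K) 4 2, .up 0 2 true, .up 1 2 true,
    .up 2 2 true, .rw h.dual.mul_pair.symm 4 2, .up 3 1 true,
    .rw h.dual.coev_eval 4 2] ?_ ?_ <;> rfl

theorem RegularAction.eval_coev_two (h : M.RegularAction) :
    M.Holds [.K, .K] [(.copair .H .K, 2), (.copair .H .K, 4), (.cross .K .H, 3), (.cross .K .H,
      1), (.pair .K .H, 0), (.pair .K .H, 0)] [] := by
  refine h.total.holds [.up 1 2 true, .up 3 1 true, .rw h.dual.symm_right.symm 2 2, .up 5 1 false,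
    .rw (h.total.slideR (.copair .H .K) .K) 0 1, .up 1 1 false, .up 4 1 false,
    .rw (h.total.slideR (.pair .K .H) .K).symm 2 2, .up 1 2 true, .rw h.dual.coev_eval 0 0,
    .rw h.dual.coev_eval 0 1] ?_ ?_ <;> rfl

theorem RegularAction.coev_comul_dual (h : M.RegularAction) :
    M.Holds [] [(.copair .H .K, 0), (.comul .K, 1)] [(.copair .H .K, 0), (.copair .H .K, 2),
      (.cross .K .H, 1), (.mul .H, 0)] := by
  refine h.total.holds [.rw h.eval_coev_two.symm 2 1, .up 1 1 false, .up 2 1 false, .up 3 1 false,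
    .rw h.dual.comul_pair 4 1, .up 0 1 false, .up 1 1 false, .up 2 1 false, .up 3 1 false,
    .rw h.dual.eval_coev 4 0] ?_ ?_ <;> rfl

theorem RegularAction.act_pair (h : M.RegularAction) :
    M.Holds [.H, .H, .K] [(.act .H .K, 1), (.pair .H .K, 0)] [(.mul .H, 0), (.pair .H .K, 0)] := by
  refine h.total.holds [.rw h.act_def 0 1, .up 2 1 true, .rw h.mul_pair.symm 0 0] ?_ ?_ <;> rfl

/-- Σ (S(eᵢ)·k) fⁱ = Σ k₁⟨k₂, S(eᵢ)⟩ fⁱ = k₁ S(k₂). -/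
theorem RegularAction.coev_cancel (h : M.RegularAction) :
    M.Holds [.K] [(.copair .H .K, 0), (.cross .K .K, 1), (.anti .H, 0), (.act .H .K, 0), (.mul .K,
      0)] [(.counit .K, 0), (.one .K, 0)] := by
  refine h.total.holds [.rw h.act_def 3 0, .up 1 1 true, .up 1 1 false, .up 2 1 false,
    .rw (h.total.slideL (.anti .H) .K) 3 0, .rw h.antipode_pair 4 1,
    .rw (h.total.slideR (.comul .K) .K).symm 1 1, .up 0 1 false, .up 3 1 true,
    .rw (h.total.slideL (.copair .H .K) .K) 1 0, .rw (h.total.slideR (.anti .K) .K).symm 2 2,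
    .rw h.pair_def 4 1, .up 1 1 false, .rw (h.total.slideL (.copair .H .K) .K) 2 1,
    .rw h.dual.coev_eval 2 1, .rw h.dual.hopf_right.antipode_right 0 0] ?_ ?_ <;> rfl

/-- Translation is the transpose of right multiplication: ⟨h·k, x⟩ = ⟨k, xh⟩. -/
theorem RegularAction.coev_act (h : M.RegularAction) :
    M.Holds [.H] [(.copair .H .K, 1), (.cross .H .H, 0), (.act .H .K, 1)] [(.copair .H .K, 1),
      (.cross .H .H, 0), (.mul .H, 0)] := by
  refine h.total.holds [.rw h.act_def 2 1, .up 1 1 false, .rw h.coev_comul_dual 0 1,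
    .rw (h.total.slideR (.mul .H) .H) 3 0, .up 5 1 false, .up 2 1 true,
    .rw (h.total.slideL (.cross .H .K) .H).symm 3 1, .up 1 1 true, .up 2 1 true,
    .rw (h.total.slideR (.copair .H .K) .H) 0 0, .up 3 2 false, .rw h.pair_def 3 3,
    .rw (h.total.slideR (.copair .H .K) .H) 1 2, .rw h.dual.eval_coev 1 2,
    .rw (h.total.slideR (.copair .H .K) .H).symm 0 0, .rw h.dual.symm_left_right 2 1] ?_ ?_ <;> rfl

theorem RegularAction.dualAction (h : M.RegularAction) : M.DualAction where
  total := fun g hg => h.total g (by unfold dualActionBox at hg; split at hg <;> first | rfl |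
      cases hg)
  monoid := h.dual.hopf_right.toIsMonoid
  hopf := h.dual.hopf_left
  symm_HH := h.dual.symm_left
  symm_HK := h.dual.symm_left_right
  symm_KH := h.dual.symm_right_left
  symm_KK := h.dual.symm_right
  one_act := h.one_act
  mul_act := h.mul_act
  act_mul := h.act_mul
  coev_comul := h.coev_comul
  coev_act := h.coev_act
  coev_counit := h.coev_counit
  coev_cancel := h.coev_cancel
  act_pair := h.act_pair
  coev_counit_right := h.coev_counit_right
  one_pair := h.one_pair
  one_counit := h.dual.hopf_right.one_counit
  proj_def := h.proj_def

/-- Makes the roles of H and K interchangeable, so that results about the antipode of H also apply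
to that of K. -/
theorem RegularAction.isDual (h : M.RegularAction) : M.IsDual .K .H where
  hopf_left := h.dual.hopf_right
  hopf_right := h.dual.hopf_left
  symm_left := h.dual.symm_right
  symm_left_right := h.dual.symm_right_left
  symm_right_left := h.dual.symm_left_right
  symm_right := h.dual.symm_left
  coev_eval := h.coev_eval
  eval_coev := h.eval_coev
  comul_pair := h.comul_pair
  counit_pair := h.counit_pair
  mul_pair := h.mul_pair
  one_pair := h.one_pair
  antipode_pair := h.antipode_pair

theorem regular_iff {x y : Wire}
    [HopfObj (M.obj x)] [HopfObj (M.obj y)]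
    {p : M.obj y ⊗ M.obj x ⟶ 𝟙_ C} (hp : M.hom (.pair y x) = some (b20 p))
    {c : 𝟙_ C ⟶ M.obj x ⊗ M.obj y} (hc : M.hom (.copair x y) = some (b02 c))
    (hS : M.hom (.anti x) = some (b11 (HopfObj.antipode (X := M.obj x))))
    (hm : M.hom (.mul y) = some (b21 μ[M.obj y])) (hD : M.hom (.comul y) = some (b12 Δ[M.obj y]))
    {q : M.obj x ⊗ M.obj y ⟶ 𝟙_ C} (hq : M.hom (.pair x y) = some (b20 q))
    {c' : 𝟙_ C ⟶ M.obj y ⊗ M.obj x} (hc' : M.hom (.copair y x) = some (b02 c'))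
    {a : M.obj x ⊗ M.obj y ⟶ M.obj y} (ha : M.hom (.act x y) = some (b21 a))
    {P : M.obj y ⟶ M.obj y} (hP : M.hom (.proj y) = some (b11 P)) :
    (M.Holds [x, y] [(.pair x y, 0)] [(.cross x y, 0), (.pair y x, 0)] ↔
      q = (β_ (M.obj x) (M.obj y)).hom ≫ p) ∧
    (M.Holds [] [(.copair y x, 0)] [(.copair x y, 0), (.cross x y, 0)] ↔
      c' = c ≫ (β_ (M.obj x) (M.obj y)).hom) ∧
    (M.Holds [x, y] [(.act x y, 0)] [(.comul y, 1), (.cross x y, 0), (.pair x y, 1)] ↔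
      a = 𝟙 _ ⊗≫ M.obj x ◁ Δ[M.obj y] ⊗≫ (β_ (M.obj x) (M.obj y)).hom ▷ M.obj y ⊗≫
        M.obj y ◁ q ⊗≫ 𝟙 _) ∧
    (M.Holds [y] [(.proj y, 0)] [(.copair x y, 0), (.mul y, 1), (.anti x, 0), (.anti x, 0),
      (.act x y, 0)] ↔
      P = 𝟙 _ ⊗≫ c ▷ M.obj y ⊗≫ M.obj x ◁ μ[M.obj y] ≫
        HopfObj.antipode (X := M.obj x) ▷ M.obj y ≫
        HopfObj.antipode (X := M.obj x) ▷ M.obj y ≫ a) := by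
  refine ⟨?_, ?_, ?_, ?_⟩
  on_goal 4 => apply holds_iff (b := [y]) (i := M.flat [y]) (j := M.flat _)
  on_goal 3 => apply holds_iff (b := [y]) (i := M.flat [x, y]) (j := M.flat _)
  on_goal 2 => apply holds_iff (b := [y, x]) (i := M.flat []) (j := M.flat _)
  on_goal 1 => apply holds_iff (b := []) (i := M.flat [x, y]) (j := M.flat _)
  all_goals first
    | (repeat' first | assumption | exact rfl | apply Val.nil | apply Val.cons | apply lay_box |
        apply Lay.there); done
    | (simp only [app, flat, flatOb, ob, tens, Box.dom, Box.cod, List.cons_append, List.nil_append,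
        List.append_eq, Iso.trans_hom, Iso.trans_inv, Iso.symm_hom, Iso.symm_inv,
        whiskerLeftIso_hom, whiskerLeftIso_inv, Iso.refl_hom, Iso.refl_inv, hom, b01, b02, b10,
            b11, b12, b20, b21]
       monoidal)

theorem retraction_iff {x : Wire}
    {s : M.obj x ⟶ M.obj x} (hS : M.hom (.anti x) = some (b11 s))
    {t : M.obj x ⟶ M.obj x} (ht : M.hom (.coanti x) = some (b11 t)) :
    M.Holds [x] [(.anti x, 0), (.coanti x, 0)] [] ↔
      s ≫ t = 𝟙 _ := by
  apply holds_iff (b := [x]) (i := M.flat [x]) (j := M.flat _)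
  all_goals first
    | (repeat' first | assumption | exact rfl | apply Val.nil | apply Val.cons | apply lay_box |
        apply Lay.there); done
    | (simp only [app, flat, flatOb, ob, tens, Box.dom, Box.cod, List.cons_append, List.nil_append,
        List.append_eq, Iso.trans_hom, Iso.trans_inv, Iso.symm_hom, Iso.symm_inv,
        whiskerLeftIso_hom, whiskerLeftIso_inv, Iso.refl_hom, Iso.refl_inv, b11]
       monoidal)

theorem lay_anti {x : Wire} {s : M.obj x ⟶ M.obj x} (hs : M.hom (.anti x) = some (b11 s)) :
    M.Lay (.anti x) 0 [x] [x] (s ▷ 𝟙_ C) :=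
  (lay_box (M := M) (g := .anti x) [] hs).congr (by
    change (M.obj x ◁ (λ_ (𝟙_ C)).inv ≫ (α_ (M.obj x) (𝟙_ C) (𝟙_ C)).inv) ≫ (s ▷ 𝟙_ C) ▷ 𝟙_ C ≫
      ((α_ (M.obj x) (𝟙_ C) (𝟙_ C)).hom ≫ M.obj x ◁ (λ_ (𝟙_ C)).hom) = _
    monoidal)

/-- The inverse is the value of the remaining layers, freed of the trailing unit. -/
theorem Holds.exists_retraction {x : Wire} {s : M.obj x ⟶ M.obj x}
    (hs : M.hom (.anti x) = some (b11 s)) {L : List Layer}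
    (h : M.Holds [x] ((.anti x, 0) :: L) []) : ∃ g, s ≫ g = 𝟙 _ := by
  obtain ⟨b, f, h₁, h₂⟩ := h
  obtain ⟨rfl, e⟩ := h₂.unique (.nil _)
  generalize hf : f = f' at h₁
  rw [eq_of_heq e] at hf
  cases h₁ with
  | cons l v =>
    obtain ⟨rfl, e⟩ := l.unique (lay_anti hs)
    obtain rfl := eq_of_heq e
    rename_i g
    have key : ∀ (g : M.obj x ⊗ 𝟙_ C ⟶ M.obj x ⊗ 𝟙_ C), 𝟙 _ = s ▷ 𝟙_ C ≫ g →
        s ≫ (ρ_ _).inv ≫ g ≫ (ρ_ _).hom = 𝟙 _ := fun g e => by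
      rw [rightUnitor_inv_naturality_assoc, ← reassoc_of% e]; simp
    exact ⟨_, key g hf⟩

theorem Holds.exists_section {x : Wire} {s : M.obj x ⟶ M.obj x}
    (hs : M.hom (.anti x) = some (b11 s)) {L : List Layer}
    (h : M.Holds [x] (L ++ [(.anti x, 0)]) []) (hL : ∃ g, M.Val [x] L [x] g) :
    ∃ g, g ≫ s = 𝟙 _ := by
  obtain ⟨b, f, h₁, h₂⟩ := h
  obtain ⟨rfl, e⟩ := h₂.unique (.nil _)
  obtain ⟨g, v⟩ := hL
  obtain ⟨-, e'⟩ := h₁.unique (v.append (.cons (lay_anti hs) (.nil _)))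
  have key : ∀ (g : M.obj x ⊗ 𝟙_ C ⟶ M.obj x ⊗ 𝟙_ C), 𝟙 _ = g ≫ s ▷ 𝟙_ C ≫ 𝟙 _ →
      ((ρ_ _).inv ≫ g ≫ (ρ_ _).hom) ≫ s = 𝟙 _ := fun g e => by
    rw [Category.comp_id] at e
    rw [Category.assoc, Category.assoc, ← rightUnitor_naturality, ← reassoc_of% e]; simp
  exact ⟨_, key g ((eq_of_heq e).symm.trans (eq_of_heq e'))⟩

end Model

/-- The Hopf algebra `K` is the dual of `H` under `p`, and the braiding is symmetric on `H`. -/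
structure IsHopfDual (H K : C) [HopfObj H] [HopfObj K] (p : K ⊗ H ⟶ 𝟙_ C) (c : 𝟙_ C ⟶ H ⊗ K) :
    Prop extends IsSymmDual H K p c, IsQuasiDual K H p

namespace Model
variable {M : Model C}

theorem isDual_iff {x y : Wire} [HopfObj (M.obj x)] [HopfObj (M.obj y)]
    {p : M.obj y ⊗ M.obj x ⟶ 𝟙_ C} {c : 𝟙_ C ⟶ M.obj x ⊗ M.obj y}
    (hp : M.hom (.pair y x) = some (b20 p)) (hc : M.hom (.copair x y) = some (b02 c))
    (hm : M.hom (.mul x) = some (b21 μ[M.obj x])) (hu : M.hom (.one x) = some (b01 η[M.obj x]))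
    (hD : M.hom (.comul x) = some (b12 Δ[M.obj x]))
    (hE : M.hom (.counit x) = some (b10 ε[M.obj x]))
    (hS : M.hom (.anti x) = some (b11 (HopfObj.antipode (X := M.obj x))))
    (hm' : M.hom (.mul y) = some (b21 μ[M.obj y])) (hu' : M.hom (.one y) = some (b01 η[M.obj y]))
    (hD' : M.hom (.comul y) = some (b12 Δ[M.obj y]))
    (hE' : M.hom (.counit y) = some (b10 ε[M.obj y]))
    (hS' : M.hom (.anti y) = some (b11 (HopfObj.antipode (X := M.obj y)))) :
    M.IsDual x y ↔ IsHopfDual (M.obj x) (M.obj y) p c := by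
  obtain ⟨i₁, i₂⟩ := zigzag_iff hp hc
  obtain ⟨j₁, j₂, j₃, j₄, j₅⟩ := quasiDual_iff hp hm hu hD hE hS hm' hu' hD' hE' hS'
  constructor
  · intro h
    exact { symm := (symm_iff x x).1 h.symm_left
            coev_eval := i₁.1 h.coev_eval
            eval_coev := i₂.1 h.eval_coev
            comul_pair := j₁.1 h.comul_pair
            counit_pair := j₂.1 h.counit_pair
            mul_pair := j₃.1 h.mul_pair
            one_pair := j₄.1 h.one_pair
            antipode_pair := j₅.1 h.antipode_pair }
  · intro h
    exact { hopf_left := isHopf_of hm hu hD hE hS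
            hopf_right := isHopf_of hm' hu' hD' hE' hS'
            symm_left := (symm_iff x x).2 h.symm
            symm_left_right := (symm_iff x y).2 h.symm_right
            symm_right_left := (symm_iff y x).2 h.symm_left
            symm_right := (symm_iff y y).2 h.symm_dual
            coev_eval := i₁.2 h.coev_eval
            eval_coev := i₂.2 h.eval_coev
            comul_pair := j₁.2 h.comul_pair
            counit_pair := j₂.2 h.counit_pair
            mul_pair := j₃.2 h.mul_pair
            one_pair := j₄.2 h.one_pair
            antipode_pair := j₅.2 h.antipode_pair }

abbrev regular (H K : C) [HopfObj H] [HopfObj K] (p : K ⊗ H ⟶ 𝟙_ C) (c : 𝟙_ C ⟶ H ⊗ K)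
    (t : K ⟶ K) : Model C where
  obj := fun | .H => H | _ => K
  box := fun
    | .mul .H => some (b21 μ[H])
    | .one .H => some (b01 η[H])
    | .comul .H => some (b12 Δ[H])
    | .counit .H => some (b10 ε[H])
    | .anti .H => some (b11 (HopfObj.antipode (X := H)))
    | .mul .K => some (b21 μ[K])
    | .one .K => some (b01 η[K])
    | .comul .K => some (b12 Δ[K])
    | .counit .K => some (b10 ε[K])
    | .anti .K => some (b11 (HopfObj.antipode (X := K)))
    | .coanti .K => some (b11 t)
    | .pair .K .H => some (b20 p)
    | .copair .H .K => some (b02 c)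
    | .pair .H .K => some (b20 ((β_ H K).hom ≫ p))
    | .copair .K .H => some (b02 (c ≫ (β_ H K).hom))
    | .act .H .K => some (b21 (translate p))
    | .proj .K => some (b11 (coinvariants p c))
    | _ => none

end Model

open Model

/-! ### Invertibility of the antipode. -/

section
variable {H K : C} [HopfObj H] [HopfObj K] {p : K ⊗ H ⟶ 𝟙_ C} {c : 𝟙_ C ⟶ H ⊗ K}

theorem IsHopfDual.regularAction (h : IsHopfDual H K p c) (t : K ⟶ K) :
    (regular H K p c t).RegularAction := by
  letI : HopfObj ((regular H K p c t).obj .H) := inferInstanceAs (HopfObj H)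
  letI : HopfObj ((regular H K p c t).obj .K) := inferInstanceAs (HopfObj K)
  obtain ⟨i₁, i₂, i₃, i₄⟩ := regular_iff (M := regular H K p c t) (x := .H) (y := .K)
    rfl rfl rfl rfl rfl rfl rfl rfl rfl
  exact { total := by
            intro g hg; unfold regularActionBox at hg; split at hg <;> first | rfl | cases hg
          dual := (isDual_iff (M := regular H K p c t) (x := .H) (y := .K)
            rfl rfl rfl rfl rfl rfl rfl rfl rfl rfl rfl rfl).2 h
          pair_def := i₁.2 rfl
          copair_def := i₂.2 rfl
          act_def := i₃.2 rfl
          proj_def := i₄.2 rfl }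

theorem IsHopfDual.swap (h : IsHopfDual H K p c) :
    IsHopfDual K H ((β_ H K).hom ≫ p) (c ≫ (β_ H K).hom) := by
  letI : HopfObj ((regular H K p c (𝟙 K)).obj .H) := inferInstanceAs (HopfObj H)
  letI : HopfObj ((regular H K p c (𝟙 K)).obj .K) := inferInstanceAs (HopfObj K)
  exact (isDual_iff (M := regular H K p c (𝟙 K)) (x := .K) (y := .H)
    rfl rfl rfl rfl rfl rfl rfl rfl rfl rfl rfl rfl).1 (h.regularAction (𝟙 K)).isDual

theorem IsHopfDual.exists_retraction (h : IsHopfDual H K p c) :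
    ∃ g, HopfObj.antipode (X := H) ≫ g = 𝟙 H :=
  -- The morphism 𝟙 K only fills the box `coanti .K`, which does not occur in this argument.
  Holds.exists_retraction (M := regular H K p c (𝟙 K)) (x := .H) rfl
    (h.regularAction (𝟙 K)).dualAction.antipode_comp_retraction

theorem IsHopfDual.exists_inv (h : IsHopfDual H K p c) :
    ∃ g, HopfObj.antipode (X := H) ≫ g = 𝟙 H ∧ g ≫ HopfObj.antipode (X := H) = 𝟙 H := by
  obtain ⟨g, hg⟩ := h.exists_retraction
  -- Here t is a left inverse of the antipode of K; its transpose is the section g' of the antipode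
  -- of H below.
  obtain ⟨t, ht⟩ := h.swap.exists_retraction
  obtain ⟨g', hg'⟩ : ∃ g,
      g ≫ HopfObj.antipode (X := H) = 𝟙 H := Holds.exists_section (M := regular H K p c t) (x :=
      .H) (L := [_, _, _]) rfl
    ((h.regularAction t).antipode_section
      ((retraction_iff (M := regular H K p c t) (x := .K) rfl rfl).2 ht)) ⟨_, by
        repeat' first | exact rfl | apply Val.nil | apply Val.cons | apply lay_box | apply
            Lay.there⟩
  have : g' = g := by rw [← Category.comp_id g', ← hg, reassoc_of% hg']
  exact ⟨g, hg, this ▸ hg'⟩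
end

/-! ### Comodule algebras over the dual and the three actions. -/

namespace Model

variable {M : Model C}

def coactionBox : Box → Bool
  | .mul .R | .one .R | .coact .R .K | .act .H .R => true
  | .mul .H | .one .H | .comul .H | .counit .H | .anti .H | .coanti .H => true
  | .mul .K | .one .K | .comul .K | .counit .K | .anti .K => true
  | .copair .H .K | .pair .K .H | .act .K .H => true
  | .mul .E | .one .E | .join .H .K .E | .split .H .K .E | .act .E .H => true
  | .cleave .K .E | .cleaveInv .K .E => true
  | _ => false

/-- The Hopf algebra `K`, dual to `H`, coacts on the algebra `R` and acts on `H`. -/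
structure Coaction (M : Model C) : Prop where
  total : M.Total coactionBox
  dual : M.IsDual .H .K
  monoid_R : M.IsMonoid .R
  antipode_inv : M.Holds [.H] [(.anti .H, 0), (.coanti .H, 0)] []
  inv_antipode : M.Holds [.H] [(.coanti .H, 0), (.anti .H, 0)] []
  coassoc : M.Holds [.R] [(.coact .R .K, 0), (.coact .R .K, 0)] [(.coact .R .K, 0), (.comul .K, 1)]
  counit : M.Holds [.R] [(.coact .R .K, 0), (.counit .K, 1)] []
  map_one : M.Holds [] [(.one .R, 0), (.coact .R .K, 0)] [(.one .R, 0), (.one .K, 1)]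
  map_mul : M.Holds [.R, .R] [(.mul .R, 0), (.coact .R .K, 0)] [(.coact .R .K, 1), (.coact .R .K,
    0), (.cross .K .R, 1), (.mul .R, 0), (.mul .K, 1)]
  act_def : M.Holds [.H, .R] [(.act .H .R, 0)] [(.coact .R .K, 1), (.cross .H .R, 0),
    (.cross .H .K, 1), (.pair .K .H, 1)]
  hit_def : M.Holds [.K, .H] [(.act .K .H, 0)] [(.comul .H, 1), (.cross .K .H, 0), (.pair .K .H, 1)]

/-- In addition, `E` is the smash product of `H` and `K`, which acts on `H`. The boxes `cleave` and
`cleaveInv` send `k` to the elements of `E` that act on `H` by `x ↦ ⟨k, S⁻¹ x₁⟩ x₂` and by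
`x ↦ ⟨k, x₁⟩ x₂`. -/
structure CleftCoaction (M : Model C) : Prop extends M.Coaction where
  monoid_E : M.IsMonoid .E
  join_split : M.Holds [.H, .K] [(.join .H .K .E, 0), (.split .H .K .E, 0)] []
  split_join : M.Holds [.E] [(.split .H .K .E, 0), (.join .H .K .E, 0)] []
  mul_def : M.Holds [.E, .E] [(.mul .E, 0)] [(.split .H .K .E, 1), (.split .H .K .E, 0),
    (.comul .K, 1), (.cross .K .H, 2), (.act .K .H, 1), (.mul .H, 0), (.mul .K, 1),
    (.join .H .K .E, 0)]
  one_def : M.Holds [] [(.one .E, 0)] [(.one .H, 0), (.one .K, 1), (.join .H .K .E, 0)]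
  rep_def : M.Holds [.E, .H] [(.act .E .H, 0)] [(.split .H .K .E, 0), (.act .K .H, 1), (.mul .H, 0)]
  cleave_def : M.Holds [.K] [(.cleave .K .E, 0)] [(.copair .H .K, 1), (.comul .H, 1), (.coanti .H,
    1), (.pair .K .H, 0), (.copair .H .K, 1), (.coanti .H, 1), (.mul .H, 0), (.mul .K, 1),
    (.join .H .K .E, 0)]
  cleaveInv_def : M.Holds [.K] [(.cleaveInv .K .E, 0)] [(.copair .H .K, 1), (.comul .H, 1),
    (.pair .K .H, 0), (.copair .H .K, 1), (.coanti .H, 1), (.mul .H, 0), (.mul .K, 1),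
    (.join .H .K .E, 0)]

theorem Coaction.one_act (h : M.Coaction) :
    M.Holds [.R] [(.one .H, 0), (.act .H .R, 0)] [] := by
  refine h.total.holds [.rw h.act_def 1 0, .up 0 1 false, .rw (h.total.slideL (.one .H) .R) 1 0,
    .rw (h.total.slideL (.one .H) .K) 1 1, .rw h.dual.counit_pair.symm 1 1,
    .rw h.counit 0 0] ?_ ?_ <;> rfl

/-- Both sides are r₀⟨r₁, h⟩⟨r₂, h'⟩, by coassociativity and the transposition of products. A double
crossing of H with K is left over and cancels by symmetry. -/
theorem Coaction.mul_act (h : M.Coaction) :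
    M.Holds [.H, .H, .R] [(.mul .H, 0), (.act .H .R, 0)] [(.act .H .R, 1), (.act .H .R, 0)] := by
  refine h.total.holds [.rw h.act_def 1 0, .up 0 1 false, .rw (h.total.slideL (.mul .H) .R) 1 0,
    .rw (h.total.slideL (.mul .H) .K) 3 1, .up 2 1 false, .rw h.dual.comul_pair.symm 5 1,
    .rw (h.total.slideR (.comul .K) .H).symm 4 1, .up 3 1 false,
    .rw (h.total.slideR (.comul .K) .H).symm 2 2, .up 1 1 false, .up 3 2 true, .up 5 1 true,
    .rw h.coassoc.symm 0 2, .rw h.dual.symm_left_right 7 2, .up 3 1 false,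
    .rw (h.total.slideR (.coact .R .K) .H) 1 1, .up 2 3 false, .up 3 4 false, .up 2 2 true,
    .up 3 2 true, .up 4 2 true, .up 5 2 true, .rw h.act_def.symm 2 0, .up 2 1 false,
    .up 3 1 false, .rw h.act_def.symm 0 1] ?_ ?_ <;> rfl

theorem Coaction.act_one (h : M.Coaction) :
    M.Holds [.H] [(.one .R, 1), (.act .H .R, 0)] [(.counit .H, 0), (.one .R, 0)] := by
  refine h.total.holds [.rw h.act_def 1 0, .rw h.map_one 0 1, .up 1 1 true,
    .rw (h.total.slideR (.one .R) .H) 0 0, .rw (h.total.slideR (.one .K) .H) 1 1,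
    .rw h.dual.one_pair 1 1, .up 0 1 false] ?_ ?_ <;> rfl

/-- h·(rr') = r₀r'₀⟨r₁r'₁, h⟩ since ψ is an algebra map, and ⟨r₁r'₁, h⟩ splits along Δ(h). Again a
double crossing of H with K cancels. -/
theorem Coaction.act_mul (h : M.Coaction) :
    M.Holds [.H, .R, .R] [(.mul .R, 1), (.act .H .R, 0)] [(.comul .H, 0), (.cross .H .R, 1),
      (.act .H .R, 0), (.act .H .R, 1), (.mul .R, 0)] := by
  refine h.total.holds [.rw h.act_def 1 0, .rw h.map_mul 0 1, .up 4 1 true,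
    .rw (h.total.slideR (.mul .K) .H) 5 1, .rw (h.total.slideR (.mul .R) .H) 3 0, .up 5 1 false,
    .up 6 1 false, .rw h.dual.mul_pair 8 1, .up 7 1 false,
    .rw (h.total.slideL (.comul .H) .K).symm 6 3, .rw (h.total.slideL (.comul .H) .K).symm 5 2,
    .rw (h.total.slideL (.comul .H) .R).symm 4 1, .up 0 1 true, .up 1 2 true, .up 2 2 true,
    .rw (h.total.slideL (.comul .H) .R).symm 1 0, .up 0 4 false, .up 3 2 false, .up 5 1 false,
    .up 6 2 false, .up 7 3 false, .up 12 1 false, .up 13 1 false, .up 14 1 false,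
    .rw h.dual.symm_left_right 11 3, .up 3 1 true,
    .rw (h.total.slideL (.cross .H .K) .R).symm 4 2, .up 6 2 true, .up 8 1 true, .up 9 1 true,
    .rw (h.total.slideL (.cross .H .K) .R).symm 7 1, .up 0 2 true, .up 6 4 false, .up 6 1 true,
    .up 7 1 true, .up 8 1 true, .up 9 1 true, .up 10 1 true,
    .rw (h.total.slideL (.pair .K .H) .R).symm 8 1, .up 6 3 false, .up 1 1 true, .up 2 1 true,
    .up 3 1 true, .rw (h.total.slideR (.coact .R .K) .H) 1 1, .up 3 3 true, .up 4 3 true,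
    .up 5 3 true, .rw h.act_def.symm 6 1, .rw h.act_def.symm 2 0] ?_ ?_ <;> rfl

/-- Δ(k ⇀ h) = h₁ ⊗ (k ⇀ h₂), as ⇀ uses only the last leg of the comultiplication. -/
theorem Coaction.hit_comul (h : M.Coaction) :
    M.Holds [.K, .H] [(.act .K .H, 0), (.comul .H, 0)] [(.comul .H, 1), (.cross .K .H, 0),
      (.act .K .H, 1)] := by
  refine h.total.holds [.rw h.hit_def 0 0, .up 2 1 true,
    .rw (h.total.slideR (.comul .H) .K).symm 1 0, .rw h.dual.hopf_left.comul_assoc.symm 0 1,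
    .up 1 1 true, .rw h.hit_def.symm 2 1] ?_ ?_ <;> rfl

theorem Coaction.one_hit (h : M.Coaction) :
    M.Holds [.H] [(.one .K, 0), (.act .K .H, 0)] [] := by
  refine h.total.holds [.rw h.hit_def 1 0, .up 0 1 false, .rw (h.total.slideL (.one .K) .H) 1 0,
    .rw h.dual.one_pair 1 1, .rw h.dual.hopf_left.comul_counit 0 0] ?_ ?_ <;> rfl

theorem Coaction.mul_hit (h : M.Coaction) :
    M.Holds [.K, .K, .H] [(.mul .K, 0), (.act .K .H, 0)] [(.act .K .H, 1), (.act .K .H, 0)] := by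
  refine h.total.holds [.rw h.hit_def 1 0, .up 0 1 false, .rw (h.total.slideL (.mul .K) .H) 1 0,
    .rw h.dual.mul_pair 3 1, .up 1 2 false, .rw h.dual.hopf_left.comul_assoc 0 2, .up 3 1 false,
    .rw (h.total.slideR (.comul .H) .K) 1 1, .up 2 3 false, .up 2 1 true, .up 3 1 true,
    .up 4 1 true, .rw h.hit_def.symm 2 0, .up 2 1 false, .rw h.hit_def.symm 0 1] ?_ ?_ <;> rfl

theorem Coaction.hit_one (h : M.Coaction) :
    M.Holds [.K] [(.one .H, 1), (.act .K .H, 0)] [(.counit .K, 0), (.one .H, 0)] := by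
  refine h.total.holds [.rw h.hit_def 1 0, .rw h.dual.hopf_left.one_comul 0 1, .up 0 1 true,
    .up 1 1 true, .rw (h.total.slideR (.one .H) .K) 0 0, .rw h.dual.counit_pair.symm 1 1,
    .up 0 1 false] ?_ ?_ <;> rfl

theorem Coaction.hit_mul (h : M.Coaction) :
    M.Holds [.K, .H, .H] [(.mul .H, 1), (.act .K .H, 0)] [(.comul .K, 0), (.cross .K .H, 1),
      (.act .K .H, 0), (.act .K .H, 1), (.mul .H, 0)] := by
  refine h.total.holds [.rw h.hit_def 1 0, .rw h.dual.hopf_left.mul_comul 0 1, .up 4 1 true,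
    .rw (h.total.slideR (.mul .H) .K) 3 0, .rw h.dual.comul_pair.symm 6 1, .up 5 1 false,
    .rw (h.total.slideL (.comul .K) .H).symm 4 1, .up 0 1 true, .up 1 2 true, .up 2 2 true,
    .rw (h.total.slideL (.comul .K) .H).symm 1 0, .up 0 4 false, .up 2 3 false, .up 8 1 false,
    .up 9 1 false, .up 10 1 false, .up 0 3 true, .up 3 1 true, .up 5 1 false, .up 6 2 false,
    .rw (h.total.slideR (.cross .H .H) .K) 4 2, .up 4 3 true,
    .rw (h.total.slideL (.pair .K .H) .H).symm 7 1, .up 6 1 true, .up 1 1 true, .up 2 1 true,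
    .up 4 1 false, .up 3 1 true, .rw (h.total.slideR (.comul .H) .K) 1 1, .up 3 1 true,
    .up 4 1 true, .rw h.hit_def.symm 5 1, .rw h.hit_def.symm 2 0] ?_ ?_ <;> rfl

theorem Coaction.one_extend (h : M.Coaction) :
    M.Holds [.R, .H] [(.one .K, 0), (.cross .K .R, 0), (.act .K .H, 1)] [] := by
  refine h.total.holds [.rw (h.total.slideL (.one .K) .R) 0 0, .rw h.one_hit 0 1] ?_ ?_ <;> rfl

theorem Coaction.mul_extend (h : M.Coaction) :
    M.Holds [.K, .K, .R, .H] [(.mul .K, 0), (.cross .K .R, 0), (.act .K .H, 1)] [(.cross .K .R,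
      1), (.act .K .H, 2), (.cross .K .R, 0), (.act .K .H, 1)] := by
  refine h.total.holds [.rw (h.total.slideL (.mul .K) .R) 0 0, .rw h.mul_hit 2 1,
    .up 1 1 false] ?_ ?_ <;> rfl

theorem Coaction.extend_one (h : M.Coaction) :
    M.Holds [.K] [(.one .R, 1), (.one .H, 2), (.cross .K .R, 0), (.act .K .H, 1)] [(.counit .K,
      0), (.one .R, 0), (.one .H, 1)] := by
  refine h.total.holds [.up 1 1 true, .rw (h.total.slideR (.one .R) .K) 0 0, .rw h.hit_one 1 1,
    .up 0 1 false] ?_ ?_ <;> rfl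

/-- In (r # h)(r' # h') the leg h₁ acts on r' and h₂ stays in H. By `hit_comul` the action of K
touches only h₂, so the trivial action on R is compatible with the smash product. -/
theorem Coaction.extend_mul (h : M.Coaction) :
    M.Holds [.K, .R, .H, .R, .H] [(.comul .H, 2), (.cross .H .R, 3), (.act .H .R, 2), (.mul .R,
      1), (.mul .H, 2), (.cross .K .R, 0), (.act .K .H, 1)] [(.comul .K, 0), (.cross .K .R, 1),
      (.cross .K .H, 2), (.cross .K .R, 0), (.act .K .H, 1), (.cross .K .R, 2), (.act .K .H, 3),
      (.comul .H, 1), (.cross .H .R, 2), (.act .H .R, 1), (.mul .R, 0), (.mul .H, 1)] := by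
  refine h.total.holds [.up 4 1 true, .rw (h.total.slideR (.mul .R) .K) 3 0, .rw h.hit_mul 6 1,
    .up 2 1 true, .rw (h.total.slideR (.act .H .R) .K) 3 1, .up 5 2 false,
    .rw (h.total.slideL (.comul .K) .R).symm 4 2, .up 1 1 true, .up 2 1 true, .up 3 1 true,
    .rw (h.total.slideL (.comul .K) .H).symm 2 1, .up 0 1 true, .up 1 1 true,
    .rw (h.total.slideL (.comul .K) .R).symm 0 0, .up 1 2 false, .up 2 4 false, .up 9 2 false,
    .up 10 2 false, .up 11 2 false, .up 2 1 true, .up 4 1 false, .up 3 1 true, .up 5 2 false,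
    .up 6 3 false, .rw (h.total.slideR (.cross .H .R) .K) 4 3, .up 6 1 true, .up 7 1 true,
    .rw (h.total.slideL (.act .K .H) .R).symm 8 2, .up 1 1 true,
    .rw (h.total.slideR (.comul .H) .K) 2 2, .up 3 2 true, .up 5 1 true, .up 6 1 true,
    .up 8 1 false, .rw h.hit_comul.symm 4 1, .up 5 1 false, .up 6 1 false] ?_ ?_ <;> rfl

theorem Coaction.inv_mul (h : M.Coaction) :
    M.Holds [.H, .H] [(.mul .H, 0), (.coanti .H, 0)] [(.coanti .H, 0), (.coanti .H, 1),
      (.cross .H .H, 0), (.mul .H, 0)] := by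
  refine h.total.holds [.rw h.inv_antipode.symm 0 1, .rw h.inv_antipode.symm 0 0,
    .rw h.dual.symm_left.symm 4 0, .rw (h.total.slideR (.anti .H) .H) 3 0, .up 1 1 false,
    .rw (h.total.slideL (.anti .H) .H) 2 0, .up 3 1 true,
    .rw h.dual.hopf_left.mul_antipode.symm 3 0, .rw h.antipode_inv 4 0] ?_ ?_ <;> rfl

theorem Coaction.inv_one (h : M.Coaction) :
    M.Holds [] [(.one .H, 0), (.coanti .H, 0)] [(.one .H, 0)] := by
  refine h.total.holds [.rw h.dual.hopf_left.one_antipode.symm 0 0,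
    .rw h.antipode_inv 1 0] ?_ ?_ <;> rfl

theorem Coaction.inv_comul (h : M.Coaction) :
    M.Holds [.H] [(.coanti .H, 0), (.comul .H, 0)] [(.comul .H, 0), (.cross .H .H, 0),
      (.coanti .H, 0), (.coanti .H, 1)] := by
  refine h.total.holds [.rw h.antipode_inv.symm 2 0, .rw h.antipode_inv.symm 2 1, .up 2 2 true,
    .up 3 2 true, .rw h.dual.symm_left.symm 2 0, .up 5 1 false,
    .rw (h.total.slideR (.anti .H) .H).symm 3 0, .rw (h.total.slideL (.anti .H) .H).symm 4 0,
    .up 3 1 true, .rw h.dual.hopf_left.antipode_comul.symm 1 0,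
    .rw h.inv_antipode 0 0] ?_ ?_ <;> rfl

/-- h₂ S⁻¹(h₁) = ε(h)1, obtained by applying S⁻¹ to an antipode axiom. -/
theorem Coaction.inv_right (h : M.Coaction) :
    M.Holds [.H] [(.comul .H, 0), (.cross .H .H, 0), (.coanti .H, 1), (.mul .H, 0)] [(.counit .H,
      0), (.one .H, 0)] := by
  refine h.total.holds [.rw h.antipode_inv.symm 4 0, .rw h.dual.hopf_left.mul_antipode 3 0,
    .up 3 1 false, .rw h.inv_antipode 2 1, .rw (h.total.slideL (.anti .H) .H) 2 0,
    .rw h.dual.symm_left 1 0, .rw h.dual.hopf_left.antipode_right 0 0,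
    .rw h.inv_one 1 0] ?_ ?_ <;> rfl

theorem Coaction.inv_left (h : M.Coaction) :
    M.Holds [.H] [(.comul .H, 0), (.cross .H .H, 0), (.coanti .H, 0), (.mul .H, 0)] [(.counit .H,
      0), (.one .H, 0)] := by
  refine h.total.holds [.rw h.antipode_inv.symm 4 0, .rw h.dual.hopf_left.mul_antipode 3 0,
    .rw h.inv_antipode 2 0, .rw (h.total.slideL (.anti .H) .H).symm 1 0, .rw h.dual.symm_left 2 0,
    .rw h.dual.hopf_left.antipode_left 0 0, .rw h.inv_one 1 0] ?_ ?_ <;> rfl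

theorem Coaction.coev_comul (h : M.Coaction) :
    M.Holds [] [(.copair .H .K, 0), (.comul .H, 0)] [(.copair .H .K, 0), (.copair .H .K, 1),
      (.cross .K .K, 2), (.mul .K, 2)] := by
  refine h.total.holds [.rw h.dual.eval_coev.symm 2 1, .rw h.dual.eval_coev.symm 2 0,
    .up 3 1 true, .rw (h.total.slideR (.pair .K .H) .K) 4 2, .up 0 2 true, .up 1 2 true,
    .up 2 2 true, .rw h.dual.mul_pair.symm 4 2, .up 3 1 true,
    .rw h.dual.coev_eval 4 2] ?_ ?_ <;> rfl

theorem Coaction.coev_cross (h : M.Coaction) :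
    M.Holds [] [(.copair .H .K, 0), (.copair .H .K, 1), (.cross .H .H, 0)] [(.copair .H .K, 0),
      (.copair .H .K, 1), (.cross .K .K, 2)] := by
  refine h.total.holds [.rw h.dual.symm_left_right.symm 3 1,
    .rw (h.total.slideR (.copair .H .K) .H) 1 0, .up 0 1 true,
    .rw (h.total.slideL (.copair .H .K) .K).symm 1 1, .rw h.dual.symm_left_right 3 1] ?_ ?_ <;> rfl

/-- Σ eᵢ S⁻¹(eⱼ) ⊗ fʲfⁱ = 1 ⊗ 1: merging the two coevaluations by `coev_comul` produces e₂ S⁻¹(e₁) =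
ε(e)1. -/
theorem Coaction.coev_inv (h : M.Coaction) :
    M.Holds [] [(.copair .H .K, 0), (.copair .H .K, 1), (.coanti .H, 1), (.mul .H, 0), (.mul .K,
      1)] [(.one .H, 0), (.one .K, 1)] := by
  refine h.total.holds [.rw h.dual.symm_left.symm 2 0, .rw h.coev_cross 0 0, .up 3 3 false,
    .rw h.coev_comul.symm 0 0, .rw h.inv_right 1 0, .rw h.dual.one_pair.symm 1 0, .up 0 1 true,
    .rw h.dual.coev_eval 1 0, .up 0 1 true] ?_ ?_ <;> rfl

/-! ### The smash product H # K acting on H, and its cleaving map. -/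

theorem CleftCoaction.rep_faithful (h : M.CleftCoaction) :
    M.Holds [.E] [(.copair .H .K, 1), (.act .E .H, 0), (.copair .H .K, 1), (.coanti .H, 1),
      (.mul .H, 0), (.mul .K, 1), (.join .H .K .E, 0)] [] := by
  refine h.total.holds [.rw h.rep_def 1 0, .rw h.hit_def 2 1, .up 0 1 true, .rw h.coev_comul 1 2,
    .up 2 3 true, .up 4 2 true, .rw h.dual.coev_eval 3 2,
    .rw (h.total.slideR (.copair .H .K) .K) 1 1, .up 3 1 false, .up 2 1 true, .up 4 3 false,
    .rw h.dual.hopf_right.mul_assoc.symm 3 3, .up 5 1 false, .up 3 2 true, .up 4 2 true,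
    .up 5 2 true, .rw h.dual.hopf_left.mul_assoc 4 0, .up 5 1 false, .up 6 1 false,
    .rw h.coev_inv 1 1, .rw h.dual.hopf_right.one_mul 2 2, .rw h.dual.hopf_left.mul_one 1 0,
    .rw h.split_join 0 0] ?_ ?_ <;> rfl

theorem CleftCoaction.inv_counit (h : M.CleftCoaction) :
    M.Holds [.H] [(.coanti .H, 0), (.counit .H, 0)] [(.counit .H, 0)] := by
  refine h.total.holds [.rw h.dual.hopf_left.antipode_counit.symm 1 0,
    .rw h.inv_antipode 0 0] ?_ ?_ <;> rfl

theorem CleftCoaction.coev_hit (h : M.CleftCoaction) :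
    M.Holds [.H] [(.copair .H .K, 0), (.act .K .H, 1)] [(.comul .H, 0), (.cross .H .H, 0)] := by
  refine h.total.holds [.rw h.hit_def 1 1, .rw h.dual.symm_left.symm 3 0, .up 0 1 false,
    .rw (h.total.slideL (.copair .H .K) .H) 1 0, .up 2 1 false,
    .rw h.dual.eval_coev 1 1] ?_ ?_ <;> rfl

theorem CleftCoaction.rep_mul (h : M.CleftCoaction) :
    M.Holds [.E, .E, .H] [(.mul .E, 0), (.act .E .H, 0)] [(.act .E .H, 1), (.act .E .H, 0)] := by
  refine h.total.holds [.rw h.mul_def 0 0, .rw h.rep_def 8 0, .rw h.join_split 7 0,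
    .rw h.mul_hit 6 1, .up 5 1 false, .up 6 1 false, .rw h.dual.hopf_left.mul_assoc 7 0,
    .up 2 3 false, .rw h.hit_mul.symm 3 1, .up 1 1 false, .up 2 1 false, .rw h.rep_def.symm 3 0,
    .rw h.rep_def.symm 0 1] ?_ ?_ <;> rfl

theorem CleftCoaction.rep_one (h : M.CleftCoaction) :
    M.Holds [.H] [(.one .E, 0), (.act .E .H, 0)] [] := by
  refine h.total.holds [.rw h.one_def 0 0, .rw h.rep_def 3 0, .rw h.join_split 2 0,
    .rw h.one_hit 1 1, .rw h.dual.hopf_left.one_mul 0 0] ?_ ?_ <;> rfl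

/-- The definition of f(k) is the reconstruction formula Σ φ(eᵢ) S⁻¹(eⱼ) # fʲfⁱ of `rep_faithful`
for φ(x) = ⟨k, S⁻¹x₁⟩ x₂; here the element so built is checked to act by φ. -/
theorem CleftCoaction.cleave_act (h : M.CleftCoaction) :
    M.Holds [.K, .H] [(.cleave .K .E, 0), (.act .E .H, 0)] [(.comul .H, 1), (.coanti .H, 1),
      (.pair .K .H, 0)] := by
  refine h.total.holds [.rw h.cleave_def 0 0, .rw h.rep_def 9 0, .rw h.join_split 8 0,
    .rw h.mul_hit 7 1, .up 1 6 false, .up 6 2 false, .rw h.coev_hit 5 1, .rw h.coev_hit 0 1,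
    .rw h.dual.hopf_left.mul_assoc 8 0, .rw h.inv_left 5 1, .up 2 3 false,
    .rw (h.total.slideL (.counit .H) .H).symm 1 1, .rw h.dual.hopf_left.counit_comul 0 1,
    .rw h.dual.hopf_left.mul_one 3 0] ?_ ?_ <;> rfl

theorem CleftCoaction.cleaveInv_act (h : M.CleftCoaction) :
    M.Holds [.K, .H] [(.cleaveInv .K .E, 0), (.act .E .H, 0)] [(.comul .H, 1), (.pair .K .H,
      0)] := by
  refine h.total.holds [.rw h.cleaveInv_def 0 0, .rw h.rep_def 8 0, .rw h.join_split 7 0,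
    .rw h.mul_hit 6 1, .up 1 5 false, .up 5 2 false, .rw h.coev_hit 4 1, .rw h.coev_hit 0 1,
    .rw h.dual.hopf_left.mul_assoc 7 0, .rw h.inv_left 4 1, .up 2 2 false,
    .rw (h.total.slideL (.counit .H) .H).symm 1 1, .rw h.dual.hopf_left.counit_comul 0 1,
    .rw h.dual.hopf_left.mul_one 2 0] ?_ ?_ <;> rfl

set_option maxRecDepth 4000 in
theorem CleftCoaction.rep_join_cleave (h : M.CleftCoaction) :
    M.Holds [.H, .K, .K, .H] [(.join .H .K .E, 0), (.cleave .K .E, 1), (.mul .E, 0), (.act .E .H,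
      0)] [(.cross .K .K, 1), (.cross .H .K, 0), (.comul .H, 1), (.comul .K, 0), (.pair .K .H, 1),
      (.cleave .K .E, 0), (.join .H .K .E, 1), (.mul .E, 0), (.act .E .H, 0)] := by
  refine h.total.holds [.rw h.rep_mul 2 0, .rw h.cleave_act 1 1, .up 0 1 false, .up 1 1 false,
    .up 2 1 false, .rw h.rep_def 4 0, .up 0 3 true, .up 1 3 true, .rw h.join_split 0 0,
    .rw (h.total.slideR (.pair .K .H) .K) 2 1, .up 1 1 true,
    .rw (h.total.slideR (.coanti .H) .K) 2 2, .rw (h.total.slideR (.pair .K .H) .H) 4 0,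
    .up 3 1 true, .rw (h.total.slideR (.coanti .H) .H) 4 1, .up 0 1 true, .up 1 2 true,
    -- The idea of the calculation: create ε on the string h, together with a unit, and expand them
    -- as S⁻¹(h₂) h₁. Then S⁻¹(h₂) joins S⁻¹(x₁) to form S⁻¹(h₂x₁), while h₁ is paired with k'₂.
    .up 4 3 false, .rw h.dual.hopf_left.counit_comul.symm 2 1,
    .rw h.dual.hopf_left.mul_one.symm 9 1, .up 9 3 false,
    .rw (h.total.slideL (.one .H) .H).symm 10 1, .up 4 6 true, .up 10 1 true, .up 11 1 true,
    .up 12 1 true, .rw h.inv_left.symm 3 1, .rw h.dual.hopf_left.comul_assoc.symm 2 1,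
    .up 9 1 true, .up 10 1 true, .up 11 1 true, .rw (h.total.slideR (.coanti .H) .H) 10 1,
    .up 6 1 false, .up 7 1 false, .up 8 1 false, .rw (h.total.slideL (.mul .H) .H) 9 1,
    .up 8 5 false, .up 12 1 true, .up 8 1 true, .up 9 1 true, .up 10 1 true, .up 11 1 true,
    .up 12 1 true, .up 13 1 true, .rw h.dual.hopf_left.mul_assoc.symm 12 1, .up 8 6 false,
    .rw (h.total.slideR (.coanti .H) .H).symm 4 1, .up 8 1 true, .up 9 1 true, .up 10 1 true,
    .up 11 1 true, .rw (h.total.slideR (.coanti .H) .H).symm 10 1,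
    .rw (h.total.slideR (.coanti .H) .H).symm 9 2, .up 5 1 false, .up 6 1 false, .up 7 1 false,
    .up 8 1 false, .rw (h.total.slideL (.cross .H .H) .H) 9 1, .up 12 1 true,
    .rw (h.total.slideR (.mul .H) .H).symm 10 1, .up 3 2 false, .up 4 2 false, .up 5 7 false,
    .up 7 1 false, .up 5 1 true, .up 6 1 true, .up 7 1 true, .up 8 1 true, .up 9 1 true,
    .up 10 1 true, .up 11 1 true, .up 12 1 true, .up 13 1 true, .rw h.dual.comul_pair.symm 12 0,
    .up 5 11 false, .up 3 10 true, .up 6 1 true, .up 7 1 true, .up 8 1 true, .up 9 1 true,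
    .up 10 1 true, .up 11 1 true, .up 12 1 true, .up 13 1 true, .up 15 1 false, .up 14 1 true,
    .rw (h.total.slideL (.pair .K .H) .H).symm 12 1, .up 6 7 false, .up 4 9 true, .up 7 1 true,
    .up 8 1 true, .up 9 1 true, .up 10 1 true, .up 11 1 true, .up 12 1 true,
    .rw h.inv_mul.symm 9 1, .up 7 4 false, .up 5 3 true, .rw h.hit_comul.symm 6 3, .up 5 1 false,
    .up 6 1 false, .up 10 2 false, .rw h.dual.hopf_left.mul_comul.symm 6 1,
    .rw h.cleave_act.symm 7 0, .rw h.join_split.symm 3 2, .up 3 2 true, .up 4 2 true,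
    .rw h.rep_def.symm 6 1, .up 5 2 true, .rw h.rep_mul.symm 7 0] ?_ ?_ <;> rfl

/-- (h # k) f(k') = ⟨k'₂, h₁⟩ f(k'₁) (h₂ # k), since both sides act on H in the same way and the
action is faithful. -/
theorem CleftCoaction.join_cleave (h : M.CleftCoaction) :
    M.Holds [.H, .K, .K] [(.join .H .K .E, 0), (.cleave .K .E, 1), (.mul .E, 0)] [(.cross .K .K,
      1), (.cross .H .K, 0), (.comul .H, 1), (.comul .K, 0), (.pair .K .H, 1), (.cleave .K .E, 0),
      (.join .H .K .E, 1), (.mul .E, 0)] := by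
  refine h.total.holds [.rw h.rep_faithful.symm 3 0, .up 0 3 false, .rw h.rep_join_cleave 1 0,
    .up 0 1 true, .up 1 1 true, .up 2 1 true, .up 3 1 true, .up 4 1 true, .up 5 1 true,
    .up 6 1 true, .up 7 1 true, .rw h.rep_faithful 8 0] ?_ ?_ <;> rfl

/-- ⟨kk', S⁻¹x₁⟩ x₂ splits by duality of product and coproduct, and S⁻¹ reverses the coproduct. The
order that results is that of f(k) acting after f(k'). -/
theorem CleftCoaction.rep_mul_cleave (h : M.CleftCoaction) :
    M.Holds [.K, .K, .H] [(.mul .K, 0), (.cleave .K .E, 0), (.act .E .H, 0)] [(.cleave .K .E, 0),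
      (.cleave .K .E, 1), (.mul .E, 0), (.act .E .H, 0)] := by
  refine h.total.holds [.rw h.cleave_act 1 0, .up 0 1 false, .up 1 1 false,
    .rw h.dual.mul_pair 2 0, .rw h.inv_comul 1 2, .up 3 1 false,
    .rw (h.total.slideL (.coanti .H) .H).symm 2 2, .rw (h.total.slideR (.coanti .H) .K) 4 1,
    .up 5 2 false, .rw (h.total.slideL (.pair .K .H) .H).symm 3 1,
    .rw h.dual.hopf_left.comul_assoc.symm 0 2, .up 1 1 true, .up 2 1 true,
    .rw h.cleave_act.symm 0 1, .rw h.cleave_act.symm 2 0, .up 0 2 true,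
    .rw h.rep_mul.symm 2 0] ?_ ?_ <;> rfl

theorem CleftCoaction.mul_cleave (h : M.CleftCoaction) :
    M.Holds [.K, .K] [(.mul .K, 0), (.cleave .K .E, 0)] [(.cleave .K .E, 0), (.cleave .K .E, 1),
      (.mul .E, 0)] := by
  refine h.total.holds [.rw h.rep_faithful.symm 2 0, .up 0 2 false, .rw h.rep_mul_cleave 1 0,
    .up 0 1 true, .up 1 1 true, .up 2 1 true, .rw h.rep_faithful 3 0] ?_ ?_ <;> rfl

theorem CleftCoaction.rep_one_cleave (h : M.CleftCoaction) :
    M.Holds [.H] [(.one .K, 0), (.cleave .K .E, 0), (.act .E .H, 0)] [(.one .E, 0), (.act .E .H,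
      0)] := by
  refine h.total.holds [.rw h.cleave_act 1 0, .up 0 1 false, .up 1 1 false,
    .rw h.dual.one_pair 2 0, .rw h.inv_counit 1 0, .rw h.dual.hopf_left.counit_comul 0 0,
    .rw h.rep_one.symm 0 0] ?_ ?_ <;> rfl

theorem CleftCoaction.one_cleave (h : M.CleftCoaction) :
    M.Holds [] [(.one .K, 0), (.cleave .K .E, 0)] [(.one .E, 0)] := by
  refine h.total.holds [.rw h.rep_faithful.symm 2 0, .up 0 2 false, .rw h.rep_one_cleave 1 0,
    .up 0 1 true, .rw h.rep_faithful 1 0] ?_ ?_ <;> rfl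

theorem CleftCoaction.rep_cleave_cleaveInv (h : M.CleftCoaction) :
    M.Holds [.K, .H] [(.comul .K, 0), (.cleave .K .E, 0), (.cleaveInv .K .E, 1), (.mul .E, 0),
      (.act .E .H, 0)] [(.counit .K, 0), (.one .E, 0), (.act .E .H, 0)] := by
  refine h.total.holds [.rw h.rep_mul 3 0, .up 1 1 false, .up 2 1 false, .rw h.cleaveInv_act 1 1,
    .rw h.cleave_act 3 0, .up 0 1 false, .up 1 2 false, .rw h.dual.hopf_left.comul_assoc 0 1,
    .rw (h.total.slideL (.pair .K .H) .H) 3 1, .up 5 1 true,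
    .rw (h.total.slideR (.coanti .H) .K).symm 4 1, .up 2 1 false, .up 6 1 true, .up 3 1 false,
    .rw h.dual.comul_pair 4 0, .rw h.inv_left 1 1, .rw h.dual.hopf_left.counit_comul 0 1,
    .rw h.dual.counit_pair.symm 0 0, .rw h.rep_one.symm 0 1, .up 0 2 true] ?_ ?_ <;> rfl

/-- Convolution invertibility: the composite action pairs k with S⁻¹(x₂) x₁ or, in the other order,
with x₂ S⁻¹(x₁), and both reduce to ε. -/
theorem CleftCoaction.cleave_cleaveInv (h : M.CleftCoaction) :
    M.Holds [.K] [(.comul .K, 0), (.cleave .K .E, 0), (.cleaveInv .K .E, 1), (.mul .E,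
      0)] [(.counit .K, 0), (.one .E, 0)] := by
  refine h.total.holds [.rw h.rep_faithful.symm 4 0, .up 0 4 false,
    .rw h.rep_cleave_cleaveInv 1 0, .up 0 1 true, .up 1 1 true,
    .rw h.rep_faithful 2 0] ?_ ?_ <;> rfl

theorem CleftCoaction.rep_cleaveInv_cleave (h : M.CleftCoaction) :
    M.Holds [.K, .H] [(.comul .K, 0), (.cleaveInv .K .E, 0), (.cleave .K .E, 1), (.mul .E, 0),
      (.act .E .H, 0)] [(.counit .K, 0), (.one .E, 0), (.act .E .H, 0)] := by
  refine h.total.holds [.rw h.rep_mul 3 0, .up 1 1 false, .up 2 1 false, .rw h.cleave_act 1 1,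
    .rw h.cleaveInv_act 4 0, .up 0 1 false, .up 1 3 false, .rw h.dual.hopf_left.comul_assoc 0 1,
    .rw (h.total.slideL (.pair .K .H) .H) 4 1, .rw (h.total.slideL (.coanti .H) .H) 3 2,
    .up 2 1 false, .up 6 1 true, .up 3 1 false, .rw h.dual.comul_pair 4 0, .rw h.inv_right 1 1,
    .rw h.dual.hopf_left.counit_comul 0 1, .rw h.dual.counit_pair.symm 0 0,
    .rw h.rep_one.symm 0 1, .up 0 2 true] ?_ ?_ <;> rfl

theorem CleftCoaction.cleaveInv_cleave (h : M.CleftCoaction) :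
    M.Holds [.K] [(.comul .K, 0), (.cleaveInv .K .E, 0), (.cleave .K .E, 1), (.mul .E,
      0)] [(.counit .K, 0), (.one .E, 0)] := by
  refine h.total.holds [.rw h.rep_faithful.symm 4 0, .up 0 4 false,
    .rw h.rep_cleaveInv_cleave 1 0, .up 0 1 true, .up 1 1 true,
    .rw h.rep_faithful 2 0] ?_ ?_ <;> rfl

theorem CleftCoaction.join_mul (h : M.CleftCoaction) :
    M.Holds [.H, .K, .H, .K] [(.join .H .K .E, 2), (.join .H .K .E, 0), (.mul .E, 0)] [(.comul .K,
      1), (.cross .K .H, 2), (.act .K .H, 1), (.mul .H, 0), (.mul .K, 1), (.join .H .K .E, 0)] := by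
  refine h.total.holds [.rw h.mul_def 2 0, .up 0 1 true, .up 1 2 true, .rw h.join_split 0 0,
    .rw h.join_split 0 2] ?_ ?_ <;> rfl

set_option maxRecDepth 4000 in
-- With Φ(r # e) = r₀ ⊗ f(r₁)e and e = h # k, the product of images is r₀r'₀ ⊗ f(r₁) e f(r'₁) e'.
-- The commutation relation rewrites it as r₀r'₀⟨r'₂, h₁⟩ ⊗ f(r₁r'₁)(h₂ # k)e', which is Φ of the
-- product r(h₁·r') # (h₂ # k)e'. The steps run from the second form to the first.
theorem CleftCoaction.duality_mul (h : M.CleftCoaction) :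
    M.Holds [.R, .H, .K, .R, .H, .K] [(.comul .K, 2), (.cross .K .R, 3), (.cross .K .H, 4),
      (.cross .K .R, 2), (.act .K .H, 3), (.comul .H, 1), (.cross .H .R, 2), (.act .H .R, 1),
      (.mul .R, 0), (.mul .H, 1), (.mul .K, 2), (.join .H .K .E, 1), (.coact .R .K, 0),
      (.cleave .K .E, 1), (.mul .E, 1)] [(.join .H .K .E, 4), (.coact .R .K, 3), (.cleave .K .E,
      4), (.mul .E, 4), (.join .H .K .E, 1), (.coact .R .K, 0), (.cleave .K .E, 1), (.mul .E, 1),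
      (.cross .E .R, 1), (.mul .R, 0), (.mul .E, 1)] := by
  refine h.total.holds [.up 2 1 true, .up 3 2 true, .up 4 2 true, .up 5 2 true, .rw h.act_def 5 1,
    .up 2 7 false, .up 4 6 false, .up 2 1 true, .up 3 2 true, .up 4 2 true, .up 5 2 true,
    .up 6 2 true, .up 7 2 true, .rw (h.total.slideR (.coact .R .K) .H) 5 1, .up 2 5 false,
    .up 4 4 false, .up 2 1 true, .up 3 2 true, .up 4 2 true, .up 5 2 true,
    .rw (h.total.slideL (.comul .H) .R) 3 1, .up 2 3 false, .up 4 2 false, .up 2 1 true,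
    .rw (h.total.slideL (.comul .K) .R) 0 2, .up 1 3 true, .up 2 3 true, .up 3 3 true,
    .up 4 3 true, .up 8 1 false, .up 9 1 false, .up 10 1 false, .up 5 6 true, .up 6 6 true,
    .up 7 6 true, .rw h.join_mul.symm 8 2, .up 5 3 false, .up 6 3 false, .up 7 3 false,
    .up 2 1 true, .up 3 5 true, .up 4 5 true, .rw h.map_mul 3 0, .up 2 6 false, .up 4 5 false,
    .up 5 5 false, .up 6 5 false, .up 7 5 false, .rw h.mul_cleave 12 1,
    .rw h.monoid_E.mul_assoc 14 1, .up 7 1 true, .up 8 1 true, .up 9 1 true, .up 10 1 true,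
    .up 11 1 true, .up 12 1 true, .rw h.monoid_E.mul_assoc.symm 13 2, .up 4 3 true, .up 8 4 false,
    .up 9 4 false, .up 10 4 false, .up 2 1 true, .up 3 1 true, .rw h.coassoc 2 1, .up 3 1 false,
    .up 6 2 true, .up 7 1 true, .up 8 1 true, .rw (h.total.slideR (.coact .R .K) .H).symm 1 1,
    -- The coefficient ⟨r'₂, h₁⟩ coming from the action on R is absorbed here by moving f(r'₁) to
    -- the right of h # k.
    .rw (h.total.slideR (.coact .R .K) .K).symm 0 2, .up 2 1 true, .rw h.join_cleave.symm 3 2,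
    .up 5 1 false, .rw h.monoid_E.mul_assoc 6 2, .up 7 1 true, .up 8 1 true, .up 10 1 false,
    .up 9 1 true, .up 11 1 false, .rw h.monoid_E.mul_assoc.symm 10 2, .up 9 3 true, .up 0 5 false,
    .up 2 3 false, .up 3 3 false, .up 6 1 true, .up 7 1 true, .up 9 1 false, .up 10 1 false,
    .up 0 1 true, .up 1 3 true, .up 2 3 true, .up 3 3 true, .up 4 3 true, .up 5 4 true,
    .rw (h.total.slideL (.cleave .K .E) .R).symm 4 1, .up 6 3 true, .up 3 3 false,
    .rw (h.total.slideL (.join .H .K .E) .R).symm 1 1, .up 2 1 true, .up 3 1 true, .up 6 3 true,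
    .rw (h.total.slideL (.mul .E) .R).symm 4 1, .up 0 6 false, .up 2 5 false, .up 3 5 false,
    .up 4 1 true, .up 4 1 false] ?_ ?_ <;> rfl

theorem CleftCoaction.duality_one (h : M.CleftCoaction) :
    M.Holds [] [(.one .R, 0), (.one .H, 1), (.one .K, 2), (.join .H .K .E, 1), (.coact .R .K, 0),
      (.cleave .K .E, 1), (.mul .E, 1)] [(.one .R, 0), (.one .E, 1)] := by
  refine h.total.holds [.rw h.one_def.symm 1 1, .up 1 1 true, .rw h.map_one 0 0, .up 2 1 true,
    .rw h.one_cleave 1 1, .up 1 1 false, .rw h.monoid_E.one_mul 2 1] ?_ ?_ <;> rfl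

/-- Coassociativity of the coaction turns the composite into r₀ ⊗ (g * f)(r₁) e, with * the
convolution product, and g * f = ε1. -/
theorem CleftCoaction.cleave_cancel (h : M.CleftCoaction) :
    M.Holds [.R, .E] [(.coact .R .K, 0), (.cleave .K .E, 1), (.mul .E, 1), (.coact .R .K, 0),
      (.cleaveInv .K .E, 1), (.mul .E, 1)] [] := by
  refine h.total.holds [.up 1 2 true, .up 2 2 true, .rw h.monoid_E.mul_assoc.symm 4 1,
    .rw h.coassoc 0 0, .rw h.cleaveInv_cleave 1 1, .up 0 2 false, .up 1 2 false,
    .rw h.monoid_E.one_mul 0 1, .rw h.counit 0 0] ?_ ?_ <;> rfl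

theorem CleftCoaction.cleaveInv_cancel (h : M.CleftCoaction) :
    M.Holds [.R, .E] [(.coact .R .K, 0), (.cleaveInv .K .E, 1), (.mul .E, 1), (.coact .R .K, 0),
      (.cleave .K .E, 1), (.mul .E, 1)] [] := by
  refine h.total.holds [.up 1 2 true, .up 2 2 true, .rw h.monoid_E.mul_assoc.symm 4 1,
    .rw h.coassoc 0 0, .rw h.cleave_cleaveInv 1 1, .up 0 2 false, .up 1 2 false,
    .rw h.monoid_E.one_mul 0 1, .rw h.counit 0 0] ?_ ?_ <;> rfl

end Model

section

/-- The multiplication of the smash product. -/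
def smashMul {A B : C} [ComonObj B] (m : A ⊗ A ⟶ A) (m' : B ⊗ B ⟶ B) (act : B ⊗ A ⟶ A) :
    (A ⊗ B) ⊗ (A ⊗ B) ⟶ A ⊗ B :=
  (α_ A B (A ⊗ B)).hom ≫ A ◁ (α_ B A B).inv ≫ A ◁ twist act ▷ B ≫
    A ◁ (α_ A B B).hom ≫ (α_ A A (B ⊗ B)).inv ≫ (m ⊗ₘ m')

/-- The map that sends `k`, when `t` is the inverse of the antipode, to the element of `H # K` that
acts on `H` by `x ↦ ⟨k, s x₁⟩ x₂`. -/
def cleaving {H K : C} [HopfObj H] [MonObj K] (p : K ⊗ H ⟶ 𝟙_ C) (c : 𝟙_ C ⟶ H ⊗ K) (t s : H ⟶ H) :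
    K ⟶ H ⊗ K :=
  𝟙 _ ⊗≫ K ◁ c ⊗≫ K ◁ Δ[H] ▷ K ⊗≫ K ◁ s ▷ H ▷ K ⊗≫ p ▷ (H ⊗ K) ⊗≫ H ◁ c ▷ K ⊗≫
    H ◁ t ▷ K ▷ K ⊗≫ μ[H] ▷ K ▷ K ⊗≫ H ◁ μ[K]

/-- The map `r ⊗ e ↦ r₀ ⊗ f(r₁) e` of a comodule `R` and an algebra `E`. -/
def galois {R K E : C} (ψ : R ⟶ R ⊗ K) (f : K ⟶ E) (m : E ⊗ E ⟶ E) : R ⊗ E ⟶ R ⊗ E :=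
  𝟙 _ ⊗≫ ψ ▷ E ⊗≫ R ◁ f ▷ E ⊗≫ R ◁ m

end

/-! ### Translation for coactions, actions and smash products. -/

namespace Model

variable {M : Model C}

theorem comodule_iff {w y : Wire} [MonObj (M.obj w)] [HopfObj (M.obj y)]
    (hmR : M.hom (.mul w) = some (b21 μ[M.obj w]))
    (huR : M.hom (.one w) = some (b01 η[M.obj w]))
    (hm' : M.hom (.mul y) = some (b21 μ[M.obj y]))
    (hu' : M.hom (.one y) = some (b01 η[M.obj y]))
    (hD' : M.hom (.comul y) = some (b12 Δ[M.obj y]))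
    (hE' : M.hom (.counit y) = some (b10 ε[M.obj y]))
    {ψ : M.obj w ⟶ M.obj w ⊗ M.obj y}
    (hψ : M.hom (.coact w y) = some (b12 ψ)) :
    (M.Holds [w] [(.coact w y, 0), (.coact w y, 0)] [(.coact w y, 0), (.comul y, 1)] ↔
      ψ ≫ ψ ▷ M.obj y ≫ (α_ _ _ _).hom = ψ ≫ M.obj w ◁ Δ[M.obj y]) ∧
    (M.Holds [w] [(.coact w y, 0), (.counit y, 1)] [] ↔
      ψ ≫ M.obj w ◁ ε[M.obj y] = (ρ_ _).inv) ∧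
    (M.Holds [] [(.one w, 0), (.coact w y, 0)] [(.one w, 0), (.one y, 1)] ↔
      η[M.obj w] ≫ ψ = (λ_ _).inv ≫ (η[M.obj w] ⊗ₘ η[M.obj y])) ∧
    (M.Holds [w, w] [(.mul w, 0), (.coact w y, 0)] [(.coact w y, 1), (.coact w y, 0), (.cross y w,
      1), (.mul w, 0), (.mul y, 1)] ↔
      μ[M.obj w] ≫ ψ = (ψ ⊗ₘ ψ) ≫ tensorμ _ _ _ _ ≫ (μ[M.obj w] ⊗ₘ μ[M.obj y])) := by
  refine ⟨?_, ?_, ?_, ?_⟩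
  on_goal 4 => apply holds_iff (b := [w, y]) (i := M.flat [w, w]) (j := M.flat _)
  on_goal 3 => apply holds_iff (b := [w, y]) (i := M.flat []) (j := M.flat _)
  on_goal 2 => apply holds_iff (b := [w]) (i := M.flat [w]) (j := M.flat _ ≪≫ (ρ_ _).symm)
  on_goal 1 => apply holds_iff (b := [w, y, y]) (i := M.flat [w]) (j := M.flat _)
  all_goals first
    | (repeat' first | assumption | exact rfl | apply Val.nil | apply Val.cons | apply lay_box |
        apply Lay.there); done
    | (simp only [app, flat, flatOb, ob, tens, Box.dom, Box.cod, List.cons_append, List.nil_append,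
        List.append_eq, Iso.trans_hom, Iso.trans_inv, Iso.symm_hom, Iso.symm_inv,
        whiskerLeftIso_hom, whiskerLeftIso_inv, Iso.refl_hom, Iso.refl_inv, hom, tensorμ, b01,
            b10, b12, b21,
        tensorHom_def' ψ ψ, MonoidalCategory.tensorHom_def η[M.obj w],
            MonoidalCategory.tensorHom_def μ[M.obj w]]
       monoidal)

theorem moduleAlgebra_iff {x y : Wire} [MonObj (M.obj x)] [HopfObj (M.obj y)]
    (hm : M.hom (.mul x) = some (b21 μ[M.obj x]))
    (hu : M.hom (.one x) = some (b01 η[M.obj x]))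
    (hm' : M.hom (.mul y) = some (b21 μ[M.obj y]))
    (hu' : M.hom (.one y) = some (b01 η[M.obj y]))
    (hD' : M.hom (.comul y) = some (b12 Δ[M.obj y]))
    (hE' : M.hom (.counit y) = some (b10 ε[M.obj y]))
    {a : M.obj y ⊗ M.obj x ⟶ M.obj x}
    (ha : M.hom (.act y x) = some (b21 a)) :
    (M.Holds [x] [(.one y, 0), (.act y x, 0)] [] ↔
      η[M.obj y] ▷ M.obj x ≫ a = (λ_ _).hom) ∧
    (M.Holds [y, y, x] [(.mul y, 0), (.act y x, 0)] [(.act y x, 1), (.act y x, 0)] ↔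
      μ[M.obj y] ▷ M.obj x ≫ a = (α_ _ _ _).hom ≫ M.obj y ◁ a ≫ a) ∧
    (M.Holds [y] [(.one x, 1), (.act y x, 0)] [(.counit y, 0), (.one x, 0)] ↔
      M.obj y ◁ η[M.obj x] ≫ a = (ρ_ _).hom ≫ ε[M.obj y] ≫ η[M.obj x]) ∧
    (M.Holds [y, x, x] [(.mul x, 1), (.act y x, 0)] [(.comul y, 0), (.cross y x, 1), (.act y x,
      0), (.act y x, 1), (.mul x, 0)] ↔
      M.obj y ◁ μ[M.obj x] ≫ a =
        Δ[M.obj y] ▷ (M.obj x ⊗ M.obj x) ≫ tensorμ _ _ _ _ ≫ (a ⊗ₘ a) ≫ μ[M.obj x]) := by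
  refine ⟨?_, ?_, ?_, ?_⟩
  on_goal 4 => apply holds_iff (b := [x]) (i := M.flat [y, x, x]) (j := M.flat _)
  on_goal 3 => apply holds_iff (b := [x]) (i := M.flat [y] ≪≫ (ρ_ _).symm) (j := M.flat _)
  on_goal 2 => apply holds_iff (b := [x]) (i := M.flat [y, y, x] ≪≫ (α_ _ _ _).symm) (j := M.flat _)
  on_goal 1 => apply holds_iff (b := [x]) (i := M.flat [x] ≪≫ (λ_ _).symm) (j := M.flat _)
  all_goals first
    | (repeat' first | assumption | exact rfl | apply Val.nil | apply Val.cons | apply lay_box |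
        apply Lay.there); done
    | (simp only [app, flat, flatOb, ob, tens, Box.dom, Box.cod, List.cons_append, List.nil_append,
        List.append_eq, Iso.trans_hom, Iso.trans_inv, Iso.symm_hom, Iso.symm_inv,
        whiskerLeftIso_hom, whiskerLeftIso_inv, Iso.refl_hom, Iso.refl_inv, hom, tensorμ, b01,
            b10, b12, b21, MonoidalCategory.tensorHom_def a a]
       monoidal)

theorem coactionAct_iff {w x y : Wire}
    {p : M.obj y ⊗ M.obj x ⟶ 𝟙_ C} (hp : M.hom (.pair y x) = some (b20 p))
    {ψ : M.obj w ⟶ M.obj w ⊗ M.obj y}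
    (hψ : M.hom (.coact w y) = some (b12 ψ))
    {b : M.obj x ⊗ M.obj w ⟶ M.obj w}
    (hb : M.hom (.act x w) = some (b21 b)) :
    M.Holds [x, w] [(.act x w, 0)] [(.coact w y, 1), (.cross x w, 0), (.cross x y, 1), (.pair y x,
      1)] ↔
      b = coactionAct p ψ := by
  apply holds_iff (b := [w]) (i := M.flat [x, w]) (j := M.flat _)
  all_goals first
    | (repeat' first | assumption | exact rfl | apply Val.nil | apply Val.cons | apply lay_box |
        apply Lay.there); done
    | (simp only [app, flat, flatOb, ob, tens, Box.dom, Box.cod, List.cons_append, List.nil_append,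
        List.append_eq, Iso.trans_hom, Iso.trans_inv, Iso.symm_hom, Iso.symm_inv,
        whiskerLeftIso_hom, whiskerLeftIso_inv, Iso.refl_hom, Iso.refl_inv, hom, coactionAct, b12,
            b20, b21]
       monoidal)

theorem hitAct_iff {x y : Wire} [ComonObj (M.obj x)]
    {p : M.obj y ⊗ M.obj x ⟶ 𝟙_ C} (hp : M.hom (.pair y x) = some (b20 p))
    (hD : M.hom (.comul x) = some (b12 Δ[M.obj x]))
    {a : M.obj y ⊗ M.obj x ⟶ M.obj x}
    (ha : M.hom (.act y x) = some (b21 a)) :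
    M.Holds [y, x] [(.act y x, 0)] [(.comul x, 1), (.cross y x, 0), (.pair y x, 1)] ↔
      a = hitAct p := by
  apply holds_iff (b := [x]) (i := M.flat [y, x]) (j := M.flat _)
  all_goals first
    | (repeat' first | assumption | exact rfl | apply Val.nil | apply Val.cons | apply lay_box |
        apply Lay.there); done
    | (simp only [app, flat, flatOb, ob, tens, Box.dom, Box.cod, List.cons_append, List.nil_append,
        List.append_eq, Iso.trans_hom, Iso.trans_inv, Iso.symm_hom, Iso.symm_inv,
        whiskerLeftIso_hom, whiskerLeftIso_inv, Iso.refl_hom, Iso.refl_inv, hom, hitAct, b12, b20,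
            b21]
       monoidal)

theorem extendAct_iff {w x y : Wire} [MonObj (M.obj w)] [HopfObj (M.obj x)] [HopfObj (M.obj y)]
    (hmR : M.hom (.mul w) = some (b21 μ[M.obj w]))
    (huR : M.hom (.one w) = some (b01 η[M.obj w]))
    (hm : M.hom (.mul x) = some (b21 μ[M.obj x]))
    (hu : M.hom (.one x) = some (b01 η[M.obj x]))
    (hD : M.hom (.comul x) = some (b12 Δ[M.obj x]))
    (hm' : M.hom (.mul y) = some (b21 μ[M.obj y]))
    (hu' : M.hom (.one y) = some (b01 η[M.obj y]))
    (hD' : M.hom (.comul y) = some (b12 Δ[M.obj y]))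
    (hE' : M.hom (.counit y) = some (b10 ε[M.obj y]))
    {b : M.obj x ⊗ M.obj w ⟶ M.obj w}
    (hb : M.hom (.act x w) = some (b21 b))
    {a : M.obj y ⊗ M.obj x ⟶ M.obj x}
    (ha : M.hom (.act y x) = some (b21 a)) :
    (M.Holds [w, x] [(.one y, 0), (.cross y w, 0), (.act y x, 1)] [] ↔
      η[M.obj y] ▷ (M.obj w ⊗ M.obj x) ≫ extendAct (M.obj w) a = (λ_ _).hom) ∧
    (M.Holds [y, y, w, x] [(.mul y, 0), (.cross y w, 0), (.act y x, 1)] [(.cross y w, 1),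
      (.act y x, 2), (.cross y w, 0), (.act y x, 1)] ↔
      μ[M.obj y] ▷ (M.obj w ⊗ M.obj x) ≫ extendAct (M.obj w) a =
        (α_ _ _ _).hom ≫ M.obj y ◁ extendAct (M.obj w) a ≫ extendAct (M.obj w) a) ∧
    (M.Holds [y] [(.one w, 1), (.one x, 2), (.cross y w, 0), (.act y x, 1)] [(.counit y, 0),
      (.one w, 0), (.one x, 1)] ↔
      M.obj y ◁ ((λ_ _).inv ≫ (η[M.obj w] ⊗ₘ η[M.obj x])) ≫ extendAct (M.obj w) a =
        (ρ_ _).hom ≫ ε[M.obj y] ≫ ((λ_ _).inv ≫ (η[M.obj w] ⊗ₘ η[M.obj x]))) ∧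
    (M.Holds [y, w, x, w, x] [(.comul x, 2), (.cross x w, 3), (.act x w, 2), (.mul w, 1), (.mul x,
      2), (.cross y w, 0), (.act y x, 1)] [(.comul y, 0), (.cross y w, 1), (.cross y x, 2),
      (.cross y w, 0), (.act y x, 1), (.cross y w, 2), (.act y x, 3), (.comul x, 1), (.cross x w,
      2), (.act x w, 1), (.mul w, 0), (.mul x, 1)] ↔
      M.obj y ◁ (smashMul μ[M.obj w] μ[M.obj x] b) ≫ extendAct (M.obj w) a = Δ[M.obj y] ▷ ((M.obj
        w ⊗ M.obj x) ⊗ (M.obj w ⊗ M.obj x)) ≫ tensorμ _ _ _ _ ≫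
        (extendAct (M.obj w) a ⊗ₘ extendAct (M.obj w) a) ≫ (smashMul μ[M.obj w] μ[M.obj x] b)) := by
  refine ⟨?_, ?_, ?_, ?_⟩
  on_goal 4 => apply holds_iff (b := [w, x]) (i := M.flat [y, w, x, w,
    x] ≪≫ whiskerLeftIso (M.obj y) (α_ (M.obj w) (M.obj x) (M.obj w ⊗ M.obj x)).symm) (j := M.flat
    _)
  on_goal 3 => apply holds_iff (b := [w, x]) (i := M.flat [y] ≪≫ (ρ_ _).symm) (j := M.flat _)
  on_goal 2 => apply holds_iff (b := [w, x]) (i := M.flat [y, y, w,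
    x] ≪≫ (α_ _ _ _).symm) (j := M.flat _)
  on_goal 1 => apply holds_iff (b := [w, x]) (i := M.flat [w, x] ≪≫ (λ_ _).symm) (j := M.flat _)
  all_goals first
    | (repeat' first | assumption | exact rfl | apply Val.nil | apply Val.cons | apply lay_box |
        apply Lay.there); done
    | (simp only [app, flat, flatOb, ob, tens, Box.dom, Box.cod, List.cons_append, List.nil_append,
        List.append_eq, Iso.trans_hom, Iso.trans_inv, Iso.symm_hom, Iso.symm_inv,
        whiskerLeftIso_hom, whiskerLeftIso_inv, Iso.refl_hom, Iso.refl_inv, hom, tensorμ,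
            smashMul, extendAct, twist,
        BraidedCategory.braiding_tensor_right_hom, b01, b10, b12, b21,
        MonoidalCategory.tensorHom_def]
       monoidal)

theorem smash_iff {x y z : Wire} [HopfObj (M.obj x)] [HopfObj (M.obj y)]
    {c : 𝟙_ C ⟶ M.obj x ⊗ M.obj y} (hc : M.hom (.copair x y) = some (b02 c))
    {p : M.obj y ⊗ M.obj x ⟶ 𝟙_ C} (hp : M.hom (.pair y x) = some (b20 p))
    (hm : M.hom (.mul x) = some (b21 μ[M.obj x]))
    (hu : M.hom (.one x) = some (b01 η[M.obj x]))
    (hD : M.hom (.comul x) = some (b12 Δ[M.obj x]))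
    (hE : M.hom (.counit x) = some (b10 ε[M.obj x]))
    (hm' : M.hom (.mul y) = some (b21 μ[M.obj y]))
    (hu' : M.hom (.one y) = some (b01 η[M.obj y]))
    (hD' : M.hom (.comul y) = some (b12 Δ[M.obj y]))
    (hE' : M.hom (.counit y) = some (b10 ε[M.obj y]))
    {a : M.obj y ⊗ M.obj x ⟶ M.obj x}
    (ha : M.hom (.act y x) = some (b21 a))
    {U : M.obj x ⊗ M.obj y ⟶ M.obj z}
    (hU : M.hom (.join x y z) = some (b21 U))
    {V : M.obj z ⟶ M.obj x ⊗ M.obj y}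
    (hV : M.hom (.split x y z) = some (b12 V))
    {t : M.obj x ⟶ M.obj x}
    (ht : M.hom (.coanti x) = some (b11 t))
    {mE : M.obj z ⊗ M.obj z ⟶ M.obj z}
    (hmE : M.hom (.mul z) = some (b21 mE)) {uE : 𝟙_ C ⟶ M.obj z}
    (huE : M.hom (.one z) = some (b01 uE))
    {v : M.obj z ⊗ M.obj x ⟶ M.obj x}
    (hv : M.hom (.act z x) = some (b21 v))
    {l : M.obj y ⟶ M.obj z}
    (hl : M.hom (.cleave y z) = some (b11 l))
    {j : M.obj y ⟶ M.obj z}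
    (hj : M.hom (.cleaveInv y z) = some (b11 j)) :
    (M.Holds [x, y] [(.join x y z, 0), (.split x y z, 0)] [] ↔
      U ≫ V = 𝟙 _) ∧
    (M.Holds [z] [(.split x y z, 0), (.join x y z, 0)] [] ↔
      V ≫ U = 𝟙 _) ∧
    (M.Holds [z, z] [(.mul z, 0)] [(.split x y z, 1), (.split x y z, 0), (.comul y, 1),
      (.cross y x, 2), (.act y x, 1), (.mul x, 0), (.mul y, 1), (.join x y z, 0)] ↔
      mE = (V ⊗ₘ V) ≫ smashMul μ[M.obj x] μ[M.obj y] a ≫ U) ∧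
    (M.Holds [] [(.one z, 0)] [(.one x, 0), (.one y, 1), (.join x y z, 0)] ↔
      uE = (λ_ _).inv ≫ (η[M.obj x] ⊗ₘ η[M.obj y]) ≫ U) ∧
    (M.Holds [z, x] [(.act z x, 0)] [(.split x y z, 0), (.act y x, 1), (.mul x, 0)] ↔
      v = V ▷ M.obj x ≫ (α_ _ _ _).hom ≫ M.obj x ◁ a ≫ μ[M.obj x]) ∧
    (M.Holds [y] [(.cleave y z, 0)] [(.copair x y, 1), (.comul x, 1), (.coanti x, 1), (.pair y x,
      0), (.copair x y, 1), (.coanti x, 1), (.mul x, 0), (.mul y, 1), (.join x y z, 0)] ↔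
      l = cleaving p c t t ≫ U) ∧
    (M.Holds [y] [(.cleaveInv y z, 0)] [(.copair x y, 1), (.comul x, 1), (.pair y x, 0),
      (.copair x y, 1), (.coanti x, 1), (.mul x, 0), (.mul y, 1), (.join x y z, 0)] ↔
      j = cleaving p c t (𝟙 _) ≫ U) := by
  refine ⟨?_, ?_, ?_, ?_, ?_, ?_, ?_⟩
  on_goal 7 => apply holds_iff (b := [z]) (i := M.flat [y]) (j := M.flat _)
  on_goal 6 => apply holds_iff (b := [z]) (i := M.flat [y]) (j := M.flat _)
  on_goal 5 => apply holds_iff (b := [x]) (i := M.flat [z, x]) (j := M.flat _)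
  on_goal 4 => apply holds_iff (b := [z]) (i := M.flat []) (j := M.flat _)
  on_goal 3 => apply holds_iff (b := [z]) (i := M.flat [z, z]) (j := M.flat _)
  on_goal 2 => apply holds_iff (b := [z]) (i := M.flat [z]) (j := M.flat _)
  on_goal 1 => apply holds_iff (b := [x, y]) (i := M.flat [x, y]) (j := M.flat _)
  all_goals first
    | (repeat' first | assumption | exact rfl | apply Val.nil | apply Val.cons | apply lay_box |
        apply Lay.there); done
    | (simp only [app, flat, flatOb, ob, tens, Box.dom, Box.cod, List.cons_append, List.nil_append,
        List.append_eq, Iso.trans_hom, Iso.trans_inv, Iso.symm_hom, Iso.symm_inv,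
        whiskerLeftIso_hom, whiskerLeftIso_inv, Iso.refl_hom, Iso.refl_inv, hom, smashMul, twist,
            cleaving, b01, b02, b10, b11, b12, b20,
        b21, tensorHom_def' V V, MonoidalCategory.tensorHom_def η[M.obj x],
            MonoidalCategory.tensorHom_def μ[M.obj x]]
       monoidal)

theorem galois_iff {w x y z : Wire} [MonObj (M.obj w)] [HopfObj (M.obj x)] [HopfObj (M.obj y)]
    (hmR : M.hom (.mul w) = some (b21 μ[M.obj w]))
    (huR : M.hom (.one w) = some (b01 η[M.obj w]))
    (hm : M.hom (.mul x) = some (b21 μ[M.obj x]))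
    (hu : M.hom (.one x) = some (b01 η[M.obj x]))
    (hD : M.hom (.comul x) = some (b12 Δ[M.obj x]))
    (hm' : M.hom (.mul y) = some (b21 μ[M.obj y]))
    (hu' : M.hom (.one y) = some (b01 η[M.obj y]))
    (hD' : M.hom (.comul y) = some (b12 Δ[M.obj y]))
    (hE' : M.hom (.counit y) = some (b10 ε[M.obj y]))
    {ψ : M.obj w ⟶ M.obj w ⊗ M.obj y}
    (hψ : M.hom (.coact w y) = some (b12 ψ))
    {b : M.obj x ⊗ M.obj w ⟶ M.obj w}
    (hb : M.hom (.act x w) = some (b21 b))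
    {a : M.obj y ⊗ M.obj x ⟶ M.obj x}
    (ha : M.hom (.act y x) = some (b21 a))
    {U : M.obj x ⊗ M.obj y ⟶ M.obj z}
    (hU : M.hom (.join x y z) = some (b21 U))
    {mE : M.obj z ⊗ M.obj z ⟶ M.obj z}
    (hmE : M.hom (.mul z) = some (b21 mE)) {uE : 𝟙_ C ⟶ M.obj z}
    (huE : M.hom (.one z) = some (b01 uE))
    {l : M.obj y ⟶ M.obj z}
    (hl : M.hom (.cleave y z) = some (b11 l))
    {j : M.obj y ⟶ M.obj z}
    (hj : M.hom (.cleaveInv y z) = some (b11 j)) :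
    (M.Holds [w, x, y, w, x, y] [(.comul y, 2), (.cross y w, 3), (.cross y x, 4), (.cross y w, 2),
      (.act y x, 3), (.comul x, 1), (.cross x w, 2), (.act x w, 1), (.mul w, 0), (.mul x, 1),
      (.mul y, 2), (.join x y z, 1), (.coact w y, 0), (.cleave y z, 1), (.mul z,
      1)] [(.join x y z, 4), (.coact w y, 3), (.cleave y z, 4), (.mul z, 4), (.join x y z, 1),
      (.coact w y, 0), (.cleave y z, 1), (.mul z, 1), (.cross z w, 1), (.mul w, 0), (.mul z, 1)] ↔
      smashMul (smashMul μ[M.obj w] μ[M.obj x] b) μ[M.obj y] (extendAct (M.obj w) a) ≫ ((α_ _ _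
        _).hom ≫ M.obj w ◁ U ≫ galois ψ l mE) =
        _ ◁ ((α_ _ _ _).hom ≫ M.obj w ◁ U ≫ galois ψ l mE) ≫
          ((α_ _ _ _).hom ≫ M.obj w ◁ U ≫ galois ψ l mE) ▷ _ ≫ tensorμ _ _ _ _ ≫ (μ[M.obj w] ⊗ₘ
            mE)) ∧
    (M.Holds [] [(.one w, 0), (.one x, 1), (.one y, 2), (.join x y z, 1), (.coact w y, 0),
      (.cleave y z, 1), (.mul z, 1)] [(.one w, 0), (.one z, 1)] ↔
      ((λ_ _).inv ≫ (((λ_ _).inv ≫ (η[M.obj w] ⊗ₘ η[M.obj x])) ⊗ₘ η[M.obj y])) ≫ ((α_ _ _ _).hom ≫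
        M.obj w ◁ U ≫ galois ψ l mE) =
        (λ_ _).inv ≫ (η[M.obj w] ⊗ₘ uE)) ∧
    (M.Holds [w, z] [(.coact w y, 0), (.cleaveInv y z, 1), (.mul z, 1), (.coact w y, 0),
      (.cleave y z, 1), (.mul z, 1)] [] ↔
      galois ψ j mE ≫ galois ψ l mE = 𝟙 _) ∧
    (M.Holds [w, z] [(.coact w y, 0), (.cleave y z, 1), (.mul z, 1), (.coact w y, 0),
      (.cleaveInv y z, 1), (.mul z, 1)] [] ↔
      galois ψ l mE ≫ galois ψ j mE = 𝟙 _) := by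
  refine ⟨?_, ?_, ?_, ?_⟩
  on_goal 4 => apply holds_iff (b := [w, z]) (i := M.flat [w, z]) (j := M.flat _)
  on_goal 3 => apply holds_iff (b := [w, z]) (i := M.flat [w, z]) (j := M.flat _)
  on_goal 2 => apply holds_iff (b := [w, z]) (i := M.flat []) (j := M.flat _)
  on_goal 1 => apply holds_iff (b := [w, z]) (i := M.flat [w, x, y, w, x,
    y] ≪≫ (α_ (M.obj w) (M.obj x) (M.obj y ⊗ M.obj w ⊗ M.obj x ⊗ M.obj y)).symm ≪≫ (α_ (M.obj w ⊗
    M.obj x) (M.obj y) (M.obj w ⊗ M.obj x ⊗ M.obj y)).symm ≪≫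
      whiskerLeftIso ((M.obj w ⊗ M.obj x) ⊗ M.obj y) (α_ (M.obj w) (M.obj x) (M.obj y)).symm) (j
        := M.flat _)
  all_goals first
    | (repeat' first | assumption | exact rfl | apply Val.nil | apply Val.cons | apply lay_box |
        apply Lay.there); done
    | (simp only [app, flat, flatOb, ob, tens, Box.dom, Box.cod, List.cons_append, List.nil_append,
        List.append_eq, Iso.trans_hom, Iso.trans_inv, Iso.symm_hom, Iso.symm_inv,
        whiskerLeftIso_hom, whiskerLeftIso_inv, Iso.refl_hom, Iso.refl_inv, hom, tensorμ,
            smashMul, extendAct, twist, galois,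
        BraidedCategory.braiding_tensor_right_hom, b01, b11, b12, b21,
        MonoidalCategory.tensorHom_def]
       monoidal)

theorem section_iff {x : Wire}
    {s : M.obj x ⟶ M.obj x} (hS : M.hom (.anti x) = some (b11 s))
    {t : M.obj x ⟶ M.obj x} (ht : M.hom (.coanti x) = some (b11 t)) :
    M.Holds [x] [(.coanti x, 0), (.anti x, 0)] [] ↔
      t ≫ s = 𝟙 _ := by
  apply holds_iff (b := [x]) (i := M.flat [x]) (j := M.flat _)
  all_goals first
    | (repeat' first | assumption | exact rfl | apply Val.nil | apply Val.cons | apply lay_box |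
        apply Lay.there); done
    | (simp only [app, flat, flatOb, ob, tens, Box.dom, Box.cod, List.cons_append, List.nil_append,
        List.append_eq, Iso.trans_hom, Iso.trans_inv, Iso.symm_hom, Iso.symm_inv,
        whiskerLeftIso_hom, whiskerLeftIso_inv, Iso.refl_hom, Iso.refl_inv, b11]
       monoidal)

end Model

/-! ### The duality isomorphism and the theorem. -/

namespace Model

/-- The interpretation of the strings by the Hopf algebra `H`, its dual `K`, a `K`-comodule algebra
`R` and the smash product of `H` and `K`. -/
abbrev coaction (H K : C) [HopfObj H] [HopfObj K] (p : K ⊗ H ⟶ 𝟙_ C) (c : 𝟙_ C ⟶ H ⊗ K)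
    (R : Mon C) (ψ : R.X ⟶ R.X ⊗ K) (t : H ⟶ H) : Model C where
  obj := fun | .R => R.X | .H => H | .K => K | .E => H ⊗ K
  box := fun
    | .mul .R => some (b21 μ[R.X])
    | .one .R => some (b01 η[R.X])
    | .coact .R .K => some (b12 ψ)
    | .act .H .R => some (b21 (coactionAct p ψ))
    | .mul .H => some (b21 μ[H])
    | .one .H => some (b01 η[H])
    | .comul .H => some (b12 Δ[H])
    | .counit .H => some (b10 ε[H])
    | .anti .H => some (b11 (HopfObj.antipode (X := H)))
    | .coanti .H => some (b11 t)
    | .mul .K => some (b21 μ[K])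
    | .one .K => some (b01 η[K])
    | .comul .K => some (b12 Δ[K])
    | .counit .K => some (b10 ε[K])
    | .anti .K => some (b11 (HopfObj.antipode (X := K)))
    | .pair .K .H => some (b20 p)
    | .copair .H .K => some (b02 c)
    | .act .K .H => some (b21 (hitAct p))
    | .mul .E => some (b21 (smashMul μ[H] μ[K] (hitAct p)))
    | .one .E => some (b01 ((λ_ _).inv ≫ (η[H] ⊗ₘ η[K])))
    | .join .H .K .E => some (b21 (𝟙 (H ⊗ K)))
    | .split .H .K .E => some (b12 (𝟙 (H ⊗ K)))
    | .act .E .H => some (b21 ((α_ _ _ _).hom ≫ H ◁ hitAct p ≫ μ[H]))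
    | .cleave .K .E => some (b11 (cleaving p c t t))
    | .cleaveInv .K .E => some (b11 (cleaving p c t (𝟙 _)))
    | _ => none

end Model

open Model

section
variable {H K : C} [HopfObj H] [HopfObj K] {p : K ⊗ H ⟶ 𝟙_ C} {c : 𝟙_ C ⟶ H ⊗ K}
  {R : Mon C} {ψ : R.X ⟶ R.X ⊗ K} {t : H ⟶ H}

theorem IsHopfDual.isCoaction (h : IsHopfDual H K p c) (hψ : IsComoduleAlgebra K R ψ)
    (ht : HopfObj.antipode (X := H) ≫ t = 𝟙 H) (ht' : t ≫ HopfObj.antipode (X := H) = 𝟙 H) :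
    (coaction H K p c R ψ t).Coaction := by
  letI : HopfObj ((coaction H K p c R ψ t).obj .H) := inferInstanceAs (HopfObj H)
  letI : HopfObj ((coaction H K p c R ψ t).obj .K) := inferInstanceAs (HopfObj K)
  letI : MonObj ((coaction H K p c R ψ t).obj .R) := R.mon
  obtain ⟨i₁, i₂, i₃⟩ := monoid_iff (M := coaction H K p c R ψ t) (x := .R) rfl rfl
  obtain ⟨j₁, j₂, j₃, j₄⟩ := comodule_iff (M := coaction H K p c R ψ t) (w := .R) (y := .K)
    rfl rfl rfl rfl rfl rfl rfl
  exact { total := by intro g hg; unfold coactionBox at hg; split at hg <;> first | rfl | cases hg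
          dual := (isDual_iff (M := coaction H K p c R ψ t) (x := .H) (y := .K)
            rfl rfl rfl rfl rfl rfl rfl rfl rfl rfl rfl rfl).2 h
          monoid_R := ⟨i₁.2 R.mon.mul_assoc, i₂.2 R.mon.one_mul,
            i₃.2 R.mon.mul_one⟩
          antipode_inv := (retraction_iff (M := coaction H K p c R ψ t) (x := .H) rfl rfl).2 ht
          inv_antipode := (section_iff (M := coaction H K p c R ψ t) (x := .H) rfl rfl).2 ht'
          coassoc := j₁.2 hψ.coassoc
          counit := j₂.2 hψ.counit
          map_one := j₃.2 hψ.map_one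
          map_mul := j₄.2 hψ.map_mul
          act_def := (coactionAct_iff (M := coaction H K p c R ψ t) rfl rfl rfl).2 rfl
          hit_def := (hitAct_iff (M := coaction H K p c R ψ t) rfl rfl rfl).2 rfl }

namespace Model.Coaction

theorem isModuleAlgebra_coactionAct (h : (coaction H K p c R ψ t).Coaction) :
    IsModuleAlgebra H R (coactionAct p ψ) := by
  letI : HopfObj ((coaction H K p c R ψ t).obj .H) := inferInstanceAs (HopfObj H)
  letI : HopfObj ((coaction H K p c R ψ t).obj .K) := inferInstanceAs (HopfObj K)
  letI : MonObj ((coaction H K p c R ψ t).obj .R) := R.mon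
  obtain ⟨i₁, i₂, i₃, i₄⟩ := moduleAlgebra_iff (M := coaction H K p c R ψ t) (x := .R) (y := .H)
    rfl rfl rfl rfl rfl rfl rfl
  exact ⟨i₁.1 h.one_act, i₂.1 h.mul_act, i₃.1 h.act_one, i₄.1 h.act_mul⟩

theorem isModuleAlgebra_hitAct (h : (coaction H K p c R ψ t).Coaction) :
    IsModuleAlgebra K (Mon.mk H) (hitAct p) := by
  letI : HopfObj ((coaction H K p c R ψ t).obj .H) := inferInstanceAs (HopfObj H)
  letI : HopfObj ((coaction H K p c R ψ t).obj .K) := inferInstanceAs (HopfObj K)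
  letI : MonObj ((coaction H K p c R ψ t).obj .R) := R.mon
  obtain ⟨i₁, i₂, i₃, i₄⟩ := moduleAlgebra_iff (M := coaction H K p c R ψ t) (x := .H) (y := .K)
    rfl rfl rfl rfl rfl rfl rfl
  exact ⟨i₁.1 h.one_hit, i₂.1 h.mul_hit, i₃.1 h.hit_one, i₄.1 h.hit_mul⟩

theorem isModuleAlgebra_extendAct (h : (coaction H K p c R ψ t).Coaction) :
    IsModuleAlgebra K (smash h.isModuleAlgebra_coactionAct) (extendAct R.X (hitAct p)) := by
  letI : HopfObj ((coaction H K p c R ψ t).obj .H) := inferInstanceAs (HopfObj H)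
  letI : HopfObj ((coaction H K p c R ψ t).obj .K) := inferInstanceAs (HopfObj K)
  letI : MonObj ((coaction H K p c R ψ t).obj .R) := R.mon
  obtain ⟨i₁, i₂, i₃, i₄⟩ := extendAct_iff (M := coaction H K p c R ψ t) (w := .R) (x := .H)
    (y := .K) rfl rfl rfl rfl rfl rfl rfl rfl rfl rfl rfl
  exact ⟨i₁.1 h.one_extend, i₂.1 h.mul_extend, i₃.1 h.extend_one, i₄.1 h.extend_mul⟩

/-- The object of E is H ⊗ K itself, so joining and splitting are identities and the remaining
definitions hold up to identity morphisms. The monoid laws of E come from the smash product already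
constructed. -/
theorem cleftCoaction (h : (coaction H K p c R ψ t).Coaction) :
    (coaction H K p c R ψ t).CleftCoaction := by
  letI : HopfObj ((coaction H K p c R ψ t).obj .H) := inferInstanceAs (HopfObj H)
  letI : HopfObj ((coaction H K p c R ψ t).obj .K) := inferInstanceAs (HopfObj K)
  letI : MonObj ((coaction H K p c R ψ t).obj .R) := R.mon
  obtain ⟨i₁, i₂, i₃⟩ := monoid_iff (M := coaction H K p c R ψ t) (x := .E) rfl rfl
  obtain ⟨j₁, j₂, j₃, j₄, j₅, j₆, j₇⟩ := smash_iff (M := coaction H K p c R ψ t) (x := .H)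
    (y := .K) (z := .E) rfl rfl rfl rfl rfl rfl rfl rfl rfl rfl rfl rfl rfl rfl rfl rfl rfl rfl rfl
  exact { h with
          monoid_E := ⟨i₁.2 ((smash h.isModuleAlgebra_hitAct).mon.mul_assoc),
            i₂.2 ((smash h.isModuleAlgebra_hitAct).mon.one_mul),
            i₃.2 ((smash h.isModuleAlgebra_hitAct).mon.mul_one)⟩
          join_split := j₁.2 (Category.comp_id (𝟙 (H ⊗ K)))
          split_join := j₂.2 (Category.comp_id (𝟙 (H ⊗ K)))
          mul_def := j₃.2 (show smashMul μ[H] μ[K] (hitAct p) = (𝟙 (H ⊗ K) ⊗ₘ 𝟙 (H ⊗ K)) ≫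
            smashMul μ[H] μ[K] (hitAct p) ≫ 𝟙 _ by simp)
          one_def := j₄.2 (show (λ_ _).inv ≫ (η[H] ⊗ₘ η[K]) =
            (λ_ _).inv ≫ (η[H] ⊗ₘ η[K]) ≫ 𝟙 (H ⊗ K) by simp)
          rep_def := j₅.2 (show (α_ _ _ _).hom ≫ H ◁ hitAct p ≫ μ[H] =
            𝟙 (H ⊗ K) ▷ H ≫ (α_ _ _ _).hom ≫ H ◁ hitAct p ≫ μ[H] by simp)
          cleave_def := j₆.2 (Category.comp_id _).symm
          cleaveInv_def := j₇.2 (Category.comp_id _).symm }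

/-- The duality isomorphism `(R # H) # K ≅ R ⊗ (H # K)`. -/
theorem nonempty_iso (h : (coaction H K p c R ψ t).Coaction) :
    Nonempty (smash h.isModuleAlgebra_extendAct ≅ R ⊗ smash h.isModuleAlgebra_hitAct) := by
  letI : HopfObj ((coaction H K p c R ψ t).obj .H) := inferInstanceAs (HopfObj H)
  letI : HopfObj ((coaction H K p c R ψ t).obj .K) := inferInstanceAs (HopfObj K)
  letI : MonObj ((coaction H K p c R ψ t).obj .R) := R.mon
  obtain ⟨i₁, i₂, i₃, i₄⟩ := galois_iff (M := coaction H K p c R ψ t) (w := .R) (x := .H) (y := .K)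
    (z := .E) rfl rfl rfl rfl rfl rfl rfl rfl rfl rfl rfl rfl rfl rfl rfl rfl rfl
  have hm := i₁.1 h.cleftCoaction.duality_mul
  have hu := i₂.1 h.cleftCoaction.duality_one
  let e : (R.X ⊗ H) ⊗ K ≅ R.X ⊗ (H ⊗ K) := α_ R.X H K ≪≫
    ⟨galois ψ (cleaving p c t t) (smashMul μ[H] μ[K] (hitAct p)),
      galois ψ (cleaving p c t (𝟙 _)) (smashMul μ[H] μ[K] (hitAct p)),
      i₄.1 h.cleftCoaction.cleave_cancel, i₃.1 h.cleftCoaction.cleaveInv_cancel⟩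
  -- The identity in the middle is the value of the box that joins H and K to E; it has to be
  -- present to match `hm` and `hu`.
  have he : (α_ R.X H K).hom ≫ R.X ◁ 𝟙 (H ⊗ K) ≫
      galois ψ (cleaving p c t t) (smashMul μ[H] μ[K] (hitAct p)) = e.hom := by simp [e]
  refine ⟨Mon.mkIso (M := smash h.isModuleAlgebra_extendAct)
    (N := R ⊗ smash h.isModuleAlgebra_hitAct) e ?_ ?_⟩
  · refine Eq.trans ?_ (hu.trans ?_)
    · rw [← he]; rfl
    · rfl
  · rw [tensorHom_def', Category.assoc, ← he]
    exact hm

end Model.Coaction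

end

end BraidedDuality

/-- `ExactPairing H Hs` says that `Hs` is the left dual `H*` of `H`,
    with evaluation `H* ⊗ H ⟶ I` and
coevaluation `I ⟶ H ⊗ H*`; `Mon C` is the category of algebras in `C`. -/
theorem corollary1p9 {C : Type u} [Category.{v} C] [MonoidalCategory C] [BraidedCategory C]
    (H Hs : C) [HopfObj H] [ExactPairing H Hs]
    (hsymm : (β_ H H).hom = (β_ H H).inv) :
    ∃ D : HopfObj Hs,
      BraidedDuality.IsQuasiDual Hs H (ExactPairing.evaluation H Hs) ∧
      (∀ D' : HopfObj Hs,
        @BraidedDuality.IsQuasiDual C _ _ _ Hs H D' _ (ExactPairing.evaluation H Hs) → D' = D) ∧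
      ∀ (R : Mon C) (ψ : R.X ⟶ R.X ⊗ Hs), BraidedDuality.IsComoduleAlgebra Hs R ψ →
        ∃ (hR : BraidedDuality.IsModuleAlgebra H R
              (BraidedDuality.coactionAct (ExactPairing.evaluation H Hs) ψ))
          (hH : BraidedDuality.IsModuleAlgebra Hs (Mon.mk H)
              (BraidedDuality.hitAct (ExactPairing.evaluation H Hs)))
          (hRH : BraidedDuality.IsModuleAlgebra Hs (BraidedDuality.smash hR)
              (BraidedDuality.extendAct R.X
                (BraidedDuality.hitAct (ExactPairing.evaluation H Hs)))),
          Nonempty (BraidedDuality.smash hRH ≅ R ⊗ BraidedDuality.smash hH) := by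
  have hS : BraidedDuality.IsSymmDual H Hs (ExactPairing.evaluation H Hs)
      (ExactPairing.coevaluation H Hs) :=
    -- Replacing one factor of C² by C⁻¹ turns the hypothesis into C² = 1; the two zigzag identities
    -- are those of the exact pairing.
    ⟨by
      nth_rewrite 1 [hsymm]; exact Iso.inv_hom_id _, by simp, by simp⟩
  refine ⟨hS.hopf, hS.isQuasiDual_hopf,
    fun D' hD' => hS.hopf_unique D' hS.hopf hD' hS.isQuasiDual_hopf, fun R ψ hψ => ?_⟩
  letI := hS.hopf
  have h : BraidedDuality.IsHopfDual H Hs (ExactPairing.evaluation H Hs)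
      (ExactPairing.coevaluation H Hs) := { hS, hS.isQuasiDual_hopf with }
  -- The two-sided inverse of the antipode of H, from which the cleaving map is built.
  obtain ⟨t, ht, ht'⟩ := h.exists_inv
  have hc := h.isCoaction hψ ht ht'
  exact ⟨hc.isModuleAlgebra_coactionAct, hc.isModuleAlgebra_hitAct, hc.isModuleAlgebra_extendAct,
    hc.nonempty_iso⟩
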